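/- Let $1\le k\le n-1$, $1\le p<n/k$, and let $f\in L^p(\mathbb R^n)$ be real- or complex-valued. An affine $k$-plane is written $\tau=(\zeta,u)$, where $\zeta$ is a $k$-dimensional linear subspace of $\mathbb R^n$ and $u\in\zeta^\perp$. Put $(Rf)(\zeta,u)=\int_\zeta f(u+v)\,dv$. For a function $\varphi$ on the set of $k$-planes, $x\in\mathbb R^n$ and $r>0$, put $$(R_x^*\varphi)(r)=\int_{SO(n)}\varphi(\gamma\mathbb R^k+x+r\gamma e_n)\,d\gamma ,\qquad \mathbb R^k=\mathbb Re_1\oplus\dots\oplus\mathbb Re_k,$$ where $d\gamma$ is the Haar probability measure. For $\alpha>0$ and $F$ on $(0,\infty)$ let $$(I^\alpha_{-,2}F)(t)=\frac{2}{\Gamma(\alpha)}\int_t^\infty F(s)\,s\,(s^2-t^2)^{\alpha-1}\,ds,\qquad D=\frac1{2t}\frac{d}{dt},$$ and let $m=[k/2]$ be the integer part of $k/2$. Consider the following expressions for the derivative $\mathcal D^{k/2}_{-,2}F$: (a) if $k$ is even, $\mathcal D^{k/2}_{-,2}F=(-D)^{k/2}F$; (b) $\mathcal D^{k/2}_{-,2}F=t^{2-k+2m}(-D)^{m+1}\,t^{k}\psi$,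 where $\psi=I^{1-k/2+m}_{-,2}\,t^{-2m-2}F$; (c) $\mathcal D^{k/2}_{-,2}F=2^{-k}\left(-\frac{d}{dt}\right)^{k} t\,I^{k/2}_{-,2}\,t^{-k-1}F$; (d) if $p<n/(2+2[k/2])$, $\mathcal D^{k/2}_{-,2}F=(-D)^{m+1}I^{1-k/2+m}_{-,2}F$. Let $\varphi=Rf$. The integrals defining $(R_x^*\varphi)(t)$ converge absolutely, that is, $Rf$ is given by an absolutely convergent integral at almost every plane $\gamma\mathbb R^k+x+t\gamma e_n$ and is integrable in $\gamma$: for almost every $x$ at almost every $t>0$; for every $t>0$ at almost every $x$; and, if $k$ is even, for almost every $x$ at every $t>0$. Further, with $\mathcal D^{k/2}_{-,2}$ computed by any of the expressions (a)--(d) under the condition stated there, for every $t>0$ the value $(\mathcal D^{k/2}_{-,2}R_x^*\varphi)(t)$ is defined for almost every $x\in\mathbb R^n$ (the fractional integral occurring in it converges absolutely on $(0,\infty)$, and the derivatives exist in the classical sense, those of lower order everywhere on $(0,\infty)$ and the last one at $t$), it belongs to $L^p(\mathbb R^n)$ as a function of $x$, and $$f(x)=\lim_{t\to0}\pi^{-k/2}\,(\mathcal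 D^{k/2}_{-,2}R_x^*\varphi)(t)\quad\text{for almost every }x,$$ where the limit is understood in the $L^p(\mathbb R^n)$-norm. -/

import Mathlib

open MeasureTheory Filter Topology
open scoped ENNReal

namespace KPlaneTransform

noncomputable section

/-- `ℝⁿ` with its Euclidean structure and Lebesgue measure. -/
abbrev E (n : ℕ) : Type := EuclideanSpace ℝ (Fin n)

/-! ### The rotation group and its invariant probability measure -/

/-- The rotation group `SO(n)`: real `n × n` matrices with `γ γᵀ = 1` and `det γ = 1`
(the star operation of `ℝ` is trivial, so that the star of a real matrix is its transpose). -/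
abbrev SO (n : ℕ) : Type := Matrix.specialUnitaryGroup (Fin n) ℝ

theorem SO.coe_inv {n : ℕ} (γ : SO n) :
    ((γ⁻¹ : SO n) : Matrix (Fin n) (Fin n) ℝ) = star (γ : Matrix (Fin n) (Fin n) ℝ) := rfl

instance (n : ℕ) : IsTopologicalGroup (SO n) where
  continuous_inv := by
    refine Continuous.subtype_mk (f := fun γ : SO n => star (γ : Matrix (Fin n) (Fin n) ℝ)) ?_ _
    exact Continuous.matrix_conjTranspose continuous_subtype_val

instance (n : ℕ) : CompactSpace (SO n) := by
  refine isCompact_iff_compactSpace.mp ?_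
  have hbox : IsCompact (Set.pi Set.univ fun _ : Fin n =>
      Set.pi Set.univ fun _ : Fin n => Set.Icc (-1 : ℝ) 1) :=
    isCompact_univ_pi fun _ => isCompact_univ_pi fun _ => isCompact_Icc
  refine IsCompact.of_isClosed_subset (X := Matrix (Fin n) (Fin n) ℝ) hbox ?_ ?_
  · have h1 : IsClosed {A : Matrix (Fin n) (Fin n) ℝ | A * star A = 1} :=
      isClosed_eq (continuous_id.mul (Continuous.matrix_conjTranspose continuous_id))
        continuous_const
    have h2 : IsClosed {A : Matrix (Fin n) (Fin n) ℝ | A.det = 1} :=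
      isClosed_eq (Continuous.matrix_det continuous_id) continuous_const
    have h3 : ((Matrix.specialUnitaryGroup (Fin n) ℝ : Submonoid (Matrix (Fin n) (Fin n) ℝ)) :
        Set (Matrix (Fin n) (Fin n) ℝ)) = {A | A * star A = 1} ∩ {A | A.det = 1} := by
      ext A
      simp only [SetLike.mem_coe, Matrix.mem_specialUnitaryGroup_iff, Matrix.mem_unitaryGroup_iff,
        Set.mem_inter_iff, Set.mem_ofPred_eq]
    rw [h3]
    exact h1.inter h2
  · intro A hA i _ j _
    have h := entry_norm_bound_of_unitary hA.1 i j
    rw [Real.norm_eq_abs, abs_le] at h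
    exact h

instance (n : ℕ) : MeasurableSpace (SO n) := borel _

instance (n : ℕ) : BorelSpace (SO n) := ⟨rfl⟩

/-- The Haar measure of `SO(n)` of total mass one. -/
def haarSO (n : ℕ) : Measure (SO n) := Measure.haarMeasure ⊤

/-- The action of a rotation on `ℝⁿ`. -/
def rot {n : ℕ} (γ : SO n) : E n →ₗ[ℝ] E n :=
  Matrix.toEuclideanLin (γ : Matrix (Fin n) (Fin n) ℝ)

theorem rot_injective {n : ℕ} (γ : SO n) : Function.Injective (rot γ) := by
  intro v w hvw
  have key : ∀ u : E n,
      Matrix.toEuclideanLin (star (γ : Matrix (Fin n) (Fin n) ℝ)) (rot γ u) = u := by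
    intro u
    have h : star (γ : Matrix (Fin n) (Fin n) ℝ) * (γ : Matrix (Fin n) (Fin n) ℝ) = 1 :=
      Matrix.mem_unitaryGroup_iff'.mp γ.2.1
    ext i
    simp [rot, Matrix.toLpLin_apply, Matrix.mulVec_mulVec, h]
  rw [← key v, hvw, key w]

/-! ### `k`-planes and the `k`-plane transform -/

/-- An affine `k`-plane `τ = ζ + u` of `ℝⁿ`, parameterized by its direction `ζ`, a `k`-dimensional
linear subspace, and by `u ∈ ζᗮ`. -/
structure KPlane (n k : ℕ) where
  /-- the direction `ζ` -/
  dir : Submodule ℝ (E n)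
  finrank_dir : Module.finrank ℝ dir = k
  /-- the point `u` of the plane in `ζᗮ` -/
  base : E n
  base_mem : base ∈ dirᗮ

/-- The `k`-plane with direction `ζ` through the point `y`. -/
def KPlane.through {n k : ℕ} (ζ : Submodule ℝ (E n)) (hζ : Module.finrank ℝ ζ = k) (y : E n) :
    KPlane n k where
  dir := ζ
  finrank_dir := hζ
  base := ζᗮ.starProjection y
  base_mem := Submodule.starProjection_apply_mem _ _

variable {𝕜 : Type*} [RCLike 𝕜]

/-- The `k`-plane transform `(Rf)(ζ, u) = ∫_ζ f(u + v) dv`, where `dv` is the Lebesgue measure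
of the Euclidean space `ζ`. -/
def kPlaneTransform {n : ℕ} (k : ℕ) (f : E n → 𝕜) (τ : KPlane n k) : 𝕜 :=
  ∫ v : τ.dir, f (τ.base + v)

/-- The integral defining `(Rf)(τ)` converges absolutely. -/
def KPlaneConverges {n : ℕ} (k : ℕ) (f : E n → 𝕜) (τ : KPlane n k) : Prop :=
  Integrable (fun v : τ.dir => f (τ.base + v))

/-- The coordinate plane `ℝᵏ = ℝe₁ ⊕ ⋯ ⊕ ℝeₖ` in `ℝⁿ`. -/
def coordPlane {n k : ℕ} (h : k < n) : Submodule ℝ (E n) :=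
  Submodule.span ℝ (Set.range fun i : Fin k => EuclideanSpace.single (Fin.castLE h.le i) (1 : ℝ))

/-- The last coordinate unit vector `eₙ` of `ℝⁿ`. -/
def lastVec {n k : ℕ} (h : k < n) : E n :=
  EuclideanSpace.single (⟨n - 1, by omega⟩ : Fin n) (1 : ℝ)

theorem finrank_rot_coordPlane {n k : ℕ} (h : k < n) (γ : SO n) :
    Module.finrank ℝ ((coordPlane h).map (rot γ)) = k := by
  rw [← LinearEquiv.finrank_eq (Submodule.equivMapOfInjective (rot γ) (rot_injective γ) _)]
  have hli : LinearIndependent ℝ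
      (fun i : Fin k => (EuclideanSpace.single (Fin.castLE h.le i) (1 : ℝ) : E n)) := by
    have h1 := (EuclideanSpace.basisFun (Fin n) ℝ).orthonormal.linearIndependent.comp
      (Fin.castLE h.le) (Fin.castLE_injective h.le)
    have h2 : (fun i : Fin k => (EuclideanSpace.single (Fin.castLE h.le i) (1 : ℝ) : E n)) =
        (EuclideanSpace.basisFun (Fin n) ℝ) ∘ Fin.castLE h.le := by
      funext i
      simp
    rw [h2]
    exact h1
  rw [coordPlane, finrank_span_eq_card hli, Fintype.card_fin]

/-- The `k`-plane `γℝᵏ + x + rγeₙ`, which lies at distance `r` from `x`. -/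
def planeAt {n k : ℕ} (h : k < n) (x : E n) (r : ℝ) (γ : SO n) : KPlane n k :=
  KPlane.through ((coordPlane h).map (rot γ)) (finrank_rot_coordPlane h γ)
    (x + r • rot γ (lastVec h))

/-- The mean `(R*ₓ φ)(r) = ∫_{SO(n)} φ(γℝᵏ + x + rγeₙ) dγ` of `φ` over the `k`-planes at distance
`r` from `x`. -/
def dualMean {n k : ℕ} (h : k < n) (φ : KPlane n k → 𝕜) (x : E n) (r : ℝ) : 𝕜 :=
  ∫ γ, φ (planeAt h x r γ) ∂(haarSO n)

/-- The iterated integral `(R*ₓ Rf)(r)` makes sense: `Rf` is defined by an absolutely convergent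
integral at almost every `k`-plane at distance `r` from `x`, and it is integrable over these
planes. -/
def DualMeanConverges {n k : ℕ} (h : k < n) (f : E n → 𝕜) (x : E n) (r : ℝ) : Prop :=
  (∀ᵐ γ ∂(haarSO n), KPlaneConverges k f (planeAt h x r γ)) ∧
    Integrable (fun γ => kPlaneTransform k f (planeAt h x r γ)) (haarSO n)

/-! ### Erdélyi–Kober integrals and differential operators on `(0, ∞)` -/

/-- The modified Erdélyi–Kober integral
`(I^α_{-,2} F)(t) = (2 / Γ(α)) ∫_t^∞ F(s) s (s² - t²)^(α - 1) ds`. -/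
def ekInt (α : ℝ) (F : ℝ → 𝕜) (t : ℝ) : 𝕜 :=
  (2 / Real.Gamma α) • ∫ s in Set.Ioi t, (s * (s ^ 2 - t ^ 2) ^ (α - 1)) • F s

/-- The integral defining `(I^α_{-,2} F)(t)` converges absolutely. -/
def EkConverges (α : ℝ) (F : ℝ → 𝕜) (t : ℝ) : Prop :=
  IntegrableOn (fun s => (s * (s ^ 2 - t ^ 2) ^ (α - 1)) • F s) (Set.Ioi t)

/-- `-d/dt`. -/
def negDeriv (F : ℝ → 𝕜) (t : ℝ) : 𝕜 := -deriv F t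

/-- `-D`, where `D = (1 / 2t) d/dt`. -/
def negD (F : ℝ → 𝕜) (t : ℝ) : 𝕜 := -((1 / (2 * t)) • deriv F t)

/-- For a first order operator `L` (`-d/dt` or `-D`), the `j`-fold derivative `(L^j F)(t)` exists
in the classical sense: `F, L F, …, L^(j-2) F` are differentiable on `(0, ∞)` and `L^(j-1) F` is
differentiable at `t`. -/
def IterDiffAt (L : (ℝ → 𝕜) → ℝ → 𝕜) (j : ℕ) (F : ℝ → 𝕜) (t : ℝ) : Prop :=
  ∀ i < j, DifferentiableAt ℝ (L^[i] F) t ∧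
    (i + 1 < j → ∀ s : ℝ, 0 < s → DifferentiableAt ℝ (L^[i] F) s)

/-! ### The forms of the Erdélyi–Kober derivative of order `k / 2`

Here `m = [k / 2]` is the integer part, `k / 2` in natural numbers. Each form comes with the
condition that it is defined at `t`: the integral in it converges absolutely on `(0, ∞)` and
the derivatives in it exist. -/

/-- `(-D)^(k/2) F` (for even `k`). -/
def evenForm (k : ℕ) (F : ℝ → 𝕜) : ℝ → 𝕜 := negD^[k / 2] F

/-- `evenForm` is defined at `t`. -/
def EvenFormExists (k : ℕ) (F : ℝ → 𝕜) (t : ℝ) : Prop := IterDiffAt negD (k / 2) F t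

/-- `t^k ψ(t)` with `ψ = I^(1 - k/2 + m)_{-,2} t^(-2m - 2) F`. -/
def weightedPsi (k : ℕ) (F : ℝ → 𝕜) (t : ℝ) : 𝕜 :=
  t ^ k • ekInt (1 - (k : ℝ) / 2 + (k / 2 : ℕ)) (fun s => (s ^ (2 * (k / 2) + 2))⁻¹ • F s) t

/-- `t^(2 - k + 2m) (-D)^(m + 1) t^k ψ`, `ψ = I^(1 - k/2 + m)_{-,2} t^(-2m - 2) F`. -/
def weightedForm (k : ℕ) (F : ℝ → 𝕜) (t : ℝ) : 𝕜 :=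
  t ^ (2 - (k : ℤ) + 2 * (k / 2 : ℕ)) • negD^[k / 2 + 1] (weightedPsi k F) t

/-- `weightedForm` is defined at `t`. -/
def WeightedFormExists (k : ℕ) (F : ℝ → 𝕜) (t : ℝ) : Prop :=
  (∀ s : ℝ, 0 < s → EkConverges (1 - (k : ℝ) / 2 + (k / 2 : ℕ))
    (fun s => (s ^ (2 * (k / 2) + 2))⁻¹ • F s) s) ∧
  IterDiffAt negD (k / 2 + 1) (weightedPsi k F) t

/-- `t I^(k/2)_{-,2} t^(-k-1) F`. -/
def ordinaryInner (k : ℕ) (F : ℝ → 𝕜) (t : ℝ) : 𝕜 :=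
  t • ekInt ((k : ℝ) / 2) (fun s => (s ^ (k + 1))⁻¹ • F s) t

/-- `2^(-k) (-d/dt)^k t I^(k/2)_{-,2} t^(-k-1) F`. -/
def ordinaryForm (k : ℕ) (F : ℝ → 𝕜) (t : ℝ) : 𝕜 :=
  ((2 : ℝ) ^ k)⁻¹ • negDeriv^[k] (ordinaryInner k F) t

/-- `ordinaryForm` is defined at `t`. -/
def OrdinaryFormExists (k : ℕ) (F : ℝ → 𝕜) (t : ℝ) : Prop :=
  (∀ s : ℝ, 0 < s → EkConverges ((k : ℝ) / 2) (fun s => (s ^ (k + 1))⁻¹ • F s) s) ∧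
  IterDiffAt negDeriv k (ordinaryInner k F) t

/-- `(-D)^(m + 1) I^(1 - k/2 + m)_{-,2} F`. -/
def directForm (k : ℕ) (F : ℝ → 𝕜) : ℝ → 𝕜 :=
  negD^[k / 2 + 1] (ekInt (1 - (k : ℝ) / 2 + (k / 2 : ℕ)) F)

/-- `directForm` is defined at `t`. -/
def DirectFormExists (k : ℕ) (F : ℝ → 𝕜) (t : ℝ) : Prop :=
  (∀ s : ℝ, 0 < s → EkConverges (1 - (k : ℝ) / 2 + (k / 2 : ℕ)) F s) ∧
  IterDiffAt negD (k / 2 + 1) (ekInt (1 - (k : ℝ) / 2 + (k / 2 : ℕ)) F) t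

/-! ### Recovery of a function in the `L^p` norm -/

/-- The formula `f(x) = lim_{t → 0} π^(-k/2) (𝒟 R*ₓ φ)(t)`, with the limit in the `L^p` norm, where
`𝒟` is an operator on functions on `(0, ∞)` and `dom F t` says that `(𝒟 F)(t)` is defined: for every
`t > 0`, the right-hand side is defined for almost all `x` and belongs to `L^p` as a function of `x`,
and it converges to `f` in the `L^p` norm as `t → 0`. -/
def RecoversInLp {n k : ℕ} (h : k < n) (p : ℝ) (φ : KPlane n k → 𝕜) (f : E n → 𝕜)
    (𝒟 : (ℝ → 𝕜) → ℝ → 𝕜) (dom : (ℝ → 𝕜) → ℝ → Prop) : Prop :=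
  (∀ t : ℝ, 0 < t → ∀ᵐ x : E n, dom (dualMean h φ x) t) ∧
  (∀ t : ℝ, 0 < t → MemLp (fun x : E n => Real.pi ^ (-(k : ℝ) / 2) • 𝒟 (dualMean h φ x) t)
    (ENNReal.ofReal p) volume) ∧
  Tendsto (fun t : ℝ => eLpNorm
      (fun x : E n => Real.pi ^ (-(k : ℝ) / 2) • 𝒟 (dualMean h φ x) t - f x)
      (ENNReal.ofReal p) volume)
    (𝓝[>] 0) (𝓝 0)

end

end KPlaneTransform

namespace KPlaneTransform
noncomputable section
variable {𝕜 : Type*} [RCLike 𝕜]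

/-! ### Rotations and the invariant measure -/

/-! Everything reduces to the spherical means M_s f(x), the averages of f over the sphere of radius
s about x. A point γ(t eₙ + v) with v in ℝᵏ has norm √(t² + |v|²), and when γ is Haar distributed
its position on that sphere is uniform. Polar coordinates in v therefore turn the mean over k-planes
at distance t from x into (R*ₓ Rf)(t) = σₖ ∫_t^∞ (s² - t²)^(k/2 - 1) s M_s f(x) ds, which is π^(k/2)
I^(k/2)_{-,2} applied to s ↦ M_s f(x). This is `map_planePt` and `dualMean_eq`. Convergence follows
from Hölder's inequality at infinity (`lintegral_pow_sphMeanE_lt_top`) and, near the singularity s =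
t, from integrating over the centre x or over the radius t.

With x fixed, each expression for the derivative inverts this fractional integral. Composing it with
a second Erdélyi–Kober integral, possibly weighted, gives a kernel computed by a beta integral: up
to explicit powers it is (u² - r²)^m u, or (u - r)^(k-1) in the ordinary form. The composition is
thus an iterated primitive, with respect to s² or to s, of a continuous multiple of s ↦ M_s f(x),
and differentiating it the right number of times returns π^(k/2) M_t f(x)
(`IsScale.iterate_iterPrim`). All derivatives but the last exist everywhere; the last exists at t
when t is a Lebesgue point of s ↦ M_s f(x), where the value taken at t itself counts.

The delicate point is that the radius t is prescribed: for every t, almost every x must make t a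
Lebesgue point, while Fubini only gives almost every t. The sphere of radius t is covered by
finitely many graphs over coordinate hyperplanes, and a thin shell by neighbourhoods of these
graphs. Integrating over such a neighbourhood averages a cap integral along a coordinate line in x,
so one-dimensional Lebesgue differentiation controls the shell averages for almost every x
(`ae_eventually_shell_le`). Approximation of f by continuous functions then gives
`ae_isLebesguePoint_sphMean`.

Hence, for every t and almost every x, π^(-k/2) times the derivative at t equals M_t f(x). By
Jensen's inequality and the continuity of translations in L^p, M_t f belongs to L^p and tends to f
in norm as t → 0. -/

instance (n : ℕ) : SecondCountableTopology (SO n) := by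
  have : SecondCountableTopology (Matrix (Fin n) (Fin n) ℝ) :=
    inferInstanceAs (SecondCountableTopology (Fin n → Fin n → ℝ))
  exact Topology.IsEmbedding.subtypeVal.secondCountableTopology

instance (n : ℕ) : IsProbabilityMeasure (haarSO n) :=
  ⟨Measure.haarMeasure_self (K₀ := (⊤ : TopologicalSpace.PositiveCompacts (SO n)))⟩

instance (n : ℕ) : (haarSO n).IsHaarMeasure := by unfold haarSO; infer_instance

/-- A compact group is unimodular: a right translate of Haar measure is again a left Haar
probability measure, hence the same one. -/
instance (n : ℕ) : (haarSO n).IsMulRightInvariant where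
  map_mul_right_eq_self g := by
    have : IsProbabilityMeasure ((haarSO n).map (· * g)) :=
      Measure.isProbabilityMeasure_map (measurable_mul_const g).aemeasurable
    exact Measure.isHaarMeasure_eq_of_isProbabilityMeasure _ _

theorem rot_apply {n : ℕ} (γ : SO n) (x : E n) (i : Fin n) :
    rot γ x i = ∑ j, (γ : Matrix (Fin n) (Fin n) ℝ) i j * x j := by
  simp [rot, Matrix.toLpLin_apply, Matrix.mulVec, dotProduct]

theorem rot_mul {n : ℕ} (γ γ' : SO n) (x : E n) : rot (γ * γ') x = rot γ (rot γ' x) := by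
  ext i
  simp [rot, Matrix.toLpLin_apply, Matrix.mulVec_mulVec]

theorem norm_rot {n : ℕ} (γ : SO n) (x : E n) : ‖rot γ x‖ = ‖x‖ := by
  have h : star (γ : Matrix (Fin n) (Fin n) ℝ) * (γ : Matrix (Fin n) (Fin n) ℝ) = 1 :=
    Matrix.mem_unitaryGroup_iff'.mp γ.2.1
  have h2 : inner ℝ (rot γ x) (rot γ x) = inner ℝ x x := by
    simp only [rot, EuclideanSpace.inner_eq_star_dotProduct, Matrix.ofLp_toLpLin,
      Matrix.toLin'_apply, star_trivial]
    rw [Matrix.dotProduct_mulVec, Matrix.vecMul_mulVec, ← Matrix.dotProduct_mulVec]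
    have h3 : (γ : Matrix (Fin n) (Fin n) ℝ).transpose * (γ : Matrix (Fin n) (Fin n) ℝ) = 1 := by
      rw [← h, Matrix.star_eq_conjTranspose, Matrix.conjTranspose_eq_transpose_of_trivial]
    rw [h3, Matrix.one_mulVec]
  rw [real_inner_self_eq_norm_sq, real_inner_self_eq_norm_sq] at h2
  exact (sq_eq_sq₀ (norm_nonneg _) (norm_nonneg _)).mp h2

/-- A rotation as a linear isometry. -/
def rotIso {n : ℕ} (γ : SO n) : E n ≃ₗᵢ[ℝ] E n :=
  (LinearIsometry.mk (rot γ) (norm_rot γ)).toLinearIsometryEquiv rfl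

theorem continuous_rot_uncurry (n : ℕ) : Continuous fun q : SO n × E n => rot q.1 q.2 := by
  refine (PiLp.continuous_toLp 2 _).comp (f := fun q : SO n × E n => fun i => rot q.1 q.2 i) ?_
  refine continuous_pi fun i => ?_
  simp only [rot_apply]
  refine continuous_finsetSum _ fun j _ => ?_
  have h1 : Continuous fun q : SO n × E n => (q.1 : Matrix (Fin n) (Fin n) ℝ) i j :=
    (continuous_subtype_val.comp continuous_fst).matrix_elem i j
  have h2 : Continuous fun q : SO n × E n => q.2 j := by fun_prop
  exact h1.mul h2

theorem continuous_rot_left {n : ℕ} (x : E n) : Continuous fun γ : SO n => rot γ x :=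
  (continuous_rot_uncurry n).comp (continuous_id.prodMk continuous_const)

theorem measurePreserving_rot {n : ℕ} (γ : SO n) :
    MeasurePreserving (rot γ) (volume : Measure (E n)) volume :=
  (rotIso γ).measurePreserving

theorem norm_lastVec {n k : ℕ} (h : k < n) : ‖lastVec h‖ = 1 := by
  simp [lastVec]

/-- Complete ω to an orthonormal basis with ω in last position and use it as the columns of a
matrix. Since 1 ≤ k < n forces n ≥ 2, the determinant can be corrected in the first column without
touching the last. -/
theorem exists_rot_lastVec {n k : ℕ} (hk : 1 ≤ k) (h : k < n) (ω : E n) (hω : ‖ω‖ = 1) :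
    ∃ γ : SO n, rot γ (lastVec h) = ω := by
  classical
  set l : Fin n := ⟨n - 1, by omega⟩ with hl
  let z : Fin n := ⟨0, by omega⟩
  have hzl : z ≠ l := by simp [z, hl, Fin.ext_iff]; omega
  have hon : Orthonormal ℝ (({l} : Set (Fin n)).domRestrict fun _ => ω) := by
    rw [orthonormal_iff_ite]
    rintro ⟨i, hi⟩ ⟨j, hj⟩
    obtain rfl : i = l := hi
    obtain rfl : j = l := hj
    simp [hω]
  obtain ⟨b, hb⟩ := hon.exists_orthonormalBasis_extension_of_card_eq (by simp)
  have hbl : b l = ω := hb l rfl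
  let A : Matrix (Fin n) (Fin n) ℝ := Matrix.of fun i j => b j i
  have hA : A.transpose * A = 1 := by
    ext i j
    have := orthonormal_iff_ite.mp b.orthonormal j i
    simp only [Matrix.mul_apply, Matrix.transpose_apply, Matrix.one_apply, A, Matrix.of_apply]
    rw [EuclideanSpace.inner_eq_star_dotProduct] at this
    simp only [dotProduct, star_trivial] at this
    rw [this]; simp [eq_comm]
  have hdet : A.det = 1 ∨ A.det = -1 := by
    have := congrArg Matrix.det hA
    rw [Matrix.det_mul, Matrix.det_transpose, Matrix.det_one] at this
    exact mul_self_eq_one_iff.mp this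
  -- Rescaling the first column by det A = ±1 keeps the columns orthonormal and makes the
  -- determinant (det A)² = 1.
  let d : Fin n → ℝ := fun i => if i = z then A.det else 1
  have hAdd : A.det * A.det = 1 := by rcases hdet with h | h <;> simp [h]
  let B : Matrix (Fin n) (Fin n) ℝ := A * Matrix.diagonal d
  have hB : B.transpose * B = 1 := by
    simp only [B, Matrix.transpose_mul, Matrix.diagonal_transpose]
    rw [Matrix.mul_assoc, ← Matrix.mul_assoc A.transpose, hA, Matrix.one_mul,
      Matrix.diagonal_mul_diagonal]
    rw [← Matrix.diagonal_one]
    congr 1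
    funext i
    by_cases hi : i = z <;> simp [d, hi, hAdd]
  have hBdet : B.det = 1 := by
    simp only [B, Matrix.det_mul, Matrix.det_diagonal, d]
    rw [Finset.prod_ite_eq' Finset.univ z]
    simpa using hAdd
  refine ⟨⟨B, Matrix.mem_specialUnitaryGroup_iff.mpr ⟨Matrix.mem_unitaryGroup_iff'.mpr ?_, hBdet⟩⟩, ?_⟩
  · rw [Matrix.star_eq_conjTranspose, Matrix.conjTranspose_eq_transpose_of_trivial]; exact hB
  · ext i
    rw [rot_apply]
    simp [lastVec, ← hl, B, Matrix.mul_diagonal, A, d, hzl.symm, hbl]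

/-- The average of a function over the rotations of a point depends only on the norm of the
point. -/
theorem lintegral_rot_eq {n k : ℕ} (hk : 1 ≤ k) (h : k < n) (g : E n → ℝ≥0∞) (z : E n) :
    ∫⁻ γ, g (rot γ z) ∂(haarSO n) = ∫⁻ γ, g (‖z‖ • rot γ (lastVec h)) ∂(haarSO n) := by
  obtain ⟨γ₀, h0⟩ : ∃ γ₀ : SO n, ‖z‖ • rot γ₀ (lastVec h) = z := by
    rcases eq_or_ne z 0 with rfl | hz
    · exact ⟨1, by simp⟩
    · obtain ⟨γ₀, h0⟩ := exists_rot_lastVec hk h (‖z‖⁻¹ • z) (by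
        simp [norm_smul, hz])
      exact ⟨γ₀, by rw [h0, smul_smul, mul_inv_cancel₀ (norm_ne_zero_iff.mpr hz), one_smul]⟩
  -- Since z = ‖z‖ γ₀eₙ, moving z means right translation by γ₀, which Haar measure ignores.
  calc ∫⁻ γ, g (rot γ z) ∂(haarSO n)
      = ∫⁻ γ, g (‖z‖ • rot (γ * γ₀) (lastVec h)) ∂(haarSO n) := by
        refine lintegral_congr fun γ => ?_
        rw [rot_mul, ← map_smul, h0]
    _ = _ := lintegral_mul_right_eq_self (μ := haarSO n)
        (fun γ => g (‖z‖ • rot γ (lastVec h))) γ₀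

/-! ### Integration in polar coordinates -/

/-- The area of the unit sphere of `ℝᵈ`. -/
def sphereArea (d : ℕ) : ℝ := 2 * Real.pi ^ ((d : ℝ) / 2) / Real.Gamma ((d : ℝ) / 2)

theorem sphereArea_pos {d : ℕ} (hd : 1 ≤ d) : 0 < sphereArea d := by
  have : (0 : ℝ) < (d : ℝ) / 2 := by positivity
  have := Real.Gamma_pos_of_pos this
  unfold sphereArea; positivity

theorem lintegral_fun_norm {d : ℕ} (hd : 1 ≤ d) (f : ℝ → ℝ≥0∞) (hf : Measurable f) :
    ∫⁻ x : E d, f ‖x‖ =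
      ENNReal.ofReal (sphereArea d) * ∫⁻ s in Set.Ioi (0 : ℝ), ENNReal.ofReal (s ^ (d - 1)) * f s := by
  have : Nonempty (Fin d) := ⟨⟨0, hd⟩⟩
  have hE : Module.finrank ℝ (E d) = d := by simp
  set μ : Measure (E d) := volume
  have hconst : (μ.toSphere Set.univ) = ENNReal.ofReal (sphereArea d) := by
    rw [Measure.toSphere_apply_univ, hE, EuclideanSpace.volume_ball]
    simp only [ENNReal.ofReal_one, one_pow, one_mul, Fintype.card_fin]
    rw [← ENNReal.ofReal_natCast, ← ENNReal.ofReal_mul (by positivity)]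
    congr 1
    have h2 : (d : ℝ) / 2 ≠ 0 := by positivity
    rw [Real.Gamma_add_one h2, sphereArea]
    have h3 : Real.Gamma ((d : ℝ) / 2) ≠ 0 := (Real.Gamma_pos_of_pos (by positivity)).ne'
    have h4 : √Real.pi ^ d = Real.pi ^ ((d : ℝ) / 2) := by
      rw [Real.sqrt_eq_rpow, ← Real.rpow_natCast, ← Real.rpow_mul Real.pi_pos.le]
      congr 1; ring
    rw [h4]
    field_simp
  calc ∫⁻ x : E d, f ‖x‖ ∂μ = ∫⁻ x : ({(0)}ᶜ : Set (E d)), f (‖x.1‖) ∂(μ.comap (↑)) := by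
        rw [lintegral_subtype_comap (measurableSet_singleton _).compl fun x => f (‖x‖),
          restrict_compl_singleton]
    _ = ∫⁻ x, f x.2 ∂μ.toSphere.prod (.volumeIoiPow (Module.finrank ℝ (E d) - 1)) := by
        simpa using μ.measurePreserving_homeomorphUnitSphereProd.lintegral_comp_emb
          (Homeomorph.measurableEmbedding _) (f ∘ Subtype.val ∘ Prod.snd)
    _ = (μ.toSphere Set.univ) * ∫⁻ x : Set.Ioi (0 : ℝ), f x
          ∂(Measure.volumeIoiPow (Module.finrank ℝ (E d) - 1)) := by
        rw [lintegral_prod _ (by fun_prop)]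
        simp [mul_comm]
    _ = _ := by
        rw [hconst, hE, Measure.volumeIoiPow, lintegral_withDensity_eq_lintegral_mul _ (by fun_prop)
          (by fun_prop)]
        congr 1
        exact lintegral_subtype_comap measurableSet_Ioi fun a => ENNReal.ofReal (a ^ (d - 1)) * f a

/-- The point `sγeₙ`. -/
def spherePt {n k : ℕ} (h : k < n) (q : ℝ × SO n) : E n := q.1 • rot q.2 (lastVec h)

theorem continuous_spherePt {n k : ℕ} (h : k < n) : Continuous (spherePt h) :=
  continuous_fst.smul ((continuous_rot_left (lastVec h)).comp continuous_snd)

theorem norm_spherePt {n k : ℕ} (h : k < n) (q : ℝ × SO n) : ‖spherePt h q‖ = |q.1| := by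
  simp [spherePt, norm_smul, norm_rot, norm_lastVec]

/-- Each rotation preserves Lebesgue measure, so g may be replaced by its average over rotations
without changing the integral. That average is radial, and `lintegral_fun_norm` applies. -/
theorem lintegral_eq_polar {n k : ℕ} (hk : 1 ≤ k) (h : k < n) (g : E n → ℝ≥0∞)
    (hg : Measurable g) :
    ∫⁻ y, g y = ENNReal.ofReal (sphereArea n) * ∫⁻ s in Set.Ioi (0 : ℝ),
      ENNReal.ofReal (s ^ (n - 1)) * ∫⁻ γ, g (spherePt h (s, γ)) ∂(haarSO n) := by
  have hm : Measurable fun s : ℝ => ∫⁻ γ, g (spherePt h (s, γ)) ∂(haarSO n) :=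
    Measurable.lintegral_prod_right' (f := fun q : ℝ × SO n => g (spherePt h q))
      (hg.comp (continuous_spherePt h).measurable)
  rw [← lintegral_fun_norm (by omega) _ hm]
  have h1 : ∀ y : E n, ∫⁻ γ, g (rot γ y) ∂(haarSO n) = ∫⁻ γ, g (spherePt h (‖y‖, γ)) ∂(haarSO n) :=
    fun y => lintegral_rot_eq hk h g y
  simp_rw [← h1]
  rw [lintegral_lintegral_swap (f := fun (y : E n) (γ : SO n) => g (rot γ y))
    ((hg.comp ((continuous_rot_uncurry n).comp continuous_swap).measurable).aemeasurable)]
  have h2 : ∀ γ : SO n, ∫⁻ y, g (rot γ y) = ∫⁻ y, g y := fun γ =>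
    (measurePreserving_rot γ).lintegral_comp hg
  simp [h2]


/-- Polar coordinates applied to the indicator of a null set. This transports measurability and
almost-everywhere statements from ℝⁿ to pairs (radius, rotation). -/
theorem quasiMeasurePreserving_spherePt {n k : ℕ} (hk : 1 ≤ k) (h : k < n) :
    Measure.QuasiMeasurePreserving (spherePt h)
      ((volume.restrict (Set.Ioi (0 : ℝ))).prod (haarSO n)) volume := by
  refine ⟨(continuous_spherePt h).measurable, ?_⟩
  refine Measure.AbsolutelyContinuous.mk fun N hN h0 => ?_
  rw [Measure.map_apply (continuous_spherePt h).measurable hN,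
    Measure.measure_prod_null ((continuous_spherePt h).measurable hN)]
  have h1 := lintegral_eq_polar hk h (N.indicator 1) (measurable_one.indicator hN)
  rw [lintegral_indicator_one hN, h0] at h1
  have h2 := (mul_eq_zero.mp h1.symm).resolve_left
    (by simpa using sphereArea_pos (d := n) (by omega))
  have hm : Measurable fun s : ℝ =>
      ∫⁻ γ, N.indicator (1 : E n → ℝ≥0∞) (spherePt h (s, γ)) ∂(haarSO n) :=
    Measurable.lintegral_prod_right' (f := fun q : ℝ × SO n => N.indicator 1 (spherePt h q))
      ((measurable_one.indicator hN).comp (continuous_spherePt h).measurable)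
  rw [lintegral_eq_zero_iff (by fun_prop)] at h2
  filter_upwards [h2, ae_restrict_mem measurableSet_Ioi] with s hs hs0
  have hs3 : (0 : ℝ) < s ^ (n - 1) := pow_pos hs0 _
  have hs1 := (mul_eq_zero.mp hs).resolve_left (by simpa using hs3)
  change (haarSO n) (Prod.mk s ⁻¹' (spherePt h ⁻¹' N)) = 0
  rw [← hs1, ← lintegral_indicator_one]
  · rfl
  · exact ((continuous_spherePt h).measurable.comp measurable_prodMk_left) hN

/-! ### The planes at a given distance from a point -/

/-- The isometric embedding of `ℝᵏ` onto the coordinate plane. -/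
def coordEmb {n k : ℕ} (h : k < n) : E k →ₗᵢ[ℝ] E n :=
  ((EuclideanSpace.basisFun (Fin k) ℝ).toBasis.constr ℝ fun i : Fin k =>
      (EuclideanSpace.single (Fin.castLE h.le i) (1 : ℝ) : E n)).isometryOfOrthonormal
    (v := (EuclideanSpace.basisFun (Fin k) ℝ).toBasis)
    (by rw [OrthonormalBasis.coe_toBasis]; exact (EuclideanSpace.basisFun (Fin k) ℝ).orthonormal) (by
      have h1 := (EuclideanSpace.basisFun (Fin n) ℝ).orthonormal.comp
        (Fin.castLE h.le) (Fin.castLE_injective h.le)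
      convert! h1 using 1
      funext i
      simp only [Function.comp_apply, Module.Basis.constr_basis, EuclideanSpace.basisFun_apply])

theorem range_coordEmb {n k : ℕ} (h : k < n) :
    LinearMap.range (coordEmb h).toLinearMap = coordPlane h := by
  exact Module.Basis.constr_range (M' := E n) (EuclideanSpace.basisFun (Fin k) ℝ).toBasis ℝ

theorem coordEmb_apply_last {n k : ℕ} (h : k < n) (v : E k) :
    inner ℝ (lastVec h) (coordEmb h v) = 0 := by
  have hv : coordEmb h v ∈ coordPlane h := by
    rw [← range_coordEmb]; exact ⟨v, rfl⟩
  have : coordPlane h ≤ (LinearMap.ker (innerₛₗ ℝ (lastVec h))) := by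
    rw [coordPlane, Submodule.span_le]
    rintro _ ⟨i, rfl⟩
    have hne : (⟨n - 1, by omega⟩ : Fin n) ≠ Fin.castLE h.le i := by
      simp [Fin.ext_iff]; omega
    change inner ℝ (lastVec h) (EuclideanSpace.single (Fin.castLE h.le i) (1 : ℝ)) = 0
    rw [EuclideanSpace.inner_single_right]
    simp [lastVec, hne.symm]
  exact this hv

/-- The point `γ(teₙ + v)` of the plane `γℝᵏ + tγeₙ`. -/
def planePt {n k : ℕ} (h : k < n) (t : ℝ) (q : SO n × E k) : E n :=
  rot q.1 (t • lastVec h + coordEmb h q.2)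

theorem continuous_planePt {n k : ℕ} (h : k < n) (t : ℝ) : Continuous (planePt h t) :=
  (continuous_rot_uncurry n).comp (continuous_fst.prodMk
    (continuous_const.add ((coordEmb h).continuous.comp continuous_snd)))

theorem norm_coord_add {n k : ℕ} (h : k < n) (t : ℝ) (v : E k) :
    ‖t • lastVec h + coordEmb h v‖ = √(t ^ 2 + ‖v‖ ^ 2) := by
  rw [eq_comm, Real.sqrt_eq_iff_mul_self_eq (by positivity) (norm_nonneg _),
    norm_add_mul_self_real]
  simp [inner_smul_left, coordEmb_apply_last, norm_smul, norm_lastVec]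
  ring

/-- The plane is parameterized isometrically by ℝᵏ through γ, followed by a translation inside its
direction space. Neither changes the integral. -/
theorem planeAt_integral {n k : ℕ} (h : k < n) (f : E n → 𝕜) (x : E n) (t : ℝ) (γ : SO n) :
    (KPlaneConverges k f (planeAt h x t γ) ↔ Integrable fun v : E k => f (x + planePt h t (γ, v))) ∧
    kPlaneTransform k f (planeAt h x t γ) = ∫ v : E k, f (x + planePt h t (γ, v)) := by
  set V : Submodule ℝ (E n) := (coordPlane h).map (rot γ) with hV
  have hmem : ∀ v : E k, ((rotIso γ).toLinearIsometry.comp (coordEmb h)).toLinearMap v ∈ V := by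
    intro v
    refine Submodule.mem_map.mpr ⟨coordEmb h v, ?_, rfl⟩
    rw [← range_coordEmb]; exact ⟨v, rfl⟩
  let U₀ : E k →ₗᵢ[ℝ] V :=
    ⟨LinearMap.codRestrict V ((rotIso γ).toLinearIsometry.comp (coordEmb h)).toLinearMap hmem,
      fun v => ((rotIso γ).toLinearIsometry.comp (coordEmb h)).norm_map v⟩
  have hfr : Module.finrank ℝ (E k) = Module.finrank ℝ V := by
    rw [hV, finrank_rot_coordPlane]; simp
  let U : E k ≃ₗᵢ[ℝ] V := U₀.toLinearIsometryEquiv hfr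
  have hU : ∀ v, ((U v : V) : E n) = rot γ (coordEmb h v) := fun v => rfl
  set y : E n := x + t • rot γ (lastVec h) with hy
  -- `KPlane.through` keeps only the component of y orthogonal to V. The component q inside V is
  -- restored by shifting the variable of integration.
  let q : V := V.orthogonalProjectionOnto y
  have hq : Vᗮ.starProjection y + q = y := by
    rw [add_comm]
    exact V.starProjection_add_starProjection_orthogonal y
  let Ψ : E k → V := fun v => q + U v
  have hΨ : MeasurePreserving Ψ volume volume :=
    (measurePreserving_add_left volume q).comp U.measurePreserving
  have hΨe : MeasurableEmbedding Ψ :=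
    (measurableEmbedding_addLeft q).comp U.toHomeomorph.measurableEmbedding
  have key : ∀ v : E k, f (Vᗮ.starProjection y + (Ψ v : V)) = f (x + planePt h t (γ, v)) := by
    intro v
    congr 1
    simp only [Ψ, Submodule.coe_add, hU]
    rw [← add_assoc, hq, hy, planePt]
    simp only [map_add, map_smul]
    abel
  constructor
  · rw [KPlaneConverges]
    change Integrable (fun v : V => f (Vᗮ.starProjection y + v)) ↔ _
    rw [← hΨ.integrable_comp_emb hΨe]
    exact integrable_congr (Eventually.of_forall key)
  · rw [kPlaneTransform]
    change ∫ v : V, f (Vᗮ.starProjection y + v) = _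
    rw [← hΨ.integral_comp hΨe]
    exact integral_congr_ae (Eventually.of_forall key)

/-- The measure `σₖ (s² - t²)^(k/2 - 1) s ds` on `(t, ∞)`. -/
def radialMeasure (k : ℕ) (t : ℝ) : Measure ℝ :=
  (volume.restrict (Set.Ioi t)).withDensity fun s =>
    ENNReal.ofReal (sphereArea k * ((s ^ 2 - t ^ 2) ^ ((k : ℝ) / 2 - 1) * s))

instance (k : ℕ) (t : ℝ) : SFinite (radialMeasure k t) := by unfold radialMeasure; infer_instance

theorem radialMeasure_prod_ac {n : ℕ} (k : ℕ) {t : ℝ} (ht : 0 ≤ t) :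
    (radialMeasure k t).prod (haarSO n) ≪ (volume.restrict (Set.Ioi (0 : ℝ))).prod (haarSO n) :=
  Measure.AbsolutelyContinuous.prod ((withDensity_absolutelyContinuous _ _).trans
    (Measure.restrict_mono (Set.Ioi_subset_Ioi ht) le_rfl).absolutelyContinuous) .rfl

/-- The substitution ρ = √(s² - t²), with dρ = s / ρ ds, whence ρ^(k-1) dρ = (s² - t²)^(k/2 - 1) s
ds. -/
theorem lintegral_sqrt_change {k : ℕ} (hk : 1 ≤ k) {t : ℝ} (ht : 0 ≤ t) (a : ℝ → ℝ≥0∞) :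
    ∫⁻ ρ in Set.Ioi (0 : ℝ), ENNReal.ofReal (ρ ^ (k - 1)) * a √(t ^ 2 + ρ ^ 2) =
      ∫⁻ s in Set.Ioi t, ENNReal.ofReal ((s ^ 2 - t ^ 2) ^ ((k : ℝ) / 2 - 1) * s) * a s := by
  have hpos : ∀ s ∈ Set.Ioi t, 0 < s ^ 2 - t ^ 2 := fun s hs => by
    have : t < s := hs
    nlinarith
  have himg : (fun s : ℝ => √(s ^ 2 - t ^ 2)) '' Set.Ioi t = Set.Ioi 0 := by
    ext ρ
    constructor
    · rintro ⟨s, hs, rfl⟩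
      exact Real.sqrt_pos.mpr (hpos s hs)
    · intro hρ
      have hρ : 0 < ρ := hρ
      refine ⟨√(t ^ 2 + ρ ^ 2), ?_, ?_⟩
      · exact Real.lt_sqrt_of_sq_lt (by nlinarith)
      · simp only
        rw [Real.sq_sqrt (by positivity), add_sub_cancel_left, Real.sqrt_sq hρ.le]
  rw [← himg, lintegral_image_eq_lintegral_abs_deriv_mul measurableSet_Ioi
    (f' := fun s => s / √(s ^ 2 - t ^ 2))]
  · refine setLIntegral_congr_fun measurableSet_Ioi fun s hs => ?_
    have h1 := hpos s hs
    have h3 : 0 < s := lt_of_le_of_lt ht hs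
    have h2 : 0 < √(s ^ 2 - t ^ 2) := Real.sqrt_pos.mpr h1
    rw [Real.sq_sqrt h1.le, add_sub_cancel, Real.sqrt_sq h3.le, ← mul_assoc,
      ← ENNReal.ofReal_mul (abs_nonneg _), abs_of_pos (by positivity)]
    congr 2
    have h4 : (s ^ 2 - t ^ 2) ^ ((k : ℝ) / 2 - 1) =
        √(s ^ 2 - t ^ 2) ^ (k - 1) / √(s ^ 2 - t ^ 2) := by
      rw [Real.sqrt_eq_rpow, ← Real.rpow_natCast (_ ^ (1 / 2 : ℝ)) (k - 1), ← Real.rpow_mul h1.le,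
        ← Real.rpow_sub h1]
      congr 1
      push_cast [Nat.cast_sub hk]
      ring
    rw [h4]
    ring
  · intro s hs
    have h1 := hpos s hs
    have := ((hasDerivAt_pow 2 s).sub_const (t ^ 2)).sqrt h1.ne'
    convert! this.hasDerivWithinAt using 1
    field_simp
    norm_num [mul_comm]
  · intro s hs s' hs' heq
    have h1 := hpos s hs
    have h1' := hpos s' hs'
    have h3 : 0 < s := lt_of_le_of_lt ht hs
    have h3' : 0 < s' := lt_of_le_of_lt ht hs'
    have := (Real.sqrt_inj h1.le h1'.le).mp heq
    exact (sq_eq_sq₀ h3.le h3'.le).mp (by linarith)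

/-- For fixed v the average over γ sees only the norm √(t² + |v|²). Polar coordinates in v and the
substitution of `lintegral_sqrt_change` then produce `radialMeasure`. As an equality of image
measures it serves both for integrability and for the values of integrals. -/
theorem map_planePt {n k : ℕ} (hk : 1 ≤ k) (h : k < n) {t : ℝ} (ht : 0 ≤ t) :
    ((haarSO n).prod (volume : Measure (E k))).map (planePt h t) =
      ((radialMeasure k t).prod (haarSO n)).map (spherePt h) := by
  refine Measure.ext_of_lintegral _ fun g hg => ?_
  rw [lintegral_map hg (continuous_planePt h t).measurable,
    lintegral_map hg (continuous_spherePt h).measurable]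
  have hm : Measurable fun s : ℝ => ∫⁻ γ, g (spherePt h (s, γ)) ∂(haarSO n) :=
    Measurable.lintegral_prod_right' (f := fun q : ℝ × SO n => g (spherePt h q))
      (hg.comp (continuous_spherePt h).measurable)
  rw [lintegral_prod_symm' (fun q : SO n × E k => g (planePt h t q)) (hg.comp (continuous_planePt h t).measurable),
    lintegral_prod (fun q : ℝ × SO n => g (spherePt h q)) (hg.comp (continuous_spherePt h).measurable).aemeasurable]
  have h1 : ∀ v : E k, ∫⁻ γ, g (planePt h t (γ, v)) ∂(haarSO n) =
      ∫⁻ γ, g (spherePt h (√(t ^ 2 + ‖v‖ ^ 2), γ)) ∂(haarSO n) := by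
    intro v
    simp only [planePt, spherePt]
    rw [lintegral_rot_eq hk h, norm_coord_add]
  have hm2 : Measurable fun ρ : ℝ =>
      ∫⁻ γ, g (spherePt h (√(t ^ 2 + ρ ^ 2), γ)) ∂(haarSO n) :=
    hm.comp (by fun_prop : Measurable fun ρ : ℝ => √(t ^ 2 + ρ ^ 2))
  simp_rw [h1]
  rw [lintegral_fun_norm hk (fun ρ : ℝ =>
      ∫⁻ γ, g (spherePt h (√(t ^ 2 + ρ ^ 2), γ)) ∂(haarSO n)) hm2,
    lintegral_sqrt_change hk ht (fun s => ∫⁻ γ, g (spherePt h (s, γ)) ∂(haarSO n)),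
    radialMeasure, lintegral_withDensity_eq_lintegral_mul _ (by fun_prop) hm,
    ← lintegral_const_mul' _ _ ENNReal.ofReal_ne_top]
  refine lintegral_congr fun s => ?_
  rw [Pi.mul_apply, ENNReal.ofReal_mul (sphereArea_pos hk).le, mul_assoc]

/-! ### Spherical means -/

/-- The spherical mean `∫_{SO(n)} f(x + sγeₙ) dγ`. -/
def sphMean {n k : ℕ} (h : k < n) (f : E n → 𝕜) (x : E n) (s : ℝ) : 𝕜 :=
  ∫ γ, f (x + spherePt h (s, γ)) ∂(haarSO n)

/-- The spherical mean of a nonnegative function. -/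
def sphMeanE {n k : ℕ} (h : k < n) (g : E n → ℝ≥0∞) (x : E n) (s : ℝ) : ℝ≥0∞ :=
  ∫⁻ γ, g (x + spherePt h (s, γ)) ∂(haarSO n)

theorem enorm_sphMean_le {n k : ℕ} (h : k < n) (f : E n → 𝕜) (x : E n) (s : ℝ) :
    ‖sphMean h f x s‖ₑ ≤ sphMeanE h (fun y => ‖f y‖ₑ) x s :=
  enorm_integral_le_lintegral_enorm _

theorem aestronglyMeasurable_comp_spherePt {n k : ℕ} (hk : 1 ≤ k) (h : k < n) {f : E n → 𝕜}
    (hf : AEStronglyMeasurable f volume) (x : E n) :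
    AEStronglyMeasurable (fun q : ℝ × SO n => f (x + spherePt h q))
      ((volume.restrict (Set.Ioi (0 : ℝ))).prod (haarSO n)) := by
  have h1 : AEStronglyMeasurable (fun y => f (x + y)) volume :=
    hf.comp_measurePreserving (measurePreserving_add_left volume x)
  exact h1.comp_quasiMeasurePreserving (quasiMeasurePreserving_spherePt hk h)

theorem aestronglyMeasurable_sphMean {n k : ℕ} (hk : 1 ≤ k) (h : k < n) {f : E n → 𝕜}
    (hf : AEStronglyMeasurable f volume) (x : E n) :
    AEStronglyMeasurable (sphMean h f x) (volume.restrict (Set.Ioi (0 : ℝ))) :=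
  (aestronglyMeasurable_comp_spherePt hk h hf x).integral_prod_right'

theorem aemeasurable_sphMeanE {n k : ℕ} (hk : 1 ≤ k) (h : k < n) {g : E n → ℝ≥0∞}
    (hg : AEMeasurable g volume) (x : E n) :
    AEMeasurable (sphMeanE h g x) (volume.restrict (Set.Ioi (0 : ℝ))) := by
  have h1 : AEMeasurable (fun y => g (x + y)) volume :=
    hg.comp_quasiMeasurePreserving (measurePreserving_add_left volume x).quasiMeasurePreserving
  exact (h1.comp_quasiMeasurePreserving
    (quasiMeasurePreserving_spherePt hk h)).lintegral_prod_right'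

/-- Fubini on both sides of `map_planePt`: the finiteness assumption gives integrability over radii
and rotations, which transfers to rotations and points of ℝᵏ, where it is the convergence of the
dual mean. -/
theorem dualMean_eq {n k : ℕ} (hk : 1 ≤ k) (h : k < n) {f : E n → 𝕜}
    (hf : AEStronglyMeasurable f volume) (x : E n) {t : ℝ} (ht : 0 < t)
    (hfin : ∫⁻ s in Set.Ioi t, ENNReal.ofReal ((s ^ 2 - t ^ 2) ^ ((k : ℝ) / 2 - 1) * s) *
      sphMeanE h (fun y => ‖f y‖ₑ) x s < ∞) :
    DualMeanConverges h f x t ∧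
    dualMean h (kPlaneTransform k f) x t = ∫ s in Set.Ioi t,
      (sphereArea k * ((s ^ 2 - t ^ 2) ^ ((k : ℝ) / 2 - 1) * s)) • sphMean h f x s := by
  have hac := radialMeasure_prod_ac (n := n) k ht.le
  have hP : Measure.QuasiMeasurePreserving (spherePt h) ((radialMeasure k t).prod (haarSO n))
      volume := (quasiMeasurePreserving_spherePt hk h).mono_left hac
  have hfx : AEStronglyMeasurable (fun y => f (x + y)) volume :=
    hf.comp_measurePreserving (measurePreserving_add_left volume x)
  have hmeas := (aestronglyMeasurable_comp_spherePt hk h hf x).mono_ac hac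
  have hint : Integrable (fun q : ℝ × SO n => f (x + spherePt h q))
      ((radialMeasure k t).prod (haarSO n)) := by
    refine ⟨hmeas, ?_⟩
    rw [hasFiniteIntegral_iff_enorm, lintegral_prod _ hmeas.enorm, radialMeasure]
    have hm := (aemeasurable_sphMeanE hk h hf.enorm x).mono_measure
      (Measure.restrict_mono (Set.Ioi_subset_Ioi ht.le) le_rfl)
    change ∫⁻ s, sphMeanE h (fun y => ‖f y‖ₑ) x s ∂_ < ∞
    rw [lintegral_withDensity_eq_lintegral_mul₀ (by fun_prop) hm]
    simp only [Pi.mul_apply, ENNReal.ofReal_mul (sphereArea_pos hk).le, mul_assoc]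
    rw [lintegral_const_mul' _ _ ENNReal.ofReal_ne_top]
    exact ENNReal.mul_lt_top ENNReal.ofReal_lt_top hfin
  have hfm : AEStronglyMeasurable (fun y => f (x + y))
      (((radialMeasure k t).prod (haarSO n)).map (spherePt h)) :=
    hfx.mono_ac hP.absolutelyContinuous
  have hint2 : Integrable (fun q : SO n × E k => f (x + planePt h t q))
      ((haarSO n).prod volume) := by
    have h1 := (integrable_map_measure hfm (continuous_spherePt h).aemeasurable).mpr hint
    rw [← map_planePt hk h ht.le] at h1
    exact h1.comp_aemeasurable (continuous_planePt h t).aemeasurable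
  have heq : ∫ q, f (x + planePt h t q) ∂((haarSO n).prod volume) =
      ∫ q, f (x + spherePt h q) ∂((radialMeasure k t).prod (haarSO n)) := by
    rw [← integral_map (f := fun y => f (x + y)) (continuous_spherePt h).aemeasurable hfm]
    rw [← map_planePt hk h ht.le] at hfm ⊢
    rw [integral_map (continuous_planePt h t).aemeasurable hfm]
  refine ⟨⟨?_, ?_⟩, ?_⟩
  · filter_upwards [hint2.prod_right_ae] with γ hγ
    exact (planeAt_integral h f x t γ).1.mpr hγ
  · simp_rw [(planeAt_integral h f x t _).2]
    exact hint2.integral_prod_left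
  · rw [dualMean]
    simp_rw [(planeAt_integral h f x t _).2]
    rw [← integral_prod _ hint2, heq, integral_prod _ hint, radialMeasure,
      integral_withDensity_eq_integral_toReal_smul (by fun_prop)
        (Eventually.of_forall fun _ => ENNReal.ofReal_lt_top)]
    refine setIntegral_congr_fun measurableSet_Ioi fun s hs => ?_
    have hs' : t < s := hs
    have h1 : 0 < s ^ 2 - t ^ 2 := by nlinarith
    have h2 := sphereArea_pos hk
    have h3 : 0 < s := ht.trans hs'
    rw [ENNReal.toReal_ofReal (by positivity)]
    rfl


/-! ### Lebesgue points -/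

/-- `t` is a Lebesgue point of `G`. -/
def IsLebesguePoint (G : ℝ → 𝕜) (t : ℝ) : Prop :=
  ∀ ε > 0, ∃ δ > 0, ∀ h, 0 < h → h < δ →
    ∫⁻ s in Set.Icc (t - h) (t + h), ‖G s - G t‖ₑ ≤ ENNReal.ofReal (ε * h)

theorem IsLebesguePoint.smul {G : ℝ → 𝕜} {t : ℝ} (hG : IsLebesguePoint G t) {w : ℝ → ℝ}
    (hw : ContinuousAt w t) : IsLebesguePoint (fun s => w s • G s) t := by
  -- Split w G - w(t) G(t) as w (G - G(t)) + (w - w(t)) G(t) and give ε/2 to each term. Here C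
  -- bounds |w| near t because η ≤ 1, and η‖G t‖ ≤ ε/4 pays for an interval of length 2h.
  intro ε hε
  set C : ℝ := |w t| + 1 with hC
  have hC0 : 0 < C := by positivity
  set η : ℝ := min 1 (ε / (4 * (‖G t‖ + 1))) with hη
  have hη0 : 0 < η := by positivity
  obtain ⟨δ, hδ, hGδ⟩ := hG (ε / (2 * C)) (by positivity)
  obtain ⟨δ', hδ', hwδ⟩ := Metric.continuousAt_iff.mp hw η hη0
  refine ⟨min δ δ', lt_min hδ hδ', fun h h0 hh => ?_⟩
  have hpt : ∀ s ∈ Set.Icc (t - h) (t + h), ‖w s • G s - w t • G t‖ₑ ≤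
      ENNReal.ofReal C * ‖G s - G t‖ₑ + ENNReal.ofReal (η * ‖G t‖) := by
    intro s hs
    have hd : dist s t < δ' := by
      rw [Real.dist_eq, abs_lt]
      have := hh.trans_le (min_le_right δ δ')
      constructor <;> linarith [hs.1, hs.2]
    have h1 : |w s - w t| < η := by simpa [Real.dist_eq] using hwδ hd
    have h2 : |w s| ≤ C := by
      have := abs_sub_abs_le_abs_sub (w s) (w t)
      have := min_le_left 1 (ε / (4 * (‖G t‖ + 1)))
      linarith
    rw [← ofReal_norm (G s - G t), ← ENNReal.ofReal_mul hC0.le,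
      ← ENNReal.ofReal_add (by positivity) (by positivity), ← ofReal_norm]
    refine ENNReal.ofReal_le_ofReal ?_
    have : w s • G s - w t • G t = w s • (G s - G t) + (w s - w t) • G t := by
      rw [smul_sub, sub_smul]; abel
    rw [this]
    refine (norm_add_le _ _).trans ?_
    rw [norm_smul, norm_smul, Real.norm_eq_abs, Real.norm_eq_abs]
    gcongr
  calc ∫⁻ s in Set.Icc (t - h) (t + h), ‖w s • G s - w t • G t‖ₑ
      ≤ ∫⁻ s in Set.Icc (t - h) (t + h),
          (ENNReal.ofReal C * ‖G s - G t‖ₑ + ENNReal.ofReal (η * ‖G t‖)) :=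
        setLIntegral_mono' measurableSet_Icc hpt
    _ = ENNReal.ofReal C * (∫⁻ s in Set.Icc (t - h) (t + h), ‖G s - G t‖ₑ) +
          ENNReal.ofReal (η * ‖G t‖) * ENNReal.ofReal (2 * h) := by
        rw [lintegral_add_right _ measurable_const, lintegral_const_mul' _ _ ENNReal.ofReal_ne_top,
          setLIntegral_const, Real.volume_Icc]
        congr 3; ring
    _ ≤ ENNReal.ofReal C * ENNReal.ofReal (ε / (2 * C) * h) +
          ENNReal.ofReal (η * ‖G t‖) * ENNReal.ofReal (2 * h) := by
        gcongr
        exact hGδ h h0 (hh.trans_le (min_le_left _ _))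
    _ ≤ ENNReal.ofReal (ε * h) := by
        rw [← ENNReal.ofReal_mul hC0.le, ← ENNReal.ofReal_mul (by positivity),
          ← ENNReal.ofReal_add (by positivity) (by positivity)]
        refine ENNReal.ofReal_le_ofReal ?_
        have h1 : η * ‖G t‖ ≤ ε / 4 := by
          calc η * ‖G t‖ ≤ ε / (4 * (‖G t‖ + 1)) * (‖G t‖ + 1) := by
                gcongr
                · exact min_le_right _ _
                · linarith
            _ = ε / 4 := by field_simp
        have h2 : C * (ε / (2 * C) * h) = ε / 2 * h := by field_simp
        rw [h2]
        nlinarith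

/-- The interval between r and t lies in the symmetric interval of half-length |r - t| about t, so
the Lebesgue point estimate is exactly the required little-o. -/
theorem IsLebesguePoint.hasDerivAt_integral_Ioi {H : ℝ → 𝕜} {a t : ℝ} (hat : a < t)
    (hi : IntegrableOn H (Set.Ioi a)) (hH : IsLebesguePoint H t) :
    HasDerivAt (fun r => ∫ s in Set.Ioi r, H s) (-(H t)) t := by
  rw [hasDerivAt_iff_isLittleO, Asymptotics.isLittleO_iff]
  intro ε hε
  obtain ⟨δ, hδ, hHδ⟩ := hH ε hε
  have h1 : ∀ᶠ r in 𝓝 t, a < r := lt_mem_nhds hat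
  have h2 : ∀ᶠ r in 𝓝 t, |r - t| < δ := by
    exact Metric.ball_mem_nhds t hδ
  filter_upwards [h1, h2] with r har hr
  rcases eq_or_ne r t with rfl | hne
  · simp
  have hii : IntervalIntegrable H volume r t := by
    rw [intervalIntegrable_iff]
    refine hi.mono_set fun s hs => ?_
    exact lt_of_le_of_lt (le_min har.le hat.le) hs.1 |>.trans_le le_rfl
  have h3 : (∫ s in Set.Ioi r, H s) - (∫ s in Set.Ioi t, H s) = ∫ s in r..t, H s :=
    intervalIntegral.integral_Ioi_sub_Ioi' (hi.mono_set (Set.Ioi_subset_Ioi har.le))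
      (hi.mono_set (Set.Ioi_subset_Ioi hat.le))
  have h4 : (∫ s in r..t, H s) - (r - t) • -H t = ∫ s in r..t, (H s - H t) := by
    rw [intervalIntegral.integral_sub hii intervalIntegrable_const,
      intervalIntegral.integral_const, smul_neg, ← neg_smul, neg_sub]
  rw [h3, h4]
  have hpos : 0 < |r - t| := abs_pos.mpr (sub_ne_zero.mpr hne)
  have h5 : ‖∫ s in r..t, (H s - H t)‖ₑ ≤ ENNReal.ofReal (ε * |r - t|) := by
    calc ‖∫ s in r..t, (H s - H t)‖ₑ = ‖∫ s in Set.uIoc r t, (H s - H t)‖ₑ := by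
          rw [← ofReal_norm, ← ofReal_norm, intervalIntegral.norm_intervalIntegral_eq]
      _ ≤ ∫⁻ s in Set.uIoc r t, ‖H s - H t‖ₑ := enorm_integral_le_lintegral_enorm _
      _ ≤ ∫⁻ s in Set.Icc (t - |r - t|) (t + |r - t|), ‖H s - H t‖ₑ := by
          refine lintegral_mono_set fun s hs => ?_
          rcases le_total r t with h | h
          · rw [Set.uIoc_of_le h] at hs
            rw [abs_of_nonpos (by linarith)]
            exact ⟨by linarith [hs.1], by linarith [hs.2]⟩
          · rw [Set.uIoc_of_ge h] at hs
            rw [abs_of_nonneg (by linarith)]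
            exact ⟨by linarith [hs.1], by linarith [hs.2]⟩
      _ ≤ _ := hHδ _ hpos hr
  rw [← ofReal_norm] at h5
  exact (ENNReal.ofReal_le_ofReal_iff (by positivity)).mp h5

/-! ### Iterated primitives with respect to a function -/

/-- A positive function on `(0, ∞)` with positive continuous derivative. -/
structure IsScale (θ θ' : ℝ → ℝ) : Prop where
  hasDerivAt : ∀ s, HasDerivAt θ (θ' s) s
  continuous_deriv : Continuous θ'
  deriv_pos : ∀ s, 0 < s → 0 < θ' s
  pos : ∀ s, 0 < s → 0 < θ s

theorem IsScale.continuous {θ θ' : ℝ → ℝ} (h : IsScale θ θ') : Continuous θ :=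
  continuous_iff_continuousAt.mpr fun s => (h.hasDerivAt s).continuousAt

theorem IsScale.strictMonoOn {θ θ' : ℝ → ℝ} (h : IsScale θ θ') :
    StrictMonoOn θ (Set.Ioi 0) := by
  refine strictMonoOn_of_deriv_pos (convex_Ioi 0) h.continuous.continuousOn fun s hs => ?_
  rw [interior_Ioi] at hs
  rw [(h.hasDerivAt s).deriv]
  exact h.deriv_pos s hs

/-- `∫_r^∞ (θ(s) - θ(r))^j / j! θ'(s) H(s) ds`. -/
def iterPrim (θ θ' : ℝ → ℝ) (j : ℕ) (H : ℝ → 𝕜) (r : ℝ) : 𝕜 :=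
  ∫ s in Set.Ioi r, ((θ s - θ r) ^ j / (j.factorial : ℝ) * θ' s) • H s

/-- As θ increases, κ/θ^N is bounded on (a, ∞) by its bound θ(a)^j/θ(a)^N at the left end. One
integrability assumption at the top power thus covers all lower ones. -/
theorem IsScale.integrableOn_pow {θ θ' : ℝ → ℝ} (h : IsScale θ θ') {N : ℕ} {H : ℝ → 𝕜}
    (hi : ∀ a, 0 < a → IntegrableOn (fun s => (θ s ^ N * θ' s) • H s) (Set.Ioi a))
    {j : ℕ} (hj : j ≤ N) {a : ℝ} (ha : 0 < a) {κ : ℝ → ℝ} (hκ : Measurable κ)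
    (hκb : ∀ s, a < s → |κ s| ≤ θ s ^ j) :
    IntegrableOn (fun s => (κ s * θ' s) • H s) (Set.Ioi a) := by
  have hc : IntegrableOn (fun s => (κ s / θ s ^ N) • (θ s ^ N * θ' s) • H s) (Set.Ioi a) := by
    refine Integrable.bdd_smul (𝕜 := ℝ) (hi a ha) (θ a ^ j / θ a ^ N) ?_ ?_
    · exact (hκ.div (h.continuous.measurable.pow_const N)).aestronglyMeasurable
    · filter_upwards [ae_restrict_mem measurableSet_Ioi] with s hs
      have hs' : a < s := hs
      have h0 := h.pos a ha
      have h1 := h.pos s (ha.trans hs')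
      have h2 : θ a < θ s := h.strictMonoOn ha (ha.trans hs') hs'
      rw [Real.norm_eq_abs, abs_div, abs_of_pos (pow_pos h1 N), div_le_div_iff₀ (by positivity)
        (by positivity)]
      calc |κ s| * θ a ^ N ≤ θ s ^ j * θ a ^ N := by
            gcongr; exact hκb s hs'
        _ = θ s ^ j * (θ a ^ j * θ a ^ (N - j)) := by rw [← pow_add]; congr 2; omega
        _ ≤ θ s ^ j * (θ a ^ j * θ s ^ (N - j)) := by gcongr
        _ = θ a ^ j * (θ s ^ j * θ s ^ (N - j)) := by ring
        _ = θ a ^ j * θ s ^ N := by rw [← pow_add (θ s)]; congr 2; omega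
  refine hc.congr_fun (fun s hs => ?_) measurableSet_Ioi
  have h1 := h.pos s (ha.trans hs)
  simp only [smul_smul]
  congr 1
  field_simp

theorem IsScale.integrableOn_iterPrim {θ θ' : ℝ → ℝ} (h : IsScale θ θ') {N : ℕ} {H : ℝ → 𝕜}
    (hi : ∀ a, 0 < a → IntegrableOn (fun s => (θ s ^ N * θ' s) • H s) (Set.Ioi a))
    {j : ℕ} (hj : j ≤ N) {r : ℝ} (hr : 0 < r) :
    IntegrableOn (fun s => ((θ s - θ r) ^ j / (j.factorial : ℝ) * θ' s) • H s) (Set.Ioi r) := by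
  have hm := h.continuous.measurable
  refine h.integrableOn_pow hi hj hr (by fun_prop) fun s hs => ?_
  have h1 : θ r < θ s := h.strictMonoOn hr (hr.trans hs) hs
  have h0 := h.pos r hr
  have hf : (1 : ℝ) ≤ j.factorial := by exact_mod_cast Nat.one_le_iff_ne_zero.mpr j.factorial_ne_zero
  rw [abs_of_nonneg (div_nonneg (pow_nonneg (by linarith) _) (by positivity))]
  calc (θ s - θ r) ^ j / (j.factorial : ℝ) ≤ (θ s - θ r) ^ j :=
        div_le_self (pow_nonneg (by linarith) _) hf
    _ ≤ θ s ^ j := by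
        apply pow_le_pow_left₀ <;> linarith

/-- Differentiation under the integral sign. The moving lower limit is hidden in the positive part
of θ(s) - θ(r), whose power is locally Lipschitz in r with an integrable constant. -/
theorem IsScale.hasDerivAt_iterPrim {θ θ' : ℝ → ℝ} (h : IsScale θ θ') {N : ℕ} {H : ℝ → 𝕜}
    (hi : ∀ a, 0 < a → IntegrableOn (fun s => (θ s ^ N * θ' s) • H s) (Set.Ioi a))
    {j : ℕ} (hj : j + 1 ≤ N) {r₀ : ℝ} (hr : 0 < r₀) :
    HasDerivAt (iterPrim θ θ' (j + 1) H) (-(θ' r₀ • iterPrim θ θ' j H r₀)) r₀ := by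
  have hm := h.continuous.measurable
  set a := r₀ / 2 with ha
  have ha0 : 0 < a := by positivity
  have har : a < r₀ := by linarith
  set fac : ℝ := ((j + 1).factorial : ℝ) with hfac
  have hfac0 : 0 < fac := by positivity
  have hfacj : fac = (j + 1) * (j.factorial : ℝ) := by rw [hfac, Nat.factorial_succ]; push_cast; ring
  have hfj : (0 : ℝ) < j.factorial := by positivity
  have hfj1 : (1 : ℝ) ≤ j.factorial := by
    exact_mod_cast Nat.one_le_iff_ne_zero.mpr j.factorial_ne_zero
  -- The integrand vanishes for s ≤ r, so for r near r₀ the domain (a, ∞) does not depend on r.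
  let F : ℝ → ℝ → 𝕜 := fun r s => (max (θ s - θ r) 0 ^ (j + 1) / fac * θ' s) • H s
  let F' : ℝ → 𝕜 := (Set.Ioi r₀).indicator fun s =>
    -(θ' r₀ • ((θ s - θ r₀) ^ j / (j.factorial : ℝ) * θ' s) • H s)
  obtain ⟨M, hM⟩ := (isCompact_Icc (a := a) (b := 2 * r₀)).exists_bound_of_continuousOn
    h.continuous_deriv.continuousOn
  have hM0 : 0 ≤ M := (norm_nonneg _).trans (hM r₀ ⟨har.le, by linarith⟩)
  have hFr : ∀ r, a < r → iterPrim θ θ' (j + 1) H r = ∫ s in Set.Ioi a, F r s := by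
    intro r har'
    rw [iterPrim]
    have : Set.Ioi r = Set.Ioi a ∩ Set.Ioi r := by
      rw [Set.Ioi_inter_Ioi, sup_eq_right.mpr har'.le]
    rw [this, ← setIntegral_indicator measurableSet_Ioi]
    refine setIntegral_congr_fun measurableSet_Ioi fun s hs => ?_
    have hs0 : 0 < s := ha0.trans hs
    by_cases hsr : r < s
    · have := h.strictMonoOn (ha0.trans har') hs0 hsr
      simp only [Set.indicator, Set.mem_Ioi, hsr, if_true, F]
      rw [max_eq_left (by linarith)]
    · have := h.strictMonoOn.monotoneOn hs0 (ha0.trans har') (not_lt.mp hsr)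
      simp only [Set.indicator, Set.mem_Ioi, hsr, if_false, F]
      rw [max_eq_right (by linarith)]
      simp
  have hFint : ∀ r, a < r → IntegrableOn (F r) (Set.Ioi a) := by
    intro r har'
    refine h.integrableOn_pow hi hj ha0 (by fun_prop) fun s hs => ?_
    have h1 := h.pos s (ha0.trans hs)
    have h2 := h.pos r (ha0.trans har')
    have hf : (1 : ℝ) ≤ fac := by
      rw [hfac]; exact_mod_cast Nat.one_le_iff_ne_zero.mpr (j + 1).factorial_ne_zero
    rw [abs_of_nonneg (by positivity)]
    calc max (θ s - θ r) 0 ^ (j + 1) / fac ≤ max (θ s - θ r) 0 ^ (j + 1) :=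
          div_le_self (by positivity) hf
      _ ≤ θ s ^ (j + 1) := by
          gcongr
          exact max_le (by linarith) h1.le
  have hbase : IntegrableOn (fun s => (θ s ^ j * θ' s) • H s) (Set.Ioi a) := by
    refine h.integrableOn_pow hi (by omega : j ≤ N) ha0 (by fun_prop) fun s hs => ?_
    have h1 := h.pos s (ha0.trans hs)
    rw [abs_of_pos (by positivity)]
  have hF'int : IntegrableOn F' (Set.Ioi a) := by
    refine IntegrableOn.integrable_indicator ?_ measurableSet_Ioi |>.integrableOn
    exact ((h.integrableOn_iterPrim hi (by omega) hr).smul (θ' r₀)).neg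
  have key := hasDerivAt_integral_of_dominated_loc_of_lip (μ := volume.restrict (Set.Ioi a))
    (F := F) (F' := F') (x₀ := r₀) (s := Set.Ioo a (2 * r₀))
    (bound := fun s => M * ‖(θ s ^ j * θ' s) • H s‖)
    (Ioo_mem_nhds har (by linarith))
    (by
      filter_upwards [lt_mem_nhds har] with r hr'
      exact (hFint r hr').aestronglyMeasurable)
    (hFint r₀ har) hF'int.aestronglyMeasurable
    (by
      filter_upwards [ae_restrict_mem measurableSet_Ioi] with s hs
      have hs0 : 0 < s := ha0.trans hs
      have hθs := h.pos s hs0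
      refine LipschitzOnWith.of_dist_le_mul fun r hr r' hr' => ?_
      have hr0 : 0 < r := ha0.trans hr.1
      have hr0' : 0 < r' := ha0.trans hr'.1
      have hl : |θ r - θ r'| ≤ M * |r - r'| := by
        have := (convex_Icc a (2 * r₀)).norm_image_sub_le_of_norm_hasDerivWithin_le
          (fun z _ => (h.hasDerivAt z).hasDerivWithinAt) hM ⟨hr'.1.le, hr'.2.le⟩ ⟨hr.1.le, hr.2.le⟩
        simpa using this
      set p := max (θ s - θ r) 0 with hp
      set q := max (θ s - θ r') 0 with hq
      have hpq : |p - q| ≤ |θ r - θ r'| := by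
        have := abs_max_sub_max_le_abs (θ s - θ r) (θ s - θ r') 0
        rw [hp, hq]
        refine this.trans (le_of_eq ?_)
        rw [abs_sub_comm]; congr 1; ring
      have hp0 : 0 ≤ p := le_max_right _ _
      have hq0 : 0 ≤ q := le_max_right _ _
      have hpθ : p ≤ θ s := max_le (by linarith [h.pos r hr0]) hθs.le
      have hqθ : q ≤ θ s := max_le (by linarith [h.pos r' hr0']) hθs.le
      have hpow : |p ^ (j + 1) - q ^ (j + 1)| ≤ |p - q| * (j + 1) * θ s ^ j := by
        have := abs_pow_sub_pow_le p q (j + 1)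
        refine this.trans ?_
        push_cast
        rw [abs_of_nonneg hp0, abs_of_nonneg hq0]
        gcongr
        exact max_le hpθ hqθ
      rw [dist_eq_norm, ← sub_smul, norm_smul, Real.norm_eq_abs, ← sub_mul, ← sub_div, abs_mul,
        abs_div, abs_of_pos hfac0, abs_of_pos (h.deriv_pos s hs0)]
      have hb : (Real.nnabs (M * ‖(θ s ^ j * θ' s) • H s‖) : ℝ) =
          M * (θ s ^ j * θ' s * ‖H s‖) := by
        rw [Real.coe_nnabs, abs_of_nonneg (by positivity), norm_smul, Real.norm_eq_abs,
          abs_of_pos (mul_pos (pow_pos hθs j) (h.deriv_pos s hs0))]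
      rw [hb, Real.dist_eq]
      have hstep : |p ^ (j + 1) - q ^ (j + 1)| / fac ≤ M * |r - r'| * θ s ^ j := by
        rw [div_le_iff₀ hfac0]
        calc |p ^ (j + 1) - q ^ (j + 1)| ≤ |p - q| * (j + 1) * θ s ^ j := hpow
          _ ≤ (M * |r - r'|) * (j + 1) * θ s ^ j := by gcongr; exact hpq.trans hl
          _ = (M * |r - r'| * θ s ^ j) * ((j + 1) * 1) := by ring
          _ ≤ (M * |r - r'| * θ s ^ j) * ((j + 1) * (j.factorial : ℝ)) := by gcongr
          _ = _ := by rw [hfacj]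
      have hd0 := h.deriv_pos s hs0
      calc |p ^ (j + 1) - q ^ (j + 1)| / fac * θ' s * ‖H s‖
          ≤ (M * |r - r'| * θ s ^ j) * θ' s * ‖H s‖ := by gcongr
        _ = _ := by ring)
    (hbase.norm.const_mul M)
    (by
      -- For j = 0 the positive part has a corner at s = r₀, which is a null set.
      have hne : ∀ᵐ s ∂(volume.restrict (Set.Ioi a)), s ≠ r₀ :=
        ae_restrict_of_ae (Measure.ae_ne volume r₀)
      filter_upwards [ae_restrict_mem measurableSet_Ioi, hne] with s hs hsr
      have hs0 : 0 < s := ha0.trans hs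
      rcases lt_or_gt_of_ne hsr with hlt | hgt
      · have h0 : F' s = 0 := by simp [F', not_lt.mpr hlt.le]
        rw [h0]
        refine (hasDerivAt_const r₀ (0 : 𝕜)).congr_of_eventuallyEq ?_
        filter_upwards [lt_mem_nhds hlt] with r hsr'
        have := h.strictMonoOn hs0 (hs0.trans hsr') hsr'
        simp only [F]
        rw [max_eq_right (by linarith)]
        simp
      · have h0 : F' s = (-(θ' r₀ * ((θ s - θ r₀) ^ j / (j.factorial : ℝ) * θ' s))) • H s := by
          simp [F', hgt, smul_smul, neg_smul]
        rw [h0]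
        have hd : HasDerivAt (fun r => (θ s - θ r) ^ (j + 1) / fac * θ' s)
            (-(θ' r₀ * ((θ s - θ r₀) ^ j / (j.factorial : ℝ) * θ' s))) r₀ := by
          convert! ((((h.hasDerivAt r₀).const_sub (θ s)).pow (j + 1)).div_const fac).mul_const (θ' s)
            using 1
          rw [hfacj]
          push_cast
          field_simp
        refine (hd.smul_const (H s)).congr_of_eventuallyEq ?_
        filter_upwards [gt_mem_nhds hgt, lt_mem_nhds hr] with r hsr' hr0'
        have := h.strictMonoOn hr0' hs0 hsr'
        change (max (θ s - θ r) 0 ^ (j + 1) / fac * θ' s) • H s = _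
        rw [max_eq_left (by linarith)])
  have hval : ∫ s in Set.Ioi a, F' s = -(θ' r₀ • iterPrim θ θ' j H r₀) := by
    simp only [F']
    rw [setIntegral_indicator measurableSet_Ioi, Set.Ioi_inter_Ioi, sup_eq_right.mpr har.le,
      integral_neg, integral_smul]
    rfl
  rw [← hval]
  refine key.2.congr_of_eventuallyEq ?_
  filter_upwards [lt_mem_nhds har] with r hr' using hFr r hr'

/-- Each of the first N applications of L lowers the order of the primitive by one, at every r > 0.
The last one differentiates the tail integral of θ' H, which is where the Lebesgue point at t
enters. -/
theorem IsScale.iterate_iterPrim {θ θ' : ℝ → ℝ} (h : IsScale θ θ') {N : ℕ} {H : ℝ → 𝕜}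
    (hi : ∀ a, 0 < a → IntegrableOn (fun s => (θ s ^ N * θ' s) • H s) (Set.Ioi a))
    {t : ℝ} (ht : 0 < t) (hH : IsLebesguePoint H t) {L : (ℝ → 𝕜) → ℝ → 𝕜} {c : ℝ → ℝ}
    (hL : ∀ F t, L F t = -(c t • deriv F t)) (hc : ∀ s, 0 < s → c s * θ' s = 1)
    {F : ℝ → 𝕜} (hF : ∀ r, 0 < r → F r = iterPrim θ θ' N H r) :
    IterDiffAt L (N + 1) F t ∧ L^[N + 1] F t = H t := by
  have hstep : ∀ (j : ℕ) (Φ : ℝ → 𝕜), j + 1 ≤ N →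
      (∀ r, 0 < r → Φ r = iterPrim θ θ' (j + 1) H r) → ∀ r, 0 < r →
      HasDerivAt Φ (-(θ' r • iterPrim θ θ' j H r)) r := by
    intro j Φ hj hΦ r hr
    refine (h.hasDerivAt_iterPrim hi hj hr).congr_of_eventuallyEq ?_
    filter_upwards [lt_mem_nhds hr] with r' hr' using hΦ r' hr'
  have hLv : ∀ (Φ : ℝ → 𝕜) (v : 𝕜) (r : ℝ), 0 < r → HasDerivAt Φ (-(θ' r • v)) r → L Φ r = v := by
    intro Φ v r hr hd
    rw [hL, hd.deriv, smul_neg, neg_neg, smul_smul, hc r hr, one_smul]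
  have hiter : ∀ i, i ≤ N → ∀ r, 0 < r → L^[i] F r = iterPrim θ θ' (N - i) H r := by
    intro i
    induction i with
    | zero => intro _ r hr; simpa using hF r hr
    | succ i ih =>
      intro hiN r hr
      rw [Function.iterate_succ_apply']
      have h1 : N - i = (N - (i + 1)) + 1 := by omega
      refine hLv _ _ r hr (hstep _ _ (by omega) (fun r' hr' => ?_) r hr)
      rw [ih (by omega) r' hr', h1]
  have hlow : ∀ i, i < N → ∀ r, 0 < r → DifferentiableAt ℝ (L^[i] F) r := by
    intro i hiN r hr
    have h1 : N - i = (N - (i + 1)) + 1 := by omega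
    exact (hstep (N - (i + 1)) _ (by omega)
      (fun r' hr' => by rw [hiter i hiN.le r' hr', h1]) r hr).differentiableAt
  have hlast : HasDerivAt (L^[N] F) (-(θ' t • H t)) t := by
    have h0 : ∀ r, 0 < r → L^[N] F r = ∫ s in Set.Ioi r, θ' s • H s := by
      intro r hr
      rw [hiter N le_rfl r hr, Nat.sub_self, iterPrim]
      simp
    have hint : IntegrableOn (fun s => θ' s • H s) (Set.Ioi (t / 2)) := by
      have := h.integrableOn_pow hi (Nat.zero_le N) (half_pos ht) (κ := fun _ => 1)
        measurable_const (fun s _ => by simp)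
      simpa using this
    refine ((hH.smul h.continuous_deriv.continuousAt).hasDerivAt_integral_Ioi
      (half_lt_self ht) hint).congr_of_eventuallyEq ?_
    filter_upwards [lt_mem_nhds ht] with r hr using h0 r hr
  refine ⟨fun i hiN => ⟨?_, fun hi2 s hs => hlow i (by omega) s hs⟩, ?_⟩
  · rcases Nat.lt_or_ge i N with h1 | h1
    · exact hlow i h1 t ht
    · obtain rfl : i = N := by omega
      exact hlast.differentiableAt
  · rw [Function.iterate_succ_apply']
    exact hLv _ _ t ht hlast


/-! ### Beta integrals -/

open ProbabilityTheory in
-- The normalization of the beta density, multiplied back by its constant.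
theorem lintegral_beta {α β : ℝ} (hα : 0 < α) (hβ : 0 < β) :
    ∫⁻ x in Set.Ioo (0 : ℝ) 1, ENNReal.ofReal (x ^ (α - 1) * (1 - x) ^ (β - 1)) =
      ENNReal.ofReal (beta α β) := by
  have hb := beta_pos hα hβ
  have h1 := lintegral_betaPDF_eq_one hα hβ
  rw [lintegral_betaPDF] at h1
  have h2 : ∀ x : ℝ, ENNReal.ofReal (1 / beta α β * x ^ (α - 1) * (1 - x) ^ (β - 1)) =
      ENNReal.ofReal (1 / beta α β) * ENNReal.ofReal (x ^ (α - 1) * (1 - x) ^ (β - 1)) := by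
    intro x
    rw [← ENNReal.ofReal_mul (by positivity), mul_assoc]
  simp_rw [h2] at h1
  rw [lintegral_const_mul' _ _ ENNReal.ofReal_ne_top] at h1
  calc _ = ENNReal.ofReal (beta α β) * (ENNReal.ofReal (1 / beta α β) *
        ∫⁻ x in Set.Ioo (0 : ℝ) 1, ENNReal.ofReal (x ^ (α - 1) * (1 - x) ^ (β - 1))) := by
        rw [← mul_assoc, ← ENNReal.ofReal_mul hb.le, mul_one_div_cancel hb.ne', ENNReal.ofReal_one,
          one_mul]
    _ = _ := by rw [h1, mul_one]

theorem injOn_image_Ioo {X X' : ℝ → ℝ} {r u : ℝ} (hru : r < u)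
    (hX : ∀ s ∈ Set.Icc r u, HasDerivAt X (X' s) s) (hX' : ∀ s ∈ Set.Ioo r u, 0 < X' s) :
    Set.InjOn X (Set.Ioo r u) ∧ X '' Set.Ioo r u = Set.Ioo (X r) (X u) := by
  have hc : ContinuousOn X (Set.Icc r u) := fun s hs => (hX s hs).continuousAt.continuousWithinAt
  have hm : StrictMonoOn X (Set.Icc r u) := by
    refine strictMonoOn_of_deriv_pos (convex_Icc r u) hc fun s hs => ?_
    rw [interior_Icc] at hs
    rw [(hX s ⟨hs.1.le, hs.2.le⟩).deriv]
    exact hX' s hs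
  refine ⟨(hm.mono Set.Ioo_subset_Icc_self).injOn, Set.Subset.antisymm ?_ ?_⟩
  · rintro _ ⟨s, hs, rfl⟩
    exact ⟨hm ⟨le_rfl, hru.le⟩ ⟨hs.1.le, hs.2.le⟩ hs.1, hm ⟨hs.1.le, hs.2.le⟩ ⟨hru.le, le_rfl⟩ hs.2⟩
  · exact intermediate_value_Ioo hru.le hc

open ProbabilityTheory in
/-- The beta integral after an increasing change of variables. -/
theorem lintegral_beta_comp {α β : ℝ} (hα : 0 < α) (hβ : 0 < β) {X X' : ℝ → ℝ} {r u : ℝ}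
    (hru : r < u) (hX : ∀ s ∈ Set.Icc r u, HasDerivAt X (X' s) s)
    (hX' : ∀ s ∈ Set.Ioo r u, 0 < X' s) (h0 : X r = 0) (h1 : X u = 1)
    {c : ℝ} (hc : 0 ≤ c) {κ : ℝ → ℝ} (hκ : ∀ s ∈ Set.Ioo r u, 0 < X s → 0 < 1 - X s →
      κ s = c * (X' s * (X s ^ (α - 1) * (1 - X s) ^ (β - 1)))) :
    ∫⁻ s in Set.Ioo r u, ENNReal.ofReal (κ s) = ENNReal.ofReal (c * beta α β) := by
  obtain ⟨hinj, himg⟩ := injOn_image_Ioo hru hX hX'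
  rw [h0, h1] at himg
  rw [ENNReal.ofReal_mul hc, ← lintegral_beta hα hβ, ← himg,
    lintegral_image_eq_lintegral_abs_deriv_mul measurableSet_Ioo
      (fun s hs => (hX s ⟨hs.1.le, hs.2.le⟩).hasDerivWithinAt) hinj,
    ← lintegral_const_mul' _ _ ENNReal.ofReal_ne_top]
  refine setLIntegral_congr_fun measurableSet_Ioo fun s hs => ?_
  have hXs : X s ∈ Set.Ioo (0 : ℝ) 1 := himg ▸ Set.mem_image_of_mem X hs
  rw [hκ s hs hXs.1 (by linarith [hXs.2]), abs_of_pos (hX' s hs), ENNReal.ofReal_mul hc,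
    ENNReal.ofReal_mul (hX' s hs).le]

open ProbabilityTheory in
-- The affine change of s² that maps (r², u²) onto (0, 1). This is the semigroup law of the
-- Erdélyi–Kober integrals at the level of kernels.
theorem lintegral_kernel_direct {α β : ℝ} (hα : 0 < α) (hβ : 0 < β) {r u : ℝ} (hr : 0 < r)
    (hru : r < u) :
    ∫⁻ s in Set.Ioo r u, ENNReal.ofReal
        (s * (s ^ 2 - r ^ 2) ^ (α - 1) * (u ^ 2 - s ^ 2) ^ (β - 1)) =
      ENNReal.ofReal ((u ^ 2 - r ^ 2) ^ (α + β - 1) / 2 * beta α β) := by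
  have hD : 0 < u ^ 2 - r ^ 2 := by nlinarith
  refine lintegral_beta_comp hα hβ (X := fun s => (s ^ 2 - r ^ 2) / (u ^ 2 - r ^ 2))
    (X' := fun s => 2 * s / (u ^ 2 - r ^ 2)) hru (fun s _ => ?_) (fun s hs => ?_) (by simp)
    (div_self hD.ne') (by positivity) (fun s hs h0 h1 => ?_)
  · have := ((hasDerivAt_pow 2 s).sub_const (r ^ 2)).div_const (u ^ 2 - r ^ 2)
    simpa using this
  · have := hr.trans hs.1
    positivity
  · have hs0 := hr.trans hs.1
    have hP : 0 < s ^ 2 - r ^ 2 := by nlinarith [hs.1]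
    have hQ : 0 < u ^ 2 - s ^ 2 := by nlinarith [hs.2]
    have h2 : 1 - (s ^ 2 - r ^ 2) / (u ^ 2 - r ^ 2) = (u ^ 2 - s ^ 2) / (u ^ 2 - r ^ 2) := by
      field_simp; ring
    rw [h2, Real.div_rpow hP.le hD.le, Real.div_rpow hQ.le hD.le]
    have h3 : (u ^ 2 - r ^ 2) ^ (α + β - 1) =
        (u ^ 2 - r ^ 2) ^ (α - 1) * (u ^ 2 - r ^ 2) ^ (β - 1) * (u ^ 2 - r ^ 2) := by
      rw [← Real.rpow_add hD, ← Real.rpow_add_one hD.ne']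
      congr 1; ring
    rw [h3]
    have h4 := Real.rpow_pos_of_pos hD (α - 1)
    have h5 := Real.rpow_pos_of_pos hD (β - 1)
    field_simp

open ProbabilityTheory in
-- Here the variable is affine in s⁻². The power s^(-2(α+β)) is exactly the one that is absorbed by
-- this substitution, at the price of the factors u^(-2α) and r^(-2β).
theorem lintegral_kernel_weighted {α β : ℝ} (hα : 0 < α) (hβ : 0 < β) {r u : ℝ} (hr : 0 < r)
    (hru : r < u) :
    ∫⁻ s in Set.Ioo r u, ENNReal.ofReal
        (s * (s ^ 2 - r ^ 2) ^ (α - 1) * (u ^ 2 - s ^ 2) ^ (β - 1) * s ^ (-(2 * (α + β)))) =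
      ENNReal.ofReal ((u ^ 2 - r ^ 2) ^ (α + β - 1) * u ^ (-(2 * α)) * r ^ (-(2 * β)) / 2 *
        beta α β) := by
  have hu : 0 < u := hr.trans hru
  have hD : 0 < u ^ 2 - r ^ 2 := by nlinarith
  refine lintegral_beta_comp hα hβ
    (X := fun s => u ^ 2 / (u ^ 2 - r ^ 2) * (1 - r ^ 2 * (s ^ 2)⁻¹))
    (X' := fun s => u ^ 2 / (u ^ 2 - r ^ 2) * (2 * r ^ 2 / s ^ 3)) hru (fun s hs => ?_)
    (fun s hs => ?_) ?_ ?_ (by positivity) (fun s hs h0 h1 => ?_)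
  · have hs0 : 0 < s := hr.trans_le hs.1
    have := ((((hasDerivAt_pow 2 s).inv (by positivity)).const_mul (r ^ 2)).const_sub 1).const_mul
      (u ^ 2 / (u ^ 2 - r ^ 2))
    convert! this using 1
    field_simp
    norm_num
  · have := hr.trans hs.1
    positivity
  · field_simp; simp
  · field_simp
  · have hs0 := hr.trans hs.1
    have hP : 0 < s ^ 2 - r ^ 2 := by nlinarith [hs.1]
    have hQ : 0 < u ^ 2 - s ^ 2 := by nlinarith [hs.2]
    have e1 : u ^ 2 / (u ^ 2 - r ^ 2) * (1 - r ^ 2 * (s ^ 2)⁻¹) =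
        u ^ 2 * (s ^ 2 - r ^ 2) / ((u ^ 2 - r ^ 2) * s ^ 2) := by
      field_simp
    have e2 : 1 - u ^ 2 * (s ^ 2 - r ^ 2) / ((u ^ 2 - r ^ 2) * s ^ 2) =
        r ^ 2 * (u ^ 2 - s ^ 2) / ((u ^ 2 - r ^ 2) * s ^ 2) := by
      field_simp; ring
    rw [e1, e2]
    generalize s ^ 2 - r ^ 2 = P at *
    generalize u ^ 2 - s ^ 2 = Q at *
    generalize u ^ 2 - r ^ 2 = D at *
    -- All powers become exponentials of linear combinations of logarithms, so that the identity
    -- reduces to one between exponents.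
    rw [Real.rpow_def_of_pos hP, Real.rpow_def_of_pos hQ, Real.rpow_def_of_pos hs0,
      Real.rpow_def_of_pos hD, Real.rpow_def_of_pos hu, Real.rpow_def_of_pos hr,
      Real.rpow_def_of_pos (by positivity), Real.rpow_def_of_pos (by positivity),
      Real.log_div (by positivity) (by positivity), Real.log_div (by positivity) (by positivity),
      Real.log_mul (by positivity) (by positivity), Real.log_mul (by positivity) (by positivity),
      Real.log_mul (by positivity) (by positivity), Real.log_pow, Real.log_pow, Real.log_pow]
    have f1 : u ^ 2 / D * (2 * r ^ 2 / s ^ 3) =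
        2 * Real.exp (2 * Real.log u - Real.log D + 2 * Real.log r - 3 * Real.log s) := by
      rw [Real.exp_sub, Real.exp_add, Real.exp_sub, Real.exp_log hD,
        show (2 : ℝ) * Real.log u = Real.log (u ^ 2) by rw [Real.log_pow]; norm_num,
        show (2 : ℝ) * Real.log r = Real.log (r ^ 2) by rw [Real.log_pow]; norm_num,
        show (3 : ℝ) * Real.log s = Real.log (s ^ 3) by rw [Real.log_pow]; norm_num,
        Real.exp_log (by positivity), Real.exp_log (by positivity), Real.exp_log (by positivity)]
      ring
    rw [f1]
    nth_rewrite 1 [← Real.exp_log hs0]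
    rw [show ∀ a b c d e f g : ℝ, Real.exp a * Real.exp b * Real.exp c / 2 *
      (2 * Real.exp d * (Real.exp e * Real.exp f)) = Real.exp (a + b + c + d + e + f) by
        intro a b c d e f g; simp only [Real.exp_add]; ring]
    · simp only [← Real.exp_add]
      congr 1
      push_cast
      ring
    -- The auxiliary identity carries a spare variable g; any value will do.
    · exact 0

open ProbabilityTheory in
-- With y = s - ru/s one has (s² - r²)(u² - s²)/s² = (u - r)² - y², so q is a function of y alone
-- and dy = (1 + ru/s²) ds leads to a beta integral. The involution s ↦ ru/s of (r, u) sends y to -y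
-- and shows that the two terms of dy contribute equally, which isolates the wanted integral of
-- q/s².
theorem lintegral_kernel_ordinary {a : ℝ} (ha : 0 < a) {r u : ℝ} (hr : 0 < r) (hru : r < u) :
    ∫⁻ s in Set.Ioo r u, ENNReal.ofReal
        ((s ^ 2 - r ^ 2) ^ (a - 1) * (u ^ 2 - s ^ 2) ^ (a - 1) * s ^ (-(2 * a))) =
      ENNReal.ofReal (4 ^ (a - 1) * (u - r) ^ (2 * a - 1) / (r * u) * beta a a) := by
  have hu : 0 < u := hr.trans hru
  have hD : 0 < u - r := by linarith
  set q : ℝ → ℝ := fun s =>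
    (s ^ 2 - r ^ 2) ^ (a - 1) * (u ^ 2 - s ^ 2) ^ (a - 1) * s ^ (2 - 2 * a) with hq
  have hqm : Measurable q := by fun_prop
  have h1 : ∫⁻ s in Set.Ioo r u, ENNReal.ofReal (q s * (1 + r * u / s ^ 2)) =
      ENNReal.ofReal (2 * 4 ^ (a - 1) * (u - r) ^ (2 * a - 1) * beta a a) := by
    refine lintegral_beta_comp ha ha
      (X := fun s => (s - r * u * s⁻¹ + (u - r)) / (2 * (u - r)))
      (X' := fun s => (1 + r * u / s ^ 2) / (2 * (u - r))) hru (fun s hs => ?_)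
      (fun s hs => ?_) ?_ ?_ (by positivity) (fun s hs h0 h1 => ?_)
    · have hs0 : 0 < s := hr.trans_le hs.1
      have := (((hasDerivAt_id s).sub ((hasDerivAt_inv hs0.ne').const_mul (r * u))).add_const
        (u - r)).div_const (2 * (u - r))
      convert! this using 1
      field_simp
      ring
    · have := hr.trans hs.1
      positivity
    · field_simp; ring
    · field_simp; ring
    · have hs0 := hr.trans hs.1
      have hP : 0 < s ^ 2 - r ^ 2 := by nlinarith [hs.1]
      have hQ : 0 < u ^ 2 - s ^ 2 := by nlinarith [hs.2]
      have e1 : (s - r * u * s⁻¹ + (u - r)) / (2 * (u - r)) *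
          (1 - (s - r * u * s⁻¹ + (u - r)) / (2 * (u - r))) =
          (s ^ 2 - r ^ 2) * (u ^ 2 - s ^ 2) / (4 * s ^ 2 * (u - r) ^ 2) := by
        field_simp; ring
      simp only [hq]
      rw [← Real.mul_rpow h0.le h1.le, e1]
      have e2 : (2 : ℝ) * 4 ^ (a - 1) * (u - r) ^ (2 * a - 1) *
          ((1 + r * u / s ^ 2) / (2 * (u - r)) *
          ((s ^ 2 - r ^ 2) * (u ^ 2 - s ^ 2) / (4 * s ^ 2 * (u - r) ^ 2)) ^ (a - 1)) =
          (4 ^ (a - 1) * ((u - r) ^ (2 * a - 1) * (u - r)⁻¹) *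
          ((s ^ 2 - r ^ 2) * (u ^ 2 - s ^ 2) / (4 * s ^ 2 * (u - r) ^ 2)) ^ (a - 1)) *
          (1 + r * u / s ^ 2) := by
        field_simp
      rw [e2]
      congr 1
      generalize s ^ 2 - r ^ 2 = P at *
      generalize u ^ 2 - s ^ 2 = Q at *
      generalize u - r = D at *
      rw [Real.rpow_def_of_pos hP, Real.rpow_def_of_pos hQ, Real.rpow_def_of_pos hs0,
        Real.rpow_def_of_pos hD, Real.rpow_def_of_pos (by norm_num : (0 : ℝ) < 4),
        Real.rpow_def_of_pos (by positivity),
        Real.log_div (by positivity) (by positivity), 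
        Real.log_mul (by positivity) (by positivity), Real.log_mul (by positivity) (by positivity),
        Real.log_mul (by positivity) (by positivity), Real.log_pow, Real.log_pow]
      nth_rewrite 2 [← Real.exp_log hD]
      rw [← Real.exp_neg]
      simp only [← Real.exp_add]
      congr 1
      push_cast
      ring
  have hinv : ∫⁻ s in Set.Ioo r u, ENNReal.ofReal (q s) =
      ENNReal.ofReal (r * u) * ∫⁻ s in Set.Ioo r u, ENNReal.ofReal (q s / s ^ 2) := by
    have himg : (fun s : ℝ => r * u / s) '' Set.Ioo r u = Set.Ioo r u := by
      have hmap : ∀ s ∈ Set.Ioo r u, r * u / s ∈ Set.Ioo r u := by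
        intro s hs
        have hs0 := hr.trans hs.1
        constructor
        · rw [lt_div_iff₀ hs0]; nlinarith [hs.2]
        · rw [div_lt_iff₀ hs0]; nlinarith [hs.1]
      refine Set.Subset.antisymm ?_ fun s hs => ⟨r * u / s, hmap s hs, ?_⟩
      · rintro _ ⟨s, hs, rfl⟩; exact hmap s hs
      · have hs0 := hr.trans hs.1
        field_simp
    nth_rewrite 1 [← himg]
    rw [lintegral_image_eq_lintegral_abs_deriv_mul measurableSet_Ioo
      (f' := fun s => -(r * u / s ^ 2)), ← lintegral_const_mul' _ _ ENNReal.ofReal_ne_top]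
    · refine setLIntegral_congr_fun measurableSet_Ioo fun s hs => ?_
      have hs0 := hr.trans hs.1
      have hP : 0 < s ^ 2 - r ^ 2 := by nlinarith [hs.1]
      have hQ : 0 < u ^ 2 - s ^ 2 := by nlinarith [hs.2]
      rw [abs_neg, ← ENNReal.ofReal_mul (abs_nonneg _), ← ENNReal.ofReal_mul (by positivity),
        abs_of_pos (by positivity)]
      have hqs : q (r * u / s) = q s := by
        have e1 : (r * u / s) ^ 2 - r ^ 2 = (r / s) ^ 2 * (u ^ 2 - s ^ 2) := by
          field_simp
        have e2 : u ^ 2 - (r * u / s) ^ 2 = (u / s) ^ 2 * (s ^ 2 - r ^ 2) := by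
          field_simp
        simp only [hq]
        rw [e1, e2]
        generalize s ^ 2 - r ^ 2 = P at *
        generalize u ^ 2 - s ^ 2 = Q at *
        rw [Real.rpow_def_of_pos hP, Real.rpow_def_of_pos hQ, Real.rpow_def_of_pos hs0,
          Real.rpow_def_of_pos (by positivity), Real.rpow_def_of_pos (by positivity),
          Real.rpow_def_of_pos (by positivity),
          Real.log_div (by positivity) (by positivity),
          Real.log_mul (by positivity) (by positivity), Real.log_mul (by positivity) (by positivity),
          Real.log_mul (by positivity) (by positivity), Real.log_pow, Real.log_pow,
          Real.log_div (by positivity) (by positivity),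
          Real.log_div (by positivity) (by positivity)]
        simp only [← Real.exp_add]
        congr 1
        push_cast
        ring
      rw [hqs]
      congr 1
      field_simp
    · intro s hs
      have hs0 := hr.trans hs.1
      have := (hasDerivAt_inv hs0.ne').const_mul (r * u)
      convert! this.hasDerivWithinAt using 1
      field_simp
    · intro s hs s' hs' heq
      have hs0 := hr.trans hs.1
      have hs0' := hr.trans hs'.1
      simp only at heq
      field_simp at heq
      exact heq.symm
  have hq0 : ∀ s ∈ Set.Ioo r u, 0 ≤ q s := by
    intro s hs
    have hs0 := hr.trans hs.1
    have hP : 0 < s ^ 2 - r ^ 2 := by nlinarith [hs.1]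
    have hQ : 0 < u ^ 2 - s ^ 2 := by nlinarith [hs.2]
    simp only [hq]; positivity
  have hsplit : ∫⁻ s in Set.Ioo r u, ENNReal.ofReal (q s * (1 + r * u / s ^ 2)) =
      ENNReal.ofReal (2 * (r * u)) * ∫⁻ s in Set.Ioo r u, ENNReal.ofReal (q s / s ^ 2) := by
    calc _ = ∫⁻ s in Set.Ioo r u,
          (ENNReal.ofReal (q s) + ENNReal.ofReal (r * u) * ENNReal.ofReal (q s / s ^ 2)) := by
          refine setLIntegral_congr_fun measurableSet_Ioo fun s hs => ?_
          have hs0 := hr.trans hs.1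
          have := hq0 s hs
          rw [← ENNReal.ofReal_mul (by positivity), ← ENNReal.ofReal_add this (by positivity)]
          congr 1; field_simp
      _ = _ := by
          rw [lintegral_add_left (by fun_prop), lintegral_const_mul' _ _ ENNReal.ofReal_ne_top, hinv,
            two_mul, ENNReal.ofReal_add (by positivity) (by positivity), add_mul]
  have hcong : ∫⁻ s in Set.Ioo r u, ENNReal.ofReal
        ((s ^ 2 - r ^ 2) ^ (a - 1) * (u ^ 2 - s ^ 2) ^ (a - 1) * s ^ (-(2 * a))) =
      ∫⁻ s in Set.Ioo r u, ENNReal.ofReal (q s / s ^ 2) := by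
    refine setLIntegral_congr_fun measurableSet_Ioo fun s hs => ?_
    have hs0 := hr.trans hs.1
    simp only [hq]
    rw [mul_div_assoc, ← Real.rpow_natCast s 2, ← Real.rpow_sub hs0]
    congr 3; push_cast; ring
  rw [hcong]
  rw [hsplit] at h1
  have hru0 : 0 < 2 * (r * u) := by positivity
  calc ∫⁻ s in Set.Ioo r u, ENNReal.ofReal (q s / s ^ 2)
      = ENNReal.ofReal (2 * (r * u))⁻¹ * (ENNReal.ofReal (2 * (r * u)) *
        ∫⁻ s in Set.Ioo r u, ENNReal.ofReal (q s / s ^ 2)) := by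
        rw [← mul_assoc, ← ENNReal.ofReal_mul (by positivity), inv_mul_cancel₀ hru0.ne',
          ENNReal.ofReal_one, one_mul]
    _ = _ := by
        rw [h1, ← ENNReal.ofReal_mul (by positivity)]
        congr 1
        field_simp

/-! ### Composition of integral operators on the half-line -/

/-- Tonelli on the triangle r < s < u. -/
theorem lintegral_compose {A : ℝ → ℝ} {B : ℝ → ℝ → ℝ} {κ : ℝ → ℝ} {r : ℝ} (hA : Measurable A)
    (hB : Measurable (Function.uncurry B)) (hA0 : ∀ s, r < s → 0 ≤ A s)
    (hκ : ∀ u, r < u → ∫⁻ s in Set.Ioo r u, ENNReal.ofReal (A s * B s u) = ENNReal.ofReal (κ u))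
    {g : ℝ → ℝ≥0∞} (hg : AEMeasurable g (volume.restrict (Set.Ioi r))) :
    ∫⁻ s in Set.Ioi r, ENNReal.ofReal (A s) * ∫⁻ u in Set.Ioi s, ENNReal.ofReal (B s u) * g u =
      ∫⁻ u in Set.Ioi r, ENNReal.ofReal (κ u) * g u := by
  set μ := volume.restrict (Set.Ioi r)
  let T : Set (ℝ × ℝ) := {q | q.1 < q.2}
  have hT : MeasurableSet T := measurableSet_lt measurable_fst measurable_snd
  let K : ℝ → ℝ → ℝ≥0∞ := fun s u => T.indicator (fun q => ENNReal.ofReal (A q.1 * B q.1 q.2)) (s, u)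
  have hKm : Measurable (Function.uncurry K) := by
    refine Measurable.indicator ?_ hT
    exact ((hA.comp measurable_fst).mul hB).ennreal_ofReal
  have h1 : ∀ s ∈ Set.Ioi r, ENNReal.ofReal (A s) *
      ∫⁻ u in Set.Ioi s, ENNReal.ofReal (B s u) * g u = ∫⁻ u, K s u * g u ∂μ := by
    intro s hs
    have : Set.Ioi s = Set.Ioi r ∩ Set.Ioi s := by
      rw [Set.Ioi_inter_Ioi, sup_eq_right.mpr (le_of_lt hs)]
    rw [← lintegral_const_mul' _ _ ENNReal.ofReal_ne_top, this, ← Measure.restrict_restrict_of_subset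
      (s := Set.Ioi r ∩ Set.Ioi s) (t := Set.Ioi r) Set.inter_subset_left,
      Set.inter_comm, ← Measure.restrict_restrict measurableSet_Ioi]
    rw [Measure.restrict_restrict_of_subset le_rfl,
      ← lintegral_indicator measurableSet_Ioi]
    refine lintegral_congr fun u => ?_
    by_cases hu : s < u
    · simp [K, T, Set.indicator, hu, ENNReal.ofReal_mul (hA0 s hs), mul_assoc]
    · simp [K, T, Set.indicator, hu]
  rw [setLIntegral_congr_fun measurableSet_Ioi h1, lintegral_lintegral_swap]
  · refine setLIntegral_congr_fun measurableSet_Ioi fun u hu => ?_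
    have hmm : Measurable fun s => K s u := hKm.comp measurable_prodMk_right
    rw [lintegral_mul_const _ hmm, ← hκ u hu]
    congr 1
    have : Set.Ioo r u = Set.Iio u ∩ Set.Ioi r := by
      rw [Set.inter_comm, Set.Ioi_inter_Iio]
    rw [this, ← Measure.restrict_restrict measurableSet_Iio, ← lintegral_indicator measurableSet_Iio]
    refine lintegral_congr fun s => ?_
    by_cases hs : s < u <;> simp [K, T, Set.indicator, hs]
  · exact hKm.aemeasurable.mul hg.comp_snd

/-- Fubini on the triangle, the absolute convergence being supplied by `lintegral_compose`. The
formula for F is only needed almost everywhere, which matters for k = 1, where it is established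
only at almost every radius. -/
theorem integral_compose {A : ℝ → ℝ} {B : ℝ → ℝ → ℝ} {κ : ℝ → ℝ} {r : ℝ} (hA : Measurable A)
    (hB : Measurable (Function.uncurry B)) (hA0 : ∀ s, r < s → 0 ≤ A s)
    (hB0 : ∀ s u, r < s → s < u → 0 ≤ B s u) (hκ0 : ∀ u, r < u → 0 ≤ κ u)
    (hκ : ∀ u, r < u → ∫⁻ s in Set.Ioo r u, ENNReal.ofReal (A s * B s u) = ENNReal.ofReal (κ u))
    {G : ℝ → 𝕜} (hG : AEStronglyMeasurable G (volume.restrict (Set.Ioi r)))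
    (hi : IntegrableOn (fun u => κ u • G u) (Set.Ioi r)) {F : ℝ → 𝕜}
    (hF : ∀ᵐ s ∂(volume.restrict (Set.Ioi r)), F s = ∫ u in Set.Ioi s, B s u • G u) :
    IntegrableOn (fun s => A s • F s) (Set.Ioi r) ∧
    ∫ s in Set.Ioi r, A s • F s = ∫ u in Set.Ioi r, κ u • G u := by
  set μ := volume.restrict (Set.Ioi r) with hμ
  let T : Set (ℝ × ℝ) := {q | q.1 < q.2}
  have hT : MeasurableSet T := measurableSet_lt measurable_fst measurable_snd
  let K : ℝ × ℝ → ℝ := T.indicator fun q => A q.1 * B q.1 q.2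
  have hKm : Measurable K := Measurable.indicator ((hA.comp measurable_fst).mul hB) hT
  have hsub : ∀ s ∈ Set.Ioi r, Set.Ioi s = Set.Ioi s ∩ Set.Ioi r := fun s hs => by
    rw [Set.Ioi_inter_Ioi, sup_eq_left.mpr (le_of_lt hs)]
  have hinner : ∀ s ∈ Set.Ioi r, ∫ u, K (s, u) • G u ∂μ = A s • ∫ u in Set.Ioi s, B s u • G u := by
    intro s hs
    rw [← integral_smul (A s) (fun u => B s u • G u), hsub s hs,
      ← Measure.restrict_restrict measurableSet_Ioi,
      ← integral_indicator (measurableSet_Ioi (a := s))]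
    refine integral_congr_ae (Eventually.of_forall fun u => ?_)
    by_cases hu : s < u <;> simp [K, T, Set.indicator, hu, mul_smul]
  have hΦm : AEStronglyMeasurable (fun q : ℝ × ℝ => K q • G q.2) (μ.prod μ) :=
    hKm.aestronglyMeasurable.smul hG.comp_snd
  have hΦ : Integrable (fun q : ℝ × ℝ => K q • G q.2) (μ.prod μ) := by
    refine ⟨hΦm, ?_⟩
    rw [hasFiniteIntegral_iff_enorm, lintegral_prod _ hΦm.enorm]
    have h1 : ∀ s ∈ Set.Ioi r, ∫⁻ u, ‖K (s, u) • G u‖ₑ ∂μ =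
        ENNReal.ofReal (A s) * ∫⁻ u in Set.Ioi s, ENNReal.ofReal (B s u) * ‖G u‖ₑ := by
      intro s hs
      rw [← lintegral_const_mul' _ _ ENNReal.ofReal_ne_top, hsub s hs,
        ← Measure.restrict_restrict measurableSet_Ioi,
        ← lintegral_indicator (measurableSet_Ioi (a := s))]
      refine lintegral_congr fun u => ?_
      by_cases hu : s < u
      · simp only [K, T, Set.indicator, Set.mem_ofPred_eq, hu, if_true, Set.mem_Ioi, enorm_smul]
        rw [← mul_assoc, ← ENNReal.ofReal_mul (hA0 s hs),
          Real.enorm_of_nonneg (mul_nonneg (hA0 s hs) (hB0 s u hs hu))]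
      · simp [K, T, Set.indicator, hu]
    rw [hμ] at h1 ⊢
    rw [setLIntegral_congr_fun measurableSet_Ioi h1, lintegral_compose hA hB hA0 hκ hG.enorm]
    have h2 := hi.2
    rw [hasFiniteIntegral_iff_enorm] at h2
    refine lt_of_le_of_lt (le_of_eq ?_) h2
    refine setLIntegral_congr_fun measurableSet_Ioi fun u hu => ?_
    rw [enorm_smul, Real.enorm_of_nonneg (hκ0 u hu)]
  have hFK : (fun s => A s • F s) =ᵐ[μ] fun s => ∫ u, K (s, u) • G u ∂μ := by
    filter_upwards [hF, ae_restrict_mem measurableSet_Ioi] with s hs hsr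
    rw [hinner s hsr, hs]
  refine ⟨hΦ.integral_prod_left.congr hFK.symm, ?_⟩
  rw [integral_congr_ae hFK, integral_integral_swap (f := fun s u => K (s, u) • G u) hΦ]
  refine setIntegral_congr_fun measurableSet_Ioi fun u hu => ?_
  rw [integral_smul_const]
  congr 1
  have hK2 : ∫ s, K (s, u) ∂μ = ∫ s in Set.Ioo r u, A s * B s u := by
    have : Set.Ioo r u = Set.Iio u ∩ Set.Ioi r := by
      rw [Set.inter_comm, Set.Ioi_inter_Iio]
    rw [this, ← Measure.restrict_restrict measurableSet_Iio, ← integral_indicator measurableSet_Iio]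
    refine integral_congr_ae (Eventually.of_forall fun s => ?_)
    by_cases hs : s < u <;> simp [K, T, Set.indicator, hs]
  have hABm : Measurable fun s => A s * B s u :=
    hA.mul (hB.comp measurable_prodMk_right)
  rw [hK2, integral_eq_lintegral_of_nonneg_ae ?_ hABm.aestronglyMeasurable, hκ u hu,
    ENNReal.toReal_ofReal (hκ0 u hu)]
  filter_upwards [ae_restrict_mem measurableSet_Ioo] with s hs
  exact mul_nonneg (hA0 s hs.1) (hB0 s u hs.1 hs.2)


/-! ### Inversion of the fractional integral -/

theorem isScale_sq : IsScale (fun s : ℝ => s ^ 2) (fun s => 2 * s) where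
  hasDerivAt s := by simpa using hasDerivAt_pow 2 s
  continuous_deriv := by fun_prop
  deriv_pos s hs := by positivity
  pos s hs := by positivity

theorem isScale_id : IsScale (fun s : ℝ => s) (fun _ => 1) where
  hasDerivAt s := hasDerivAt_id s
  continuous_deriv := continuous_const
  deriv_pos _ _ := one_pos
  pos _ hs := hs

theorem negD_eq (F : ℝ → 𝕜) (t : ℝ) : negD F t = -((1 / (2 * t)) • deriv F t) := rfl

theorem negDeriv_eq (F : ℝ → 𝕜) (t : ℝ) : negDeriv F t = -((1 : ℝ) • deriv F t) := by
  rw [one_smul]; rfl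

/-- The kernel of the fractional integral that expresses the dual mean through spherical means. -/
def meanKernel (k : ℕ) (r s : ℝ) : ℝ :=
  sphereArea k * ((s ^ 2 - r ^ 2) ^ ((k : ℝ) / 2 - 1) * s)

theorem measurable_meanKernel (k : ℕ) : Measurable (Function.uncurry (meanKernel k)) := by
  unfold meanKernel Function.uncurry; fun_prop

theorem meanKernel_nonneg {k : ℕ} (hk : 1 ≤ k) {r s : ℝ} (hr : 0 < r) (hrs : r < s) :
    0 ≤ meanKernel k r s := by
  have h1 := sphereArea_pos hk
  have h2 : 0 < s := hr.trans hrs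
  have h3 : 0 < s ^ 2 - r ^ 2 := by nlinarith
  unfold meanKernel; positivity

/-- This makes the integral against `meanKernel` equal to π^(k/2) times the Erdélyi–Kober integral
of order k/2, and is the source of the factor π^(-k/2) in the inversion formula. -/
theorem sphereArea_mul_Gamma {k : ℕ} (hk : 1 ≤ k) :
    sphereArea k * Real.Gamma ((k : ℝ) / 2) = 2 * Real.pi ^ ((k : ℝ) / 2) := by
  have : Real.Gamma ((k : ℝ) / 2) ≠ 0 := (Real.Gamma_pos_of_pos (by positivity)).ne'
  unfold sphereArea; field_simp

theorem lintegral_meanKernel {k : ℕ} (hk : 1 ≤ k) {A : ℝ → ℝ} {u c v : ℝ} (hu : 0 < u)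
    {S : Set ℝ} (hc : ∫⁻ s in S, ENNReal.ofReal (A s * (u ^ 2 - s ^ 2) ^ ((k : ℝ) / 2 - 1)) =
      ENNReal.ofReal c) (hv : v = sphereArea k * u * c) :
    ∫⁻ s in S, ENNReal.ofReal (A s * meanKernel k s u) = ENNReal.ofReal v := by
  have h0 := sphereArea_pos hk
  rw [hv, ENNReal.ofReal_mul (by positivity), ← hc, ← lintegral_const_mul' _ _ ENNReal.ofReal_ne_top]
  refine lintegral_congr fun s => ?_
  rw [← ENNReal.ofReal_mul (by positivity), meanKernel]
  congr 1; ring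

/-- Common core of the direct, weighted and ordinary forms. They differ only in the order α, the
weight w and the resulting kernel. -/
theorem ekInt_compose {k : ℕ} (hk : 1 ≤ k) {α : ℝ} (hα : 0 < α) {w : ℝ → ℝ} (hw : Measurable w)
    (hw0 : ∀ s, 0 < s → 0 ≤ w s) {G : ℝ → 𝕜}
    (hG : AEStronglyMeasurable G (volume.restrict (Set.Ioi 0))) {F : ℝ → 𝕜}
    (hF : ∀ᵐ r ∂(volume.restrict (Set.Ioi (0 : ℝ))),
      F r = ∫ s in Set.Ioi r, meanKernel k r s • G s)
    {r : ℝ} (hr : 0 < r) {ker : ℝ → ℝ} (hker0 : ∀ u, r < u → 0 ≤ ker u)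
    (hker : ∀ u, r < u → ∫⁻ s in Set.Ioo r u,
      ENNReal.ofReal (s * (s ^ 2 - r ^ 2) ^ (α - 1) * w s * meanKernel k s u) =
        ENNReal.ofReal (Real.Gamma α / 2 * ker u))
    (hi : IntegrableOn (fun u => ker u • G u) (Set.Ioi r)) :
    EkConverges α (fun s => w s • F s) r ∧
      ekInt α (fun s => w s • F s) r = ∫ u in Set.Ioi r, ker u • G u := by
  have hΓ := Real.Gamma_pos_of_pos hα
  have hle : volume.restrict (Set.Ioi r) ≤ volume.restrict (Set.Ioi (0 : ℝ)) :=
    Measure.restrict_mono (Set.Ioi_subset_Ioi hr.le) le_rfl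
  have h := integral_compose (A := fun s => s * (s ^ 2 - r ^ 2) ^ (α - 1) * w s)
    (B := meanKernel k) (κ := fun u => Real.Gamma α / 2 * ker u) (r := r) (by fun_prop)
    (measurable_meanKernel k) (fun s hs => ?_) (fun s u hs hu => ?_) (fun u hu => ?_) hker
    (hG.mono_measure hle) ?_ (ae_mono hle hF)
  · have h1 : ∀ s, (s * (s ^ 2 - r ^ 2) ^ (α - 1) * w s) • F s =
        (s * (s ^ 2 - r ^ 2) ^ (α - 1)) • (w s • F s) := fun s => by rw [smul_smul]
    simp only [h1] at h
    refine ⟨h.1, ?_⟩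
    rw [ekInt, h.2, ← integral_smul (2 / Real.Gamma α)]
    refine integral_congr_ae (Eventually.of_forall fun u => ?_)
    simp only [smul_smul]
    congr 1
    field_simp
  · have h2 : 0 < s ^ 2 - r ^ 2 := by nlinarith
    have h3 : 0 < s := hr.trans hs
    have := hw0 s h3
    positivity
  · exact meanKernel_nonneg hk (hr.trans hs) hu
  · exact mul_nonneg (by positivity) (hker0 u hu)
  · have h1 : ∀ u, (Real.Gamma α / 2 * ker u) • G u = (Real.Gamma α / 2) • ker u • G u :=
      fun u => by rw [smul_smul]
    simp only [h1]
    exact hi.smul (Real.Gamma α / 2)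

/-! ### The four expressions applied to a fractional integral of order k/2 -/

theorem half_order_pos (k : ℕ) : 0 < 1 - (k : ℝ) / 2 + (k / 2 : ℕ) := by
  have h : k < 2 * (k / 2) + 2 := by omega
  have h' : (k : ℝ) < 2 * (k / 2 : ℕ) + 2 := by exact_mod_cast h
  linarith

/-- For even k the exponent k/2 - 1 is a natural number, so F is already an iterated primitive with
respect to s² and no further fractional integral is needed. The formula for F is required at every
r, since F itself is differentiated. -/
theorem evenForm_eq {k : ℕ} (hk : 1 ≤ k) (hev : Even k) {G : ℝ → 𝕜}
    (hG : ∀ a, 0 < a → IntegrableOn (fun s => s ^ (k - 1) • G s) (Set.Ioi a)) {F : ℝ → 𝕜}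
    (hF : ∀ r, 0 < r → F r = ∫ s in Set.Ioi r, meanKernel k r s • G s)
    {t : ℝ} (ht : 0 < t) (hLeb : IsLebesguePoint G t) :
    EvenFormExists k F t ∧ evenForm k F t = Real.pi ^ ((k : ℝ) / 2) • G t := by
  obtain ⟨N, hN⟩ : ∃ N, k = 2 * N + 2 := by
    obtain ⟨j, hj⟩ := hev
    exact ⟨j - 1, by omega⟩
  have hk2 : k / 2 = N + 1 := by omega
  have hkr : (k : ℝ) / 2 = N + 1 := by rw [hN]; push_cast; ring
  set c := Real.pi ^ ((k : ℝ) / 2) with hc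
  have h := isScale_sq.iterate_iterPrim (N := N) (H := fun s => c • G s) (fun a ha => ?_) ht
    (hLeb.smul (w := fun _ => c) continuousAt_const) negD_eq (fun s hs => by field_simp)
    (F := F) (fun r hr => ?_)
  · rw [EvenFormExists, evenForm, hk2]
    exact h
  · refine IntegrableOn.congr_fun ((hG a ha).smul (2 * c)) (fun s _ => ?_) measurableSet_Ioi
    simp only [Pi.smul_apply, smul_smul]
    congr 1
    rw [hN, ← pow_mul, show 2 * N + 2 - 1 = 2 * N + 1 by omega, pow_succ]
    ring
  · rw [hF r hr, iterPrim]
    refine setIntegral_congr_fun measurableSet_Ioi fun s hs => ?_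
    simp only [smul_smul]
    congr 1
    rw [meanKernel, sphereArea, ← hc, hkr, add_sub_cancel_right, Real.rpow_natCast,
      Real.Gamma_nat_eq_factorial]
    ring

/-- The auxiliary order, 1 for even k and 1/2 for odd k, completes k/2 to the integer m + 1. -/
theorem order_add (k : ℕ) :
    (1 - (k : ℝ) / 2 + (k / 2 : ℕ)) + (k : ℝ) / 2 = (k / 2 : ℕ) + 1 := by ring

open ProbabilityTheory in
theorem Gamma_mul_beta_half {k : ℕ} (hk : 1 ≤ k) {α : ℝ} {m : ℕ}
    (hαk : α + (k : ℝ) / 2 = m + 1) :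
    sphereArea k * beta α ((k : ℝ) / 2) =
      2 * Real.pi ^ ((k : ℝ) / 2) * Real.Gamma α / (m.factorial : ℝ) := by
  rw [beta, hαk, Real.Gamma_nat_eq_factorial, ← sphereArea_mul_Gamma hk]
  ring

/-- Orders add up to m + 1, so the composition is an iterated primitive with respect to s². Without
a weight its integrand grows like s^(2m+1) G(s), which exceeds the s^(k-1) available in general.
This is the reason for the stronger restriction on p. -/
theorem directForm_eq {k : ℕ} (hk : 1 ≤ k) {G : ℝ → 𝕜}
    (hGm : AEStronglyMeasurable G (volume.restrict (Set.Ioi 0)))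
    (hG : ∀ a, 0 < a → IntegrableOn (fun s => s ^ (2 * (k / 2) + 1) • G s) (Set.Ioi a))
    {F : ℝ → 𝕜} (hF : ∀ᵐ r ∂(volume.restrict (Set.Ioi (0 : ℝ))),
      F r = ∫ s in Set.Ioi r, meanKernel k r s • G s)
    {t : ℝ} (ht : 0 < t) (hLeb : IsLebesguePoint G t) :
    DirectFormExists k F t ∧ directForm k F t = Real.pi ^ ((k : ℝ) / 2) • G t := by
  set m := k / 2 with hm
  set α : ℝ := 1 - (k : ℝ) / 2 + m with hα
  have hα0 : 0 < α := half_order_pos k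
  have hαk : α + (k : ℝ) / 2 = m + 1 := order_add k
  have hβ : (0 : ℝ) < (k : ℝ) / 2 := by positivity
  set c := Real.pi ^ ((k : ℝ) / 2) with hc
  have hi : ∀ a, 0 < a →
      IntegrableOn (fun s : ℝ => ((s ^ 2) ^ m * (2 * s)) • (c • G s)) (Set.Ioi a) := by
    intro a ha
    refine IntegrableOn.congr_fun ((hG a ha).smul (2 * c)) (fun s _ => ?_) measurableSet_Ioi
    simp only [Pi.smul_apply, smul_smul]
    congr 1
    rw [← pow_mul, pow_succ]
    ring
  have hek : ∀ r, 0 < r → EkConverges α F r ∧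
      ekInt α F r = iterPrim (fun s => s ^ 2) (fun s => 2 * s) m (fun s => c • G s) r := by
    intro r hr
    have hint := isScale_sq.integrableOn_iterPrim hi le_rfl hr
    have h := ekInt_compose hk hα0 (w := fun _ => 1) measurable_const (fun _ _ => zero_le_one) hGm hF
      hr (ker := fun u => (u ^ 2 - r ^ 2) ^ m / (m.factorial : ℝ) * (2 * u) * c)
      (fun u hu => ?_) (fun u hu => ?_) ?_
    · simp only [one_smul] at h
      refine ⟨h.1, h.2.trans ?_⟩
      rw [iterPrim]
      simp only [smul_smul]
    · have h2 : 0 < u ^ 2 - r ^ 2 := by nlinarith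
      have h3 : 0 < u := hr.trans hu
      positivity
    · simp only [mul_one]
      refine lintegral_meanKernel hk (hr.trans hu) (lintegral_kernel_direct hα0 hβ hr hu) ?_
      have := Gamma_mul_beta_half hk hαk
      rw [hαk, add_sub_cancel_right, Real.rpow_natCast]
      rw [show ∀ a b c d : ℝ, a * b * (c / 2 * d) = a * d * (b * c / 2) by intros; ring, this]
      ring
    · simpa only [smul_smul] using hint
  have h := isScale_sq.iterate_iterPrim hi ht (hLeb.smul (w := fun _ => c) continuousAt_const)
    negD_eq (fun s hs => by field_simp) (F := ekInt α F) (fun r hr => (hek r hr).2)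
  exact ⟨⟨fun s hs => (hek s hs).1, h.1⟩, h.2⟩

/-- The value of the kernel integral that occurs in `weightedPsi`. -/
theorem lintegral_weighted_meanKernel {k : ℕ} (hk : 1 ≤ k) {α : ℝ} (hα0 : 0 < α) {m : ℕ}
    (hαk : α + (k : ℝ) / 2 = m + 1) {r u : ℝ} (hr : 0 < r) (hu : r < u) :
    ∫⁻ s in Set.Ioo r u, ENNReal.ofReal (s * (s ^ 2 - r ^ 2) ^ (α - 1) * (s ^ (2 * m + 2))⁻¹ *
        meanKernel k s u) = ENNReal.ofReal (Real.Gamma α / 2 * ((r ^ k)⁻¹ *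
        ((u ^ 2 - r ^ 2) ^ m / (m.factorial : ℝ) * (2 * u) *
          (u ^ (-(2 * α)) * Real.pi ^ ((k : ℝ) / 2))))) := by
  have hβ : (0 : ℝ) < (k : ℝ) / 2 := by positivity
  refine lintegral_meanKernel hk (hr.trans hu) (c := (u ^ 2 - r ^ 2) ^ (α + (k : ℝ) / 2 - 1) *
    u ^ (-(2 * α)) * r ^ (-(2 * ((k : ℝ) / 2))) / 2 * ProbabilityTheory.beta α ((k : ℝ) / 2)) ?_ ?_
  · rw [← lintegral_kernel_weighted hα0 hβ hr hu]
    refine setLIntegral_congr_fun measurableSet_Ioo fun s hs => ?_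
    have hs0 := hr.trans hs.1
    have e : s ^ (-(2 * (α + (k : ℝ) / 2))) = (s ^ (2 * m + 2))⁻¹ := by
      rw [hαk, ← Real.rpow_natCast, ← Real.rpow_neg hs0.le]
      congr 1; push_cast; ring
    rw [e]
    congr 1; ring
  · have := Gamma_mul_beta_half hk hαk
    have e : r ^ (-(2 * ((k : ℝ) / 2))) = (r ^ k)⁻¹ := by
      rw [← Real.rpow_natCast, ← Real.rpow_neg hr.le]
      congr 1; ring
    rw [hαk, add_sub_cancel_right, Real.rpow_natCast, e]
    rw [show ∀ a b c d e f : ℝ, a * b * (c * d * e / 2 * f) = a * f * (b * c * d * e / 2) by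
      intros; ring, this]
    ring

/-- The factor s^(-2α) brings the growth s^(2m+1) back to s^(k-1), because 2m + 1 - 2α = k - 1. -/
theorem integrableOn_weighted {k : ℕ} (hk : 1 ≤ k) {m : ℕ} {α : ℝ}
    (hαk : α + (k : ℝ) / 2 = m + 1) (c : ℝ) {G : ℝ → 𝕜}
    (hG : ∀ a, 0 < a → IntegrableOn (fun s => s ^ (k - 1) • G s) (Set.Ioi a)) {a : ℝ} (ha : 0 < a) :
    IntegrableOn (fun s : ℝ => ((s ^ 2) ^ m * (2 * s)) • ((s ^ (-(2 * α)) * c) • G s))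
      (Set.Ioi a) := by
  refine IntegrableOn.congr_fun ((hG a ha).smul (2 * c)) (fun s hs => ?_) measurableSet_Ioi
  have hs0 : 0 < s := ha.trans hs
  simp only [Pi.smul_apply, smul_smul]
  congr 1
  have e : s ^ (k - 1) = s ^ (2 * m + 1) * s ^ (-(2 * α)) := by
    rw [← Real.rpow_natCast, ← Real.rpow_natCast, ← Real.rpow_add hs0]
    congr 1
    push_cast [Nat.cast_sub hk]
    linarith
  rw [e, ← pow_mul, pow_succ]
  ring

/-- The weighted kernel differs from the direct one by r^(-k) and u^(-2α). The first is cancelled by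
the factor t^k in front of ψ. The second becomes a continuous weight on G, and is removed at the end
by t^(2-k+2m) = t^(2α). -/
theorem weightedForm_eq {k : ℕ} (hk : 1 ≤ k) {G : ℝ → 𝕜}
    (hGm : AEStronglyMeasurable G (volume.restrict (Set.Ioi 0)))
    (hG : ∀ a, 0 < a → IntegrableOn (fun s => s ^ (k - 1) • G s) (Set.Ioi a))
    {F : ℝ → 𝕜} (hF : ∀ᵐ r ∂(volume.restrict (Set.Ioi (0 : ℝ))),
      F r = ∫ s in Set.Ioi r, meanKernel k r s • G s)
    {t : ℝ} (ht : 0 < t) (hLeb : IsLebesguePoint G t) :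
    WeightedFormExists k F t ∧ weightedForm k F t = Real.pi ^ ((k : ℝ) / 2) • G t := by
  set m := k / 2 with hm
  set α : ℝ := 1 - (k : ℝ) / 2 + m with hα
  have hα0 : 0 < α := half_order_pos k
  have hαk : α + (k : ℝ) / 2 = m + 1 := order_add k
  set c := Real.pi ^ ((k : ℝ) / 2) with hc
  have hi := fun a (ha : 0 < a) => integrableOn_weighted hk hαk c hG ha
  have hek : ∀ r, 0 < r → EkConverges α (fun s => (s ^ (2 * m + 2))⁻¹ • F s) r ∧
      weightedPsi k F r = iterPrim (fun s => s ^ 2) (fun s => 2 * s) m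
        (fun s => (s ^ (-(2 * α)) * c) • G s) r := by
    intro r hr
    have hint := isScale_sq.integrableOn_iterPrim hi le_rfl hr
    have h := ekInt_compose hk hα0 (w := fun s => (s ^ (2 * m + 2))⁻¹) (by fun_prop)
      (fun s hs => by positivity) hGm hF hr (ker := fun u => (r ^ k)⁻¹ *
        ((u ^ 2 - r ^ 2) ^ m / (m.factorial : ℝ) * (2 * u) * (u ^ (-(2 * α)) * c)))
      (fun u hu => ?_) (fun u hu => lintegral_weighted_meanKernel hk hα0 hαk hr hu) ?_
    · refine ⟨h.1, ?_⟩
      rw [weightedPsi]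
      change r ^ k • ekInt α (fun s => (s ^ (2 * m + 2))⁻¹ • F s) r = _
      rw [h.2, iterPrim, ← integral_smul (r ^ k)]
      refine integral_congr_ae (Eventually.of_forall fun u => ?_)
      simp only [smul_smul]
      congr 1
      field_simp
    · have h2 : 0 < u ^ 2 - r ^ 2 := by nlinarith
      have h3 : 0 < u := hr.trans hu
      positivity
    · have := hint.smul (r ^ k)⁻¹
      refine IntegrableOn.congr_fun this (fun u _ => ?_) measurableSet_Ioi
      simp only [Pi.smul_apply, smul_smul]
  have hw : ContinuousAt (fun s : ℝ => s ^ (-(2 * α)) * c) t :=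
    (Real.continuousAt_rpow_const t _ (Or.inl ht.ne')).mul continuousAt_const
  have h := isScale_sq.iterate_iterPrim hi ht (hLeb.smul hw)
    negD_eq (fun s hs => by field_simp) (F := weightedPsi k F) (fun r hr => (hek r hr).2)
  refine ⟨⟨fun s hs => (hek s hs).1, h.1⟩, ?_⟩
  rw [weightedForm]
  change t ^ (2 - (k : ℤ) + 2 * (m : ℕ)) • negD^[m + 1] (weightedPsi k F) t = _
  rw [h.2, smul_smul, ← mul_assoc, ← Real.rpow_intCast, ← Real.rpow_add ht]
  have e : ((2 - (k : ℤ) + 2 * (m : ℕ) : ℤ) : ℝ) + -(2 * α) = 0 := by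
    rw [hα]; push_cast; ring
  rw [e, Real.rpow_zero, one_mul]

/-- By `lintegral_kernel_ordinary` the composed kernel is a multiple of (u - r)^(k-1)/r. After
multiplication by r it is an iterated primitive with respect to s itself, undone by k ordinary
derivatives; the power 4^(k/2 - 1) accounts for 2^(-k). -/
theorem ordinaryForm_eq {k : ℕ} (hk : 1 ≤ k) {G : ℝ → 𝕜}
    (hGm : AEStronglyMeasurable G (volume.restrict (Set.Ioi 0)))
    (hG : ∀ a, 0 < a → IntegrableOn (fun s => s ^ (k - 1) • G s) (Set.Ioi a))
    {F : ℝ → 𝕜} (hF : ∀ᵐ r ∂(volume.restrict (Set.Ioi (0 : ℝ))),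
      F r = ∫ s in Set.Ioi r, meanKernel k r s • G s)
    {t : ℝ} (ht : 0 < t) (hLeb : IsLebesguePoint G t) :
    OrdinaryFormExists k F t ∧ ordinaryForm k F t = Real.pi ^ ((k : ℝ) / 2) • G t := by
  obtain ⟨N, hN⟩ : ∃ N, k = N + 1 := ⟨k - 1, by omega⟩
  have hβ : (0 : ℝ) < (k : ℝ) / 2 := by positivity
  set c := 2 ^ k * Real.pi ^ ((k : ℝ) / 2) with hc
  have hi : ∀ a, 0 < a →
      IntegrableOn (fun s : ℝ => (s ^ N * 1) • (c • G s)) (Set.Ioi a) := by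
    intro a ha
    refine IntegrableOn.congr_fun ((hG a ha).smul c) (fun s _ => ?_) measurableSet_Ioi
    simp only [Pi.smul_apply, smul_smul]
    congr 1
    rw [hN, Nat.add_sub_cancel]
    ring
  have hek : ∀ r, 0 < r → EkConverges ((k : ℝ) / 2) (fun s => (s ^ (k + 1))⁻¹ • F s) r ∧
      ordinaryInner k F r = iterPrim (fun s => s) (fun _ => 1) N (fun s => c • G s) r := by
    intro r hr
    have hint := isScale_id.integrableOn_iterPrim hi le_rfl hr
    have h := ekInt_compose hk hβ (w := fun s => (s ^ (k + 1))⁻¹) (by fun_prop)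
      (fun s hs => by positivity) hGm hF hr (ker := fun u => r⁻¹ *
        ((u - r) ^ N / (N.factorial : ℝ) * 1 * c))
      (fun u hu => ?_) (fun u hu => ?_) ?_
    · refine ⟨h.1, ?_⟩
      rw [ordinaryInner, h.2, iterPrim, ← integral_smul r]
      refine integral_congr_ae (Eventually.of_forall fun u => ?_)
      simp only [smul_smul]
      congr 1
      field_simp
    · have h2 : 0 < u - r := by linarith
      positivity
    · refine lintegral_meanKernel hk (hr.trans hu)
        (c := 4 ^ ((k : ℝ) / 2 - 1) * (u - r) ^ (2 * ((k : ℝ) / 2) - 1) / (r * u) *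
          ProbabilityTheory.beta ((k : ℝ) / 2) ((k : ℝ) / 2)) ?_ ?_
      · rw [← lintegral_kernel_ordinary hβ hr hu]
        refine setLIntegral_congr_fun measurableSet_Ioo fun s hs => ?_
        have hs0 := hr.trans hs.1
        have e : s ^ (-(2 * ((k : ℝ) / 2))) = s * (s ^ (k + 1))⁻¹ := by
          rw [show -(2 * ((k : ℝ) / 2)) = -(k : ℝ) by ring, Real.rpow_neg hs0.le,
            Real.rpow_natCast, pow_succ]
          field_simp
        rw [e]
        congr 1; ring
      · have hu0 : 0 < u := hr.trans hu
        have := Gamma_mul_beta_half hk (α := (k : ℝ) / 2) (m := N) (by rw [hN]; push_cast; ring)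
        have e : 2 * ((k : ℝ) / 2) - 1 = N := by rw [hN]; push_cast; ring
        have e4 : (4 : ℝ) ^ ((k : ℝ) / 2 - 1) = 2 ^ k / 4 := by
          rw [Real.rpow_sub_one (by norm_num), show (4 : ℝ) = 2 ^ (2 : ℝ) by norm_num,
            ← Real.rpow_mul (by norm_num), ← Real.rpow_natCast]
          congr 2; ring
        rw [e, e4, Real.rpow_natCast]
        rw [show ∀ a b c d e f : ℝ, a * b * (c / 4 * d / e * f) = a * f * (b * c * d / (4 * e)) by
          intros; ring, this]
        field_simp
        ring
    · have := hint.smul r⁻¹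
      refine IntegrableOn.congr_fun this (fun u _ => ?_) measurableSet_Ioi
      simp only [Pi.smul_apply, smul_smul]
  have h := isScale_id.iterate_iterPrim hi ht (hLeb.smul (w := fun _ => c) continuousAt_const)
    (L := negDeriv) (c := fun _ => 1) negDeriv_eq (fun s hs => one_mul 1)
    (F := ordinaryInner k F) (fun r hr => (hek r hr).2)
  rw [← hN] at h
  refine ⟨⟨fun s hs => (hek s hs).1, h.1⟩, ?_⟩
  rw [ordinaryForm, h.2, smul_smul, hc]
  congr 1
  field_simp

/-- The kernel integral of an integrable function converges almost everywhere. -/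
theorem ae_lintegral_kernel_lt_top {k : ℕ} (hk : 1 ≤ k) {g : ℝ → ℝ≥0∞}
    (hgm : AEMeasurable g (volume.restrict (Set.Ioi 0)))
    (hg : ∀ a, 0 < a → ∫⁻ s in Set.Ioi a, ENNReal.ofReal (s ^ (k - 1)) * g s < ∞) :
    ∀ᵐ r ∂(volume.restrict (Set.Ioi (0 : ℝ))),
      ∫⁻ s in Set.Ioi r, ENNReal.ofReal ((s ^ 2 - r ^ 2) ^ ((k : ℝ) / 2 - 1) * s) * g s < ∞ := by
  have hpos := sphereArea_pos hk
  set m := k / 2 with hm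
  set α : ℝ := 1 - (k : ℝ) / 2 + m with hα
  have hα0 : 0 < α := half_order_pos k
  have hαk : α + (k : ℝ) / 2 = m + 1 := order_add k
  have hΓ := Real.Gamma_pos_of_pos hα0
  have key : ∀ a : ℝ, 0 < a → ∀ᵐ r ∂(volume.restrict (Set.Ioi a)),
      ∫⁻ s in Set.Ioi r, ENNReal.ofReal ((s ^ 2 - r ^ 2) ^ ((k : ℝ) / 2 - 1) * s) * g s < ∞ := by
    intro a ha
    have hgm' := hgm.mono_measure (Measure.restrict_mono (Set.Ioi_subset_Ioi ha.le) le_rfl)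
    -- A positive weighted average over r > a of the integrals in question is finite, so almost all
    -- of them are. The weighted kernel is chosen since its composition needs only the growth
    -- s^(k-1).
    have h := lintegral_compose (A := fun s => s * (s ^ 2 - a ^ 2) ^ (α - 1) * (s ^ (2 * m + 2))⁻¹)
      (B := meanKernel k) (by fun_prop) (measurable_meanKernel k) (fun s hs => by
        have h2 : 0 < s ^ 2 - a ^ 2 := by nlinarith
        have h3 : 0 < s := ha.trans hs
        positivity)
      (fun u hu => lintegral_weighted_meanKernel hk hα0 hαk ha hu) hgm'
    have hfin : ∫⁻ s in Set.Ioi a, ENNReal.ofReal (s * (s ^ 2 - a ^ 2) ^ (α - 1) *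
        (s ^ (2 * m + 2))⁻¹) * ∫⁻ u in Set.Ioi s, ENNReal.ofReal (meanKernel k s u) * g u < ∞ := by
      rw [h]
      set C : ℝ := Real.Gamma α * (a ^ k)⁻¹ * Real.pi ^ ((k : ℝ) / 2) with hC
      refine lt_of_le_of_lt (setLIntegral_mono' measurableSet_Ioi
        (g := fun u => ENNReal.ofReal C * (ENNReal.ofReal (u ^ (k - 1)) * g u)) fun u hu => ?_) ?_
      · have hu0 : 0 < u := ha.trans hu
        have h2 : 0 < u ^ 2 - a ^ 2 := by
          have : a < u := hu
          nlinarith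
        rw [← mul_assoc (ENNReal.ofReal C), ← ENNReal.ofReal_mul (by positivity)]
        gcongr ENNReal.ofReal ?_ * _
        have e : u ^ (k - 1) = u ^ (2 * m + 1) * u ^ (-(2 * α)) := by
          rw [← Real.rpow_natCast, ← Real.rpow_natCast, ← Real.rpow_add hu0]
          congr 1
          push_cast [Nat.cast_sub hk]
          linarith
        have hf : (1 : ℝ) ≤ m.factorial := by
          exact_mod_cast Nat.one_le_iff_ne_zero.mpr m.factorial_ne_zero
        have h4 : (u ^ 2 - a ^ 2) ^ m / (m.factorial : ℝ) ≤ (u ^ 2) ^ m :=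
          (div_le_self (by positivity) hf).trans (pow_le_pow_left₀ h2.le (by nlinarith) _)
        calc _ = C * u * u ^ (-(2 * α)) * ((u ^ 2 - a ^ 2) ^ m / (m.factorial : ℝ)) := by
              rw [hC]; ring
          _ ≤ C * u * u ^ (-(2 * α)) * (u ^ 2) ^ m := by gcongr
          _ = _ := by rw [e, ← pow_mul, pow_succ]; ring
      · rw [lintegral_const_mul' _ _ ENNReal.ofReal_ne_top]
        exact ENNReal.mul_lt_top ENNReal.ofReal_lt_top (hg a ha)
    have hmeas : AEMeasurable (fun s => ENNReal.ofReal (s * (s ^ 2 - a ^ 2) ^ (α - 1) *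
        (s ^ (2 * m + 2))⁻¹) * ∫⁻ u in Set.Ioi s, ENNReal.ofReal (meanKernel k s u) * g u)
        (volume.restrict (Set.Ioi a)) := by
      refine AEMeasurable.mul (by fun_prop) ?_
      let T : Set (ℝ × ℝ) := {q | q.1 < q.2}
      have hT : MeasurableSet T := measurableSet_lt measurable_fst measurable_snd
      have hK : Measurable (T.indicator fun q : ℝ × ℝ => ENNReal.ofReal (meanKernel k q.1 q.2)) :=
        (measurable_meanKernel k).ennreal_ofReal.indicator hT
      have h1 : AEMeasurable (fun q : ℝ × ℝ =>
          T.indicator (fun q : ℝ × ℝ => ENNReal.ofReal (meanKernel k q.1 q.2)) q * g q.2)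
          ((volume.restrict (Set.Ioi a)).prod (volume.restrict (Set.Ioi a))) :=
        hK.aemeasurable.mul hgm'.comp_snd
      refine h1.lintegral_prod_right'.congr ?_
      filter_upwards [ae_restrict_mem measurableSet_Ioi] with s hs
      have hsub : Set.Ioi s = Set.Ioi s ∩ Set.Ioi a := by
        rw [Set.Ioi_inter_Ioi, sup_eq_left.mpr (le_of_lt hs)]
      rw [hsub, ← Measure.restrict_restrict measurableSet_Ioi,
        ← lintegral_indicator (measurableSet_Ioi (a := s))]
      refine lintegral_congr fun u => ?_
      by_cases hu : s < u <;> simp [T, Set.indicator, hu]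
    filter_upwards [ae_lt_top' hmeas hfin.ne, ae_restrict_mem measurableSet_Ioi] with r hr har
    have har' : a < r := har
    have h2 : 0 < r ^ 2 - a ^ 2 := by nlinarith
    have h3 : 0 < r := ha.trans har'
    have hA : ENNReal.ofReal (r * (r ^ 2 - a ^ 2) ^ (α - 1) * (r ^ (2 * m + 2))⁻¹) ≠ 0 := by
      simpa using (by positivity : 0 < r * (r ^ 2 - a ^ 2) ^ (α - 1) * (r ^ (2 * m + 2))⁻¹)
    have h4 : ∫⁻ u in Set.Ioi r, ENNReal.ofReal (meanKernel k r u) * g u < ∞ :=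
      ENNReal.lt_top_of_mul_ne_top_right hr.ne hA
    simp only [meanKernel, ENNReal.ofReal_mul hpos.le, mul_assoc] at h4
    rw [lintegral_const_mul' _ _ ENNReal.ofReal_ne_top] at h4
    exact ENNReal.lt_top_of_mul_ne_top_right h4.ne (by simpa using hpos)
  have hU : Set.Ioi (0 : ℝ) = ⋃ N : ℕ, Set.Ioi (1 / ((N : ℝ) + 1)) := by
    ext r
    simp only [Set.mem_Ioi, Set.mem_iUnion]
    exact ⟨fun hr => exists_nat_one_div_lt hr, fun ⟨N, hN⟩ => lt_trans (by positivity) hN⟩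
  rw [hU, ae_restrict_iUnion_iff]
  exact fun N => key _ (by positivity)


/-! ### Differentiation of integrals over thin shells -/

/-- Lebesgue differentiation along the lines of a product with `ℝ`. -/
theorem ae_tendsto_line_average {W : Type*} [MeasurableSpace W] {ν : Measure W} [SFinite ν]
    {F : W × ℝ → ℝ≥0∞} (hF : Measurable F) (hFi : ∫⁻ q, F q ∂(ν.prod volume) ≠ ∞) {C : ℝ}
    (hC : 0 < C) :
    ∀ᵐ q ∂(ν.prod volume), Tendsto (fun j : ℕ => ENNReal.ofReal (2 ^ j) *
      ∫⁻ v in Set.Icc (-(C / 2 ^ j)) (C / 2 ^ j), F (q.1, q.2 + v)) atTop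
      (𝓝 (ENNReal.ofReal (2 * C) * F q)) := by
  have hm : ∀ j : ℕ, Measurable fun q : W × ℝ => ENNReal.ofReal (2 ^ j) *
      ∫⁻ v in Set.Icc (-(C / 2 ^ j)) (C / 2 ^ j), F (q.1, q.2 + v) := by
    intro j
    refine Measurable.const_mul ?_ _
    exact Measurable.lintegral_prod_right' (f := fun z : (W × ℝ) × ℝ => F (z.1.1, z.1.2 + z.2))
      (hF.comp (by fun_prop))
  -- Measurability of the set of convergence allows it to be tested on slices. Almost every slice is
  -- integrable on the line, where Lebesgue differentiation applies.
  have hset := measurableSet_tendsto_fun (l := atTop) hm (hF.const_mul (ENNReal.ofReal (2 * C)))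
  rw [Filter.Eventually, mem_ae_iff, Measure.measure_prod_null hset.compl]
  rw [lintegral_prod _ hF.aemeasurable] at hFi
  filter_upwards [ae_lt_top hF.lintegral_prod_right' hFi] with w hw
  have hd := (Besicovitch.vitaliFamily (volume : Measure ℝ)).ae_tendsto_lintegral_div'
    (hF.comp (measurable_prodMk_left (x := w))) hw.ne
  change ∀ᵐ u, _
  filter_upwards [hd] with u hu
  have hr : Tendsto (fun j : ℕ => C / 2 ^ j) atTop (𝓝[>] 0) := by
    refine tendsto_nhdsWithin_iff.mpr ⟨?_, Eventually.of_forall fun j => ?_⟩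
    · have := (tendsto_pow_atTop_nhds_zero_of_lt_one (r := (1 / 2 : ℝ)) (by norm_num)
        (by norm_num)).const_mul C
      simpa [div_eq_mul_inv] using this
    · exact Set.mem_Ioi.mpr (by positivity)
  have h1 := hu.comp ((Besicovitch.tendsto_filterAt (volume : Measure ℝ) u).comp hr)
  have h2 := ENNReal.Tendsto.const_mul h1 (Or.inr (ENNReal.ofReal_ne_top (r := 2 * C)))
  refine h2.congr fun j => ?_
  have hj : (0 : ℝ) < C / 2 ^ j := by positivity
  simp only [Function.comp_apply]
  rw [Real.volume_closedBall, Real.closedBall_eq_Icc]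
  have h3 : ∫⁻ y in Set.Icc (u - C / 2 ^ j) (u + C / 2 ^ j), F (w, y) =
      ∫⁻ v in Set.Icc (-(C / 2 ^ j)) (C / 2 ^ j), F (w, u + v) := by
    have h4 : Set.Icc (-(C / 2 ^ j)) (C / 2 ^ j) =
        (fun v => u + v) ⁻¹' Set.Icc (u - C / 2 ^ j) (u + C / 2 ^ j) := by
      ext v; simp only [Set.mem_Icc, Set.mem_preimage]
      constructor <;> rintro ⟨h5, h6⟩ <;> constructor <;> linarith
    rw [h4]
    exact ((measurePreserving_add_left volume u).setLIntegral_comp_preimage_emb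
      (measurableEmbedding_addLeft u) (fun y => F (w, y)) _).symm
  rw [h3, ENNReal.div_eq_inv_mul, ← mul_assoc]
  congr 1
  rw [← ENNReal.ofReal_inv_of_pos (by positivity), ← ENNReal.ofReal_mul (by positivity)]
  congr 1
  field_simp

/-! ### Covering a thin shell by neighbourhoods of graphs -/

/-- The point of `ℝ^(m+1)` whose `i`-th coordinate is given separately. -/
def axisEquiv {m : ℕ} (i : Fin (m + 1)) : (Fin m → ℝ) × ℝ ≃ᵐ E (m + 1) :=
  MeasurableEquiv.prodComm.trans ((MeasurableEquiv.piFinSuccAbove (fun _ => ℝ) i).symm.trans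
    (MeasurableEquiv.toLp 2 (Fin (m + 1) → ℝ)))

theorem axisEquiv_apply {m : ℕ} (i : Fin (m + 1)) (q : (Fin m → ℝ) × ℝ) :
    axisEquiv i q = WithLp.toLp 2 (i.insertNth (α := fun _ => ℝ) q.2 q.1) := rfl

theorem measurePreserving_axisEquiv {m : ℕ} (i : Fin (m + 1)) :
    MeasurePreserving (axisEquiv i) (volume.prod volume) volume :=
  Measure.measurePreserving_swap.trans
    (((volume_preserving_piFinSuccAbove (fun _ => ℝ) i).symm).trans
      (PiLp.volume_preserving_toLp (Fin (m + 1))))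

theorem axisEquiv_add {m : ℕ} (i : Fin (m + 1)) (q q' : (Fin m → ℝ) × ℝ) :
    axisEquiv i (q + q') = axisEquiv i q + axisEquiv i q' := by
  simp only [axisEquiv_apply, Prod.snd_add, Prod.fst_add]
  rw [← WithLp.toLp_add, ← Fin.insertNth_add]

theorem norm_axisEquiv_sq {m : ℕ} (i : Fin (m + 1)) (w : Fin m → ℝ) (u : ℝ) :
    ‖axisEquiv i (w, u)‖ ^ 2 = u ^ 2 + ∑ j, w j ^ 2 := by
  rw [EuclideanSpace.real_norm_sq_eq, Fin.sum_univ_succAbove _ i]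
  simp [axisEquiv_apply]

theorem axisEquiv_apply_self {m : ℕ} (i : Fin (m + 1)) (w : Fin m → ℝ) (u : ℝ) :
    axisEquiv i (w, u) i = u := by
  simp [axisEquiv_apply]

/-- A cap of the sphere of radius `t` is a graph over this set of `w`. -/
def capSet (m : ℕ) (t : ℝ) : Set (Fin m → ℝ) :=
  {w | ∑ j, w j ^ 2 ≤ t ^ 2 * (1 - 1 / (2 * (m + 1)))}

theorem measurableSet_capSet (m : ℕ) (t : ℝ) : MeasurableSet (capSet m t) :=
  measurableSet_le (by fun_prop) measurable_const

theorem volume_capSet_lt_top (m : ℕ) {t : ℝ} (ht : 0 < t) : volume (capSet m t) < ∞ := by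
  refine lt_of_le_of_lt (measure_mono (t := Metric.closedBall 0 t) fun w hw => ?_)
    measure_closedBall_lt_top
  rw [mem_closedBall_zero_iff, pi_norm_le_iff_of_nonneg ht.le]
  intro j
  have h1 : w j ^ 2 ≤ ∑ j, w j ^ 2 :=
    Finset.single_le_sum (f := fun j => w j ^ 2) (fun j _ => sq_nonneg _) (Finset.mem_univ j)
  have h2 : ∑ j, w j ^ 2 ≤ t ^ 2 * (1 - 1 / (2 * (m + 1))) := hw
  have h3 : t ^ 2 * (1 - 1 / (2 * (m + 1))) ≤ t ^ 2 := by
    have : (0 : ℝ) < 1 / (2 * (m + 1)) := by positivity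
    nlinarith [sq_pos_of_pos ht]
  exact abs_le_of_sq_le_sq (by linarith) ht.le

/-- The height of the sphere of radius `t` over `w`. -/
def capHeight {m : ℕ} (t : ℝ) (w : Fin m → ℝ) : ℝ := √(t ^ 2 - ∑ j, w j ^ 2)

theorem measurable_capHeight {m : ℕ} (t : ℝ) : Measurable (capHeight (m := m) t) := by
  unfold capHeight; fun_prop

/-- The sign that belongs to a Boolean. -/
def boolSign (σ : Bool) : ℝ := if σ then 1 else -1

/-- The points near the graph of a spherical cap in direction `±eᵢ`. -/
def capPiece {m : ℕ} (t δ : ℝ) (i : Fin (m + 1)) (σ : Bool) : Set (E (m + 1)) :=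
  axisEquiv i '' {q | q.1 ∈ capSet m t ∧ |q.2 - boolSign σ * capHeight t q.1| ≤ δ}

/-- A thin shell is covered by neighbourhoods of graphs. -/
theorem exists_mem_capPiece {m : ℕ} {t h : ℝ} (ht : 0 < t) (h0 : 0 ≤ h)
    (hh : h ≤ t / (8 * (m + 1))) (y : E (m + 1)) (hy : |‖y‖ - t| ≤ h) :
    ∃ i σ, y ∈ capPiece t (3 * √(2 * (m + 1)) * h) i σ := by
  -- The squares of the coordinates have mean ‖y‖²/(m + 1), so one of them is at least that large.
  -- Its axis and its sign select the chart.
  obtain ⟨i, -, hi⟩ : ∃ i ∈ (Finset.univ : Finset (Fin (m + 1))),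
      ‖y‖ ^ 2 / (m + 1) ≤ y i ^ 2 := by
    refine Finset.exists_le_of_sum_le Finset.univ_nonempty ?_
    rw [← EuclideanSpace.real_norm_sq_eq, Finset.sum_const, Finset.card_univ, Fintype.card_fin,
      nsmul_eq_mul]
    apply le_of_eq
    push_cast
    field_simp
  obtain ⟨σ, hσ⟩ : ∃ σ, 0 ≤ boolSign σ * y i := by
    rcases le_total 0 (y i) with h | h
    · exact ⟨true, by simpa [boolSign] using h⟩
    · exact ⟨false, by simpa [boolSign] using h⟩
  have hσ2 : boolSign σ * boolSign σ = 1 := by cases σ <;> simp [boolSign]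
  refine ⟨i, σ, (axisEquiv i).symm y, ?_, (axisEquiv i).apply_symm_apply y⟩
  rcases hq : (axisEquiv i).symm y with ⟨w, u⟩
  obtain rfl : axisEquiv i (w, u) = y := by rw [← hq, (axisEquiv i).apply_symm_apply]
  rw [axisEquiv_apply_self] at hi hσ
  have hn := norm_axisEquiv_sq i w u
  set r := ‖axisEquiv i (w, u)‖ with hr
  set d : ℝ := m + 1 with hd
  have hd1 : 1 ≤ d := by rw [hd]; linarith [(Nat.cast_nonneg m : (0 : ℝ) ≤ m)]
  set Sw := ∑ j, w j ^ 2 with hS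
  obtain ⟨hy1, hy2⟩ := abs_le.mp hy
  have hr0 : 0 ≤ r := norm_nonneg _
  have hSle : Sw ≤ r ^ 2 * (1 - 1 / d) := by
    have : r ^ 2 * (1 - 1 / d) = r ^ 2 - r ^ 2 / d := by ring
    linarith
  have hd' : 0 ≤ 1 - 1 / d := by
    rw [sub_nonneg, div_le_one (by linarith)]; exact hd1
  have hhd : h * (8 * d) ≤ t := (le_div_iff₀ (by positivity)).mp hh
  have hht : h ≤ t := by nlinarith
  -- The factor 1 - 1/d at radius r is relaxed to 1 - 1/(2d) at radius t. The bound t/(8d) on h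
  -- leaves enough room for this.
  have hcap : Sw ≤ t ^ 2 * (1 - 1 / (2 * d)) := by
    have h1 : r ^ 2 ≤ t ^ 2 * (1 + 3 / (8 * d)) := by
      have h2 : r ^ 2 ≤ (t + h) ^ 2 := by nlinarith
      have h3 : t ^ 2 * (1 + 3 / (8 * d)) = t ^ 2 + 3 * t * (t / (8 * d)) := by ring
      rw [h3]
      nlinarith
    have h4 : (1 + 3 / (8 * d)) * (1 - 1 / d) ≤ 1 - 1 / (2 * d) := by
      have : (1 - 1 / (2 * d)) - (1 + 3 / (8 * d)) * (1 - 1 / d) =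
          1 / (8 * d) + 3 / (8 * d ^ 2) := by field_simp; ring
      have : 0 < 1 / (8 * d) + 3 / (8 * d ^ 2) := by positivity
      linarith
    calc Sw ≤ r ^ 2 * (1 - 1 / d) := hSle
      _ ≤ t ^ 2 * (1 + 3 / (8 * d)) * (1 - 1 / d) := by gcongr
      _ = t ^ 2 * ((1 + 3 / (8 * d)) * (1 - 1 / d)) := by ring
      _ ≤ _ := by gcongr
  refine ⟨hcap, ?_⟩
  simp only
  set φ := capHeight t w with hφ
  have hφ2 : φ ^ 2 = t ^ 2 - Sw := by
    rw [hφ, capHeight, Real.sq_sqrt]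
    have : t ^ 2 * (1 - 1 / (2 * d)) ≤ t ^ 2 := by
      have : 0 < 1 / (2 * d) := by positivity
      nlinarith [sq_pos_of_pos ht]
    linarith
  have hφ0 : 0 ≤ φ := Real.sqrt_nonneg _
  -- Over the cap the height is bounded below: the graph stays away from the equator.
  have hφlow : t ≤ √(2 * d) * φ := by
    refine (sq_le_sq₀ ht.le (by positivity)).mp ?_
    rw [mul_pow, Real.sq_sqrt (by positivity), hφ2]
    have : t ^ 2 * (1 - 1 / (2 * d)) = t ^ 2 - t ^ 2 / (2 * d) := by ring
    have h5 : t ^ 2 / (2 * d) ≤ t ^ 2 - Sw := by linarith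
    rw [div_le_iff₀ (by positivity)] at h5
    linarith
  have habs : |u - boolSign σ * φ| = |boolSign σ * u - φ| := by
    cases σ
    · simp only [boolSign]
      rw [← abs_neg]
      congr 1
      simp only [Bool.false_eq_true, if_false]
      ring
    · simp [boolSign]
  rw [habs]
  set a := boolSign σ * u with ha
  have ha2 : a ^ 2 = u ^ 2 := by
    rw [ha, mul_pow, sq (boolSign σ), hσ2, one_mul]
  -- Both a² - φ² and r² - t² equal u² + Sw - t². Since a ≥ 0, r ≤ 2t and φ ≥ t/√(2d), dividing by a
  -- + φ gives the distance 3√(2d) h to the graph.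
  have hprod : |a - φ| * (a + φ) = |r - t| * (r + t) := by
    rw [← abs_of_nonneg (by linarith : 0 ≤ a + φ), ← abs_mul,
      ← abs_of_nonneg (by linarith : 0 ≤ r + t), ← abs_mul]
    congr 1
    nlinarith
  have hs : 0 < √(2 * d) := Real.sqrt_pos.mpr (by positivity)
  have h6 : |a - φ| * φ ≤ h * (3 * t) := by
    calc |a - φ| * φ ≤ |a - φ| * (a + φ) := by gcongr; linarith
      _ = |r - t| * (r + t) := hprod
      _ ≤ h * (3 * t) := by gcongr; linarith
  have h7 : |a - φ| * t ≤ (3 * √(2 * d) * h) * t := by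
    calc |a - φ| * t ≤ |a - φ| * (√(2 * d) * φ) := by gcongr
      _ = √(2 * d) * (|a - φ| * φ) := by ring
      _ ≤ √(2 * d) * (h * (3 * t)) := by gcongr
      _ = _ := by ring
  exact le_of_mul_le_mul_right h7 ht

/-- The integral of `b` over a translate of a spherical cap, in graph coordinates. -/
def capIntegral {m : ℕ} (t : ℝ) (b : E (m + 1) → ℝ≥0∞) (i : Fin (m + 1)) (σ : Bool)
    (x : E (m + 1)) : ℝ≥0∞ :=
  ∫⁻ w in capSet m t, b (x + axisEquiv i (w, boolSign σ * capHeight t w))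

theorem measurable_capIntegral {m : ℕ} (t : ℝ) {b : E (m + 1) → ℝ≥0∞} (hb : Measurable b)
    (i : Fin (m + 1)) (σ : Bool) : Measurable (capIntegral t b i σ) := by
  have hφ := measurable_capHeight (m := m) t
  refine Measurable.lintegral_prod_right'
    (f := fun z : E (m + 1) × (Fin m → ℝ) =>
      b (z.1 + axisEquiv i (z.2, boolSign σ * capHeight t z.2))) (hb.comp ?_)
  exact measurable_fst.add ((axisEquiv i).measurable.comp (by fun_prop))

theorem lintegral_capIntegral {m : ℕ} (t : ℝ) {b : E (m + 1) → ℝ≥0∞} (hb : Measurable b)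
    (i : Fin (m + 1)) (σ : Bool) :
    ∫⁻ x, capIntegral t b i σ x = volume (capSet m t) * ∫⁻ x, b x := by
  have hφ := measurable_capHeight (m := m) t
  simp only [capIntegral]
  rw [lintegral_lintegral_swap
    (f := fun x w => b (x + axisEquiv i (w, boolSign σ * capHeight t w)))]
  · have : ∀ w : Fin m → ℝ, ∫⁻ x, b (x + axisEquiv i (w, boolSign σ * capHeight t w)) =
        ∫⁻ x, b x := fun w => lintegral_add_right_eq_self b _
    simp [this, mul_comm]
  · refine (hb.comp ?_).aemeasurable
    exact measurable_fst.add ((axisEquiv i).measurable.comp (by fun_prop))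

/-- The piece is the stack of the translates of the cap by v eᵢ with |v| ≤ δ, and translating the
cap is the same as translating the centre x. -/
theorem lintegral_capPiece {m : ℕ} (t δ : ℝ) {b : E (m + 1) → ℝ≥0∞} (hb : Measurable b)
    (i : Fin (m + 1)) (σ : Bool) (x : E (m + 1)) :
    MeasurableSet (capPiece t δ i σ) ∧ ∫⁻ y in capPiece t δ i σ, b (x + y) =
      ∫⁻ v in Set.Icc (-δ) δ, capIntegral t b i σ (x + axisEquiv i (0, v)) := by
  have hφ := measurable_capHeight (m := m) t
  set Q : Set ((Fin m → ℝ) × ℝ) :=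
    {q | q.1 ∈ capSet m t ∧ |q.2 - boolSign σ * capHeight t q.1| ≤ δ} with hQdef
  have hQ : MeasurableSet Q :=
    (measurable_fst (measurableSet_capSet m t)).inter (measurableSet_le
      (f := fun q : (Fin m → ℝ) × ℝ => |q.2 - boolSign σ * capHeight t q.1|)
      (g := fun _ => δ) (by fun_prop) measurable_const)
  have hP : capPiece t δ i σ = (axisEquiv i).symm ⁻¹' Q := by
    rw [capPiece]; exact (axisEquiv i).toEquiv.image_eq_preimage_symm Q
  have hPm : MeasurableSet (capPiece t δ i σ) := by
    rw [hP]; exact (axisEquiv i).symm.measurable hQ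
  refine ⟨hPm, ?_⟩
  have hpre : axisEquiv i ⁻¹' capPiece t δ i σ = Q := by
    rw [hP, ← Set.preimage_comp]; simp
  have hbm : Measurable fun q : (Fin m → ℝ) × ℝ => b (x + axisEquiv i q) :=
    hb.comp ((axisEquiv i).measurable.const_add x)
  rw [← (measurePreserving_axisEquiv i).setLIntegral_comp_preimage_emb
    (axisEquiv i).measurableEmbedding (fun y => b (x + y)), hpre,
    ← lintegral_indicator hQ, lintegral_prod _ (hbm.indicator hQ).aemeasurable]
  have h1 : ∀ w, ∫⁻ u, Q.indicator (fun q => b (x + axisEquiv i q)) (w, u) =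
      (capSet m t).indicator (fun w => ∫⁻ v in Set.Icc (-δ) δ,
        b (x + axisEquiv i (0, v) + axisEquiv i (w, boolSign σ * capHeight t w))) w := by
    intro w
    by_cases hw : w ∈ capSet m t
    · rw [Set.indicator_of_mem hw, ← lintegral_indicator measurableSet_Icc,
        ← lintegral_add_right_eq_self _ (boolSign σ * capHeight t w)]
      refine lintegral_congr fun v => ?_
      have hiff : (w, v + boolSign σ * capHeight t w) ∈ Q ↔ v ∈ Set.Icc (-δ) δ := by
        simp only [hQdef, Set.mem_ofPred_eq, hw, true_and, add_sub_cancel_right, abs_le,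
          Set.mem_Icc]
      have hsum : axisEquiv i (w, v + boolSign σ * capHeight t w) =
          axisEquiv i (0, v) + axisEquiv i (w, boolSign σ * capHeight t w) := by
        rw [← axisEquiv_add]; simp
      by_cases hv : v ∈ Set.Icc (-δ) δ
      · rw [Set.indicator_of_mem hv, Set.indicator_of_mem (hiff.mpr hv), hsum, add_assoc]
      · rw [Set.indicator_of_notMem hv, Set.indicator_of_notMem (fun h => hv (hiff.mp h))]
    · rw [Set.indicator_of_notMem hw]
      have : ∀ u, Q.indicator (fun q => b (x + axisEquiv i q)) (w, u) = 0 := fun u =>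
        Set.indicator_of_notMem (fun h => hw h.1) _
      simp [this]
  simp_rw [h1]
  rw [lintegral_indicator (measurableSet_capSet m t)]
  simp only [capIntegral]
  refine lintegral_lintegral_swap (f := fun (w : Fin m → ℝ) (v : ℝ) =>
    b (x + axisEquiv i (0, v) + axisEquiv i (w, boolSign σ * capHeight t w))) ?_
  refine (hb.comp ?_).aemeasurable
  exact (((axisEquiv i).measurable.comp (by fun_prop)).const_add x).add
    ((axisEquiv i).measurable.comp (by fun_prop))

/-- As a function of the centre the cap integral is integrable on the whole space, so it can be
differentiated along almost every line parallel to the i-th axis. -/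
theorem ae_tendsto_capIntegral {m : ℕ} {t : ℝ} (ht : 0 < t) {b : E (m + 1) → ℝ≥0∞}
    (hb : Measurable b) (hbi : ∫⁻ x, b x ≠ ∞) (i : Fin (m + 1)) (σ : Bool) {C : ℝ} (hC : 0 < C) :
    ∀ᵐ x, Tendsto (fun j : ℕ => ENNReal.ofReal (2 ^ j) *
      ∫⁻ v in Set.Icc (-(C / 2 ^ j)) (C / 2 ^ j), capIntegral t b i σ (x + axisEquiv i (0, v))) atTop
      (𝓝 (ENNReal.ofReal (2 * C) * capIntegral t b i σ x)) := by
  have hmp := measurePreserving_axisEquiv i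
  have hm := measurable_capIntegral t hb i σ
  have h := ae_tendsto_line_average (ν := (volume : Measure (Fin m → ℝ)))
    (F := fun q => capIntegral t b i σ (axisEquiv i q)) (hm.comp (axisEquiv i).measurable) (by
      rw [hmp.lintegral_comp hm, lintegral_capIntegral t hb]
      exact ENNReal.mul_ne_top (volume_capSet_lt_top m ht).ne hbi) hC
  have h2 := hmp.symm.quasiMeasurePreserving.ae h
  filter_upwards [h2] with x hx
  rw [(axisEquiv i).apply_symm_apply] at hx
  refine hx.congr fun j => ?_
  congr 1
  refine lintegral_congr fun v => ?_
  congr 1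
  have : (((axisEquiv i).symm x).1, ((axisEquiv i).symm x).2 + v) = (axisEquiv i).symm x + (0, v) := by
    ext <;> simp
  rw [this, axisEquiv_add, (axisEquiv i).apply_symm_apply]

/-- The integral of `b` over a thin shell is controlled, after division by the thickness, by
integrals over caps of the sphere. -/
theorem ae_eventually_shell_le {m : ℕ} {t : ℝ} (ht : 0 < t) :
    ∃ C : ℝ, 0 < C ∧ ∀ b : E (m + 1) → ℝ≥0∞, Measurable b → ∫⁻ x, b x ≠ ∞ →
      ∀ᵐ x, ∀ c, ENNReal.ofReal C * ∑ z : Fin (m + 1) × Bool, capIntegral t b z.1 z.2 x < c →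
        ∀ᶠ j : ℕ in atTop, ENNReal.ofReal (2 ^ j) *
          ∫⁻ y in {y : E (m + 1) | |‖y‖ - t| ≤ 1 / 2 ^ j}, b (x + y) < c := by
  set D : ℝ := 3 * √(2 * (m + 1)) with hD
  have hD0 : 0 < D := by positivity
  refine ⟨2 * D, by positivity, fun b hb hbi => ?_⟩
  have hall : ∀ᵐ x, ∀ z : Fin (m + 1) × Bool, Tendsto (fun j : ℕ => ENNReal.ofReal (2 ^ j) *
      ∫⁻ v in Set.Icc (-(D / 2 ^ j)) (D / 2 ^ j),
        capIntegral t b z.1 z.2 (x + axisEquiv z.1 (0, v))) atTop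
      (𝓝 (ENNReal.ofReal (2 * D) * capIntegral t b z.1 z.2 x)) :=
    ae_all_iff.mpr fun z => ae_tendsto_capIntegral ht hb hbi z.1 z.2 hD0
  filter_upwards [hall] with x hx c hc
  have hsum := tendsto_finsetSum (Finset.univ : Finset (Fin (m + 1) × Bool)) fun z _ => hx z
  rw [← Finset.mul_sum] at hsum
  have hlt := hsum.eventually (gt_mem_nhds hc)
  have hsmall : ∀ᶠ j : ℕ in atTop, (1 : ℝ) / 2 ^ j ≤ t / (8 * (m + 1)) := by
    have h1 : Tendsto (fun j : ℕ => (1 : ℝ) / 2 ^ j) atTop (𝓝 0) := by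
      have := tendsto_pow_atTop_nhds_zero_of_lt_one (r := (1 / 2 : ℝ)) (by norm_num) (by norm_num)
      simpa using this
    exact (h1.eventually (gt_mem_nhds (by positivity : 0 < t / (8 * ((m : ℝ) + 1))))).mono
      fun j hj => hj.le
  filter_upwards [hlt, hsmall] with j hj hjs
  refine lt_of_le_of_lt ?_ hj
  rw [← Finset.mul_sum]
  gcongr
  have hcov : {y : E (m + 1) | |‖y‖ - t| ≤ 1 / 2 ^ j} ⊆
      ⋃ z : Fin (m + 1) × Bool, capPiece t (D / 2 ^ j) z.1 z.2 := by
    intro y hy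
    obtain ⟨i, σ, h⟩ := exists_mem_capPiece ht (by positivity) hjs y hy
    refine Set.mem_iUnion.mpr ⟨(i, σ), ?_⟩
    rwa [← hD, mul_one_div] at h
  calc ∫⁻ y in {y : E (m + 1) | |‖y‖ - t| ≤ 1 / 2 ^ j}, b (x + y)
      ≤ ∫⁻ y in ⋃ z : Fin (m + 1) × Bool, capPiece t (D / 2 ^ j) z.1 z.2, b (x + y) :=
        lintegral_mono_set hcov
    _ ≤ ∑' z : Fin (m + 1) × Bool, ∫⁻ y in capPiece t (D / 2 ^ j) z.1 z.2, b (x + y) :=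
        lintegral_iUnion_le _ _
    _ = _ := by
        rw [tsum_fintype]
        exact Finset.sum_congr rfl fun z _ => (lintegral_capPiece t _ hb z.1 z.2 x).2


/-! ### Lebesgue points of spherical means -/

theorem measurable_sphMeanE {n k : ℕ} (h : k < n) {g : E n → ℝ≥0∞} (hg : Measurable g) (s : ℝ) :
    Measurable fun x => sphMeanE h g x s := by
  refine Measurable.lintegral_prod_right'
    (f := fun z : E n × SO n => g (z.1 + spherePt h (s, z.2))) (hg.comp ?_)
  exact measurable_fst.add ((continuous_spherePt h).measurable.comp (by fun_prop))

theorem lintegral_sphMeanE {n k : ℕ} (h : k < n) {g : E n → ℝ≥0∞} (hg : Measurable g) (s : ℝ) :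
    ∫⁻ x, sphMeanE h g x s = ∫⁻ x, g x := by
  simp only [sphMeanE]
  rw [lintegral_lintegral_swap (f := fun x γ => g (x + spherePt h (s, γ)))]
  · have : ∀ γ : SO n, ∫⁻ x, g (x + spherePt h (s, γ)) = ∫⁻ x, g x :=
      fun γ => lintegral_add_right_eq_self g _
    simp [this]
  · refine (hg.comp ?_).aemeasurable
    exact measurable_fst.add ((continuous_spherePt h).measurable.comp (by fun_prop))

/-- At almost every center, an almost everywhere valid property holds at almost every point of the
sphere of radius `s`. -/
theorem ae_ae_sphere {n k : ℕ} (h : k < n) {P : E n → Prop} (hP : ∀ᵐ y, P y) (s : ℝ) :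
    ∀ᵐ x, ∀ᵐ γ ∂(haarSO n), P (x + spherePt h (s, γ)) := by
  set N := toMeasurable volume {y | ¬P y} with hN
  have hNm : MeasurableSet N := measurableSet_toMeasurable _ _
  have hN0 : volume N = 0 := by rw [hN, measure_toMeasurable]; exact hP
  have h1 := lintegral_sphMeanE h (measurable_one.indicator hNm) s
  rw [lintegral_indicator_one hNm, hN0,
    lintegral_eq_zero_iff (measurable_sphMeanE h (measurable_one.indicator hNm) s)] at h1
  filter_upwards [h1] with x hx
  have hm : Measurable fun γ : SO n => x + spherePt h (s, γ) :=
    ((continuous_spherePt h).measurable.comp measurable_prodMk_left).const_add x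
  have hx' : ∫⁻ γ, N.indicator (1 : E n → ℝ≥0∞) (x + spherePt h (s, γ)) ∂(haarSO n) = 0 := hx
  rw [lintegral_eq_zero_iff (f := fun γ : SO n => N.indicator (1 : E n → ℝ≥0∞)
    (x + spherePt h (s, γ))) ((measurable_one.indicator hNm).comp hm)] at hx'
  filter_upwards [hx'] with γ hγ
  by_contra hc
  have : x + spherePt h (s, γ) ∈ N := subset_toMeasurable _ _ hc
  simp [Set.indicator_of_mem this] at hγ

/-- For every center, an almost everywhere valid property holds at almost every point of almost
every sphere. -/
theorem ae_radius_ae_sphere {n k : ℕ} (hk : 1 ≤ k) (h : k < n) {P : E n → Prop} (hP : ∀ᵐ y, P y)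
    (x : E n) : ∀ᵐ s ∂(volume.restrict (Set.Ioi (0 : ℝ))), ∀ᵐ γ ∂(haarSO n),
      P (x + spherePt h (s, γ)) := by
  have h1 : ∀ᵐ y, P (x + y) := (measurePreserving_add_left volume x).quasiMeasurePreserving.ae hP
  exact Measure.ae_ae_of_ae_prod ((quasiMeasurePreserving_spherePt hk h).ae h1)

theorem sphMean_congr {n k : ℕ} {h : k < n} {f f' : E n → 𝕜} {x : E n} {s : ℝ}
    (hs : ∀ᵐ γ ∂(haarSO n), f (x + spherePt h (s, γ)) = f' (x + spherePt h (s, γ))) :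
    sphMean h f x s = sphMean h f' x s := integral_congr_ae hs

/-- Equality at t has to be assumed separately, because the value there is part of the notion. -/
theorem IsLebesguePoint.congr_ae {G G' : ℝ → 𝕜} {t : ℝ} (hG : IsLebesguePoint G t) {S : Set ℝ}
    (hS : S ∈ 𝓝 t) (hGG' : ∀ᵐ s ∂(volume.restrict S), G s = G' s)
    (ht : G t = G' t) :
    IsLebesguePoint G' t := by
  intro ε hε
  obtain ⟨δ, hδ, hd⟩ := hG ε hε
  obtain ⟨δ', hδ', hS'⟩ := Metric.mem_nhds_iff.mp hS
  refine ⟨min δ δ', lt_min hδ hδ', fun h h0 hh => ?_⟩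
  refine le_trans (le_of_eq ?_) (hd h h0 (hh.trans_le (min_le_left _ _)))
  have hsub : Set.Icc (t - h) (t + h) ⊆ S := by
    intro s hs
    refine hS' ?_
    rw [Metric.mem_ball, Real.dist_eq, abs_lt]
    have := hh.trans_le (min_le_right δ δ')
    constructor <;> linarith [hs.1, hs.2]
  refine lintegral_congr_ae ?_
  filter_upwards [ae_restrict_of_ae_restrict_of_subset hsub hGG'] with s hs
  rw [hs, ht]

theorem continuous_sphMean {n k : ℕ} (h : k < n) {g : E n → 𝕜} (hg : Continuous g)
    (hc : HasCompactSupport g) (x : E n) : Continuous (sphMean h g x) := by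
  obtain ⟨C, hC⟩ := hg.bounded_above_of_compact_support hc
  refine continuous_of_dominated (bound := fun _ => C) (fun s => ?_)
    (fun s => Eventually.of_forall fun γ => hC _) (integrable_const _) (Eventually.of_forall fun γ => ?_)
  · exact (hg.comp (continuous_const.add ((continuous_spherePt h).comp
      (by fun_prop)))).aestronglyMeasurable
  · exact hg.comp (continuous_const.add ((continuous_spherePt h).comp (by fun_prop)))

/-- No integrability of f on the sphere is assumed: either the right side is infinite, or f is
integrable there because f - g and g are. -/
theorem enorm_sphMean_sub_le {n k : ℕ} (h : k < n) {f g : E n → 𝕜} (hf : StronglyMeasurable f)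
    (hg : Continuous g) (hc : HasCompactSupport g) (x : E n) (s : ℝ) :
    ‖sphMean h f x s - sphMean h g x s‖ₑ ≤ sphMeanE h (fun y => ‖f y - g y‖ₑ) x s := by
  have hm : Measurable fun γ : SO n => x + spherePt h (s, γ) :=
    ((continuous_spherePt h).measurable.comp measurable_prodMk_left).const_add x
  have hgi : Integrable (fun γ => g (x + spherePt h (s, γ))) (haarSO n) := by
    obtain ⟨C, hC⟩ := hg.bounded_above_of_compact_support hc
    exact Integrable.of_bound (hg.measurable.comp hm).aestronglyMeasurable C
      (Eventually.of_forall fun γ => hC _)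
  rcases eq_or_ne (sphMeanE h (fun y => ‖f y - g y‖ₑ) x s) ∞ with htop | hfin
  · rw [htop]; exact le_top
  have hd : Integrable (fun γ => f (x + spherePt h (s, γ)) - g (x + spherePt h (s, γ)))
      (haarSO n) := by
    refine ⟨((hf.measurable.comp hm).sub (hg.measurable.comp hm)).aestronglyMeasurable, ?_⟩
    rw [hasFiniteIntegral_iff_enorm]
    exact lt_top_iff_ne_top.mpr hfin
  have hfi : Integrable (fun γ => f (x + spherePt h (s, γ))) (haarSO n) := by
    have := hd.add hgi
    refine this.congr (Eventually.of_forall fun γ => ?_)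
    simp
  rw [sphMean, sphMean, ← integral_sub hfi hgi]
  exact enorm_integral_le_lintegral_enorm _

/-- Polar coordinates on the shell, where the Jacobian s^(n-1) is at least (t/2)^(n-1). -/
theorem sphMeanE_shell_le {n k : ℕ} (hk : 1 ≤ k) (h : k < n) {t : ℝ} (ht : 0 < t) :
    ∃ C : ℝ, 0 < C ∧ ∀ b : E n → ℝ≥0∞, Measurable b → ∀ (x : E n) (δ : ℝ), δ ≤ t / 2 →
      ∫⁻ s in Set.Icc (t - δ) (t + δ), sphMeanE h b x s ≤
        ENNReal.ofReal C * ∫⁻ y in {y : E n | |‖y‖ - t| ≤ δ}, b (x + y) := by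
  have hn := sphereArea_pos (d := n) (by omega)
  set c := sphereArea n * (t / 2) ^ (n - 1) with hc
  have hc0 : 0 < c := by positivity
  refine ⟨c⁻¹, inv_pos.mpr hc0, fun b hb x δ hδ => ?_⟩
  set S : Set (E n) := {y : E n | |‖y‖ - t| ≤ δ}
  have hS : MeasurableSet S := measurableSet_le
    (f := fun y : E n => |‖y‖ - t|) (g := fun _ => δ) (by fun_prop) measurable_const
  have hbx : Measurable fun y => b (x + y) := hb.comp (measurable_const_add x)
  have key : ENNReal.ofReal c * ∫⁻ s in Set.Icc (t - δ) (t + δ), sphMeanE h b x s ≤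
      ∫⁻ y in S, b (x + y) := by
    rw [← lintegral_indicator hS, lintegral_eq_polar hk h _ (hbx.indicator hS), hc,
      ENNReal.ofReal_mul hn.le, mul_assoc]
    gcongr ENNReal.ofReal (sphereArea n) * ?_
    rw [← lintegral_const_mul' _ _ ENNReal.ofReal_ne_top]
    calc ∫⁻ s in Set.Icc (t - δ) (t + δ), ENNReal.ofReal ((t / 2) ^ (n - 1)) * sphMeanE h b x s
        ≤ ∫⁻ s in Set.Icc (t - δ) (t + δ), ENNReal.ofReal (s ^ (n - 1)) *
            ∫⁻ γ, S.indicator (fun y => b (x + y)) (spherePt h (s, γ)) ∂(haarSO n) := by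
          refine setLIntegral_mono' measurableSet_Icc fun s hs => ?_
          have hs2 : t / 2 ≤ s := by linarith [hs.1]
          gcongr
          refine lintegral_mono fun γ => ?_
          have hmem : spherePt h (s, γ) ∈ S := by
            change |‖spherePt h (s, γ)‖ - t| ≤ δ
            rw [norm_spherePt, abs_of_nonneg (by linarith : (0 : ℝ) ≤ s), abs_le]
            constructor <;> linarith [hs.1, hs.2]
          rw [Set.indicator_of_mem hmem]
      _ ≤ _ := by
          refine lintegral_mono_set fun s hs => ?_
          exact Set.mem_Ioi.mpr (by linarith [hs.1])
  calc ∫⁻ s in Set.Icc (t - δ) (t + δ), sphMeanE h b x s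
      = ENNReal.ofReal c⁻¹ * (ENNReal.ofReal c *
          ∫⁻ s in Set.Icc (t - δ) (t + δ), sphMeanE h b x s) := by
        rw [← mul_assoc, ← ENNReal.ofReal_mul (by positivity), inv_mul_cancel₀ hc0.ne',
          ENNReal.ofReal_one, one_mul]
    _ ≤ _ := by gcongr

/-- Approximate f by continuous compactly supported functions gⱼ, whose spherical means are
continuous in the radius. The error f - gⱼ enters through its shell averages, controlled by cap
integrals, and through its mean over the sphere of radius t itself. -/
theorem ae_isLebesguePoint_of_integrable {m k : ℕ} (hk : 1 ≤ k) (h : k < m + 1) {t : ℝ} (ht : 0 < t)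
    {f : E (m + 1) → 𝕜} (hf : StronglyMeasurable f) (hfi : Integrable f) :
    ∀ᵐ x, IsLebesguePoint (sphMean h f x) t := by
  have hex : ∀ j : ℕ, ∃ g : E (m + 1) → 𝕜, HasCompactSupport g ∧
      ∫⁻ x, ‖f x - g x‖ₑ ≤ ENNReal.ofReal ((1 / 2) ^ j) ∧ Continuous g ∧ Integrable g :=
    fun j => hfi.exists_hasCompactSupport_lintegral_sub_le (by simp)
  choose g hgc hgl hg _ using hex
  set b : ℕ → E (m + 1) → ℝ≥0∞ := fun j x => ‖f x - g j x‖ₑ with hbdef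
  have hb : ∀ j, Measurable (b j) := fun j => (hf.measurable.sub (hg j).measurable).enorm
  have hbi : ∀ j, ∫⁻ x, b j x ≠ ∞ := fun j => ((hgl j).trans_lt ENNReal.ofReal_lt_top).ne
  obtain ⟨C, hC, hshell⟩ := ae_eventually_shell_le (m := m) ht
  obtain ⟨C', hC', hpolar⟩ := sphMeanE_shell_le hk h ht
  -- R j collects both error contributions. Its integral is at most K 2^(-j), so the sum over j is
  -- finite almost everywhere and R j x tends to 0 for almost every x.
  set R : ℕ → E (m + 1) → ℝ≥0∞ := fun j x =>
    ENNReal.ofReal C * ∑ z : Fin (m + 1) × Bool, capIntegral t (b j) z.1 z.2 x +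
      sphMeanE h (b j) x t with hR
  have hcapm : ∀ j (z : Fin (m + 1) × Bool), Measurable (capIntegral t (b j) z.1 z.2) :=
    fun j z => measurable_capIntegral t (hb j) z.1 z.2
  have hRm : ∀ j, Measurable (R j) := fun j =>
    ((Finset.measurable_sum _ fun z _ => hcapm j z).const_mul _).add
      (measurable_sphMeanE h (hb j) t)
  set K : ℝ≥0∞ := ENNReal.ofReal C * ∑ _z : Fin (m + 1) × Bool, volume (capSet m t) + 1 with hK
  have hKtop : K ≠ ∞ := by
    refine ENNReal.add_ne_top.mpr ⟨ENNReal.mul_ne_top ENNReal.ofReal_ne_top ?_, ENNReal.one_ne_top⟩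
    exact ENNReal.sum_ne_top.mpr fun z _ => (volume_capSet_lt_top m ht).ne
  have hRi : ∀ j, ∫⁻ x, R j x = K * ∫⁻ x, b j x := by
    intro j
    simp only [hR]
    rw [lintegral_add_right _ (measurable_sphMeanE h (hb j) t), lintegral_sphMeanE h (hb j),
      lintegral_const_mul' _ _ ENNReal.ofReal_ne_top,
      lintegral_finsetSum _ fun z _ => hcapm j z]
    simp only [lintegral_capIntegral t (hb j)]
    rw [hK, ← Finset.sum_mul, add_mul, one_mul, mul_assoc]
  have hsum : ∫⁻ x, ∑' j, R j x ≠ ∞ := by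
    rw [lintegral_tsum fun j => (hRm j).aemeasurable]
    simp only [hRi]
    rw [ENNReal.tsum_mul_left]
    refine ENNReal.mul_ne_top hKtop (ne_top_of_le_ne_top ?_ (ENNReal.tsum_le_tsum hgl))
    exact (summable_geometric_of_lt_one (by norm_num) (by norm_num)).tsum_ofReal_ne_top
  have hae1 := ae_lt_top (Measurable.tsum hRm) hsum
  have hae2 := ae_all_iff.mpr fun j => hshell (b j) (hb j) (hbi j)
  filter_upwards [hae1, hae2] with x hx1 hx2
  have hR0 := ENNReal.tendsto_atTop_zero_of_tsum_ne_top hx1.ne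
  intro ε hε
  -- The final bound is (2C' + 4) η l.
  set η : ℝ := ε / (4 * C' + 4) with hη
  have hη0 : 0 < η := by positivity
  obtain ⟨j, hj⟩ := (hR0.eventually (gt_mem_nhds (ENNReal.ofReal_pos.mpr hη0))).exists
  have hj1 : ENNReal.ofReal C * ∑ z : Fin (m + 1) × Bool, capIntegral t (b j) z.1 z.2 x <
      ENNReal.ofReal η := lt_of_le_of_lt le_self_add hj
  have hj2 : sphMeanE h (b j) x t ≤ ENNReal.ofReal η := (lt_of_le_of_lt le_add_self hj).le
  obtain ⟨i₀, hi₀⟩ := eventually_atTop.mp (hx2 j _ hj1)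
  obtain ⟨δ, hδ, hcont⟩ := Metric.continuousAt_iff.mp
    ((continuous_sphMean h (hg j) (hgc j) x).continuousAt (x := t)) η hη0
  refine ⟨min (min δ (t / 2)) (1 / 2 ^ i₀), by positivity, fun l hl0 hl => ?_⟩
  have hlδ : l < δ := hl.trans_le ((min_le_left _ _).trans (min_le_left _ _))
  have hlt : l < t / 2 := hl.trans_le ((min_le_left _ _).trans (min_le_right _ _))
  have hli : l < 1 / 2 ^ i₀ := hl.trans_le (min_le_right _ _)
  -- Shell averages are controlled only for dyadic thickness. Enlarging l to the next dyadic number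
  -- costs a factor 2.
  obtain ⟨i, hi1, hi2⟩ : ∃ i : ℕ, 1 / 2 ^ (i + 1) < l ∧ l ≤ 1 / 2 ^ i := by
    have hl1 : l ≤ 1 := hli.le.trans (by
      rw [div_le_one (by positivity)]; exact one_le_pow₀ (by norm_num))
    obtain ⟨i, hi⟩ := exists_nat_pow_near_of_lt_one hl0 hl1 (y := (1 / 2 : ℝ)) (by norm_num)
      (by norm_num)
    exact ⟨i, by simpa using hi⟩
  have hii : i₀ ≤ i := by
    by_contra hlt'
    have h1 : i + 1 ≤ i₀ := by omega
    have h2 : (1 : ℝ) / 2 ^ i₀ ≤ 1 / 2 ^ (i + 1) := by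
      gcongr
      norm_num
    linarith
  have hsh : ∫⁻ y in {y : E (m + 1) | |‖y‖ - t| ≤ l}, b j (x + y) ≤ ENNReal.ofReal (2 * l * η) := by
    have h1 := (hi₀ i hii).le
    calc ∫⁻ y in {y : E (m + 1) | |‖y‖ - t| ≤ l}, b j (x + y)
        ≤ ∫⁻ y in {y : E (m + 1) | |‖y‖ - t| ≤ 1 / 2 ^ i}, b j (x + y) :=
          lintegral_mono_set fun y hy => le_trans hy hi2
      _ = ENNReal.ofReal (1 / 2 ^ i) * (ENNReal.ofReal (2 ^ i) *
            ∫⁻ y in {y : E (m + 1) | |‖y‖ - t| ≤ 1 / 2 ^ i}, b j (x + y)) := by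
          rw [← mul_assoc, ← ENNReal.ofReal_mul (by positivity),
            one_div_mul_cancel (by positivity), ENNReal.ofReal_one, one_mul]
      _ ≤ ENNReal.ofReal (1 / 2 ^ i) * ENNReal.ofReal η := by gcongr
      _ ≤ _ := by
          rw [← ENNReal.ofReal_mul (by positivity)]
          refine ENNReal.ofReal_le_ofReal ?_
          gcongr
          have : (1 : ℝ) / 2 ^ i = 2 * (1 / 2 ^ (i + 1)) := by rw [pow_succ]; field_simp
          linarith
  have hpt : ∀ s ∈ Set.Icc (t - l) (t + l), ‖sphMean h f x s - sphMean h f x t‖ₑ ≤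
      sphMeanE h (b j) x s + ENNReal.ofReal (2 * η) := by
    intro s hs
    have e : sphMean h f x s - sphMean h f x t = (sphMean h f x s - sphMean h (g j) x s) +
        ((sphMean h (g j) x s - sphMean h (g j) x t) -
          (sphMean h f x t - sphMean h (g j) x t)) := by ring
    have h1 : ‖sphMean h (g j) x s - sphMean h (g j) x t‖ₑ ≤ ENNReal.ofReal η := by
      rw [← ofReal_norm, ← dist_eq_norm]
      refine ENNReal.ofReal_le_ofReal (hcont ?_).le
      rw [Real.dist_eq, abs_lt]
      constructor <;> linarith [hs.1, hs.2]
    rw [e]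
    refine (enorm_add_le _ _).trans ?_
    gcongr
    · exact enorm_sphMean_sub_le h hf (hg j) (hgc j) x s
    · refine (enorm_sub_le).trans ?_
      rw [two_mul, ENNReal.ofReal_add hη0.le hη0.le]
      gcongr
      exact (enorm_sphMean_sub_le h hf (hg j) (hgc j) x t).trans hj2
  calc ∫⁻ s in Set.Icc (t - l) (t + l), ‖sphMean h f x s - sphMean h f x t‖ₑ
      ≤ ∫⁻ s in Set.Icc (t - l) (t + l), (sphMeanE h (b j) x s + ENNReal.ofReal (2 * η)) :=
        setLIntegral_mono' measurableSet_Icc hpt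
    _ = (∫⁻ s in Set.Icc (t - l) (t + l), sphMeanE h (b j) x s) +
          ENNReal.ofReal (2 * η) * ENNReal.ofReal (2 * l) := by
        rw [lintegral_add_right _ measurable_const, setLIntegral_const, Real.volume_Icc]
        congr 3; ring
    _ ≤ ENNReal.ofReal C' * ENNReal.ofReal (2 * l * η) +
          ENNReal.ofReal (2 * η) * ENNReal.ofReal (2 * l) := by
        gcongr
        exact (hpolar (b j) (hb j) x l hlt.le).trans (by gcongr)
    _ ≤ ENNReal.ofReal (ε * l) := by
        rw [← ENNReal.ofReal_mul hC'.le, ← ENNReal.ofReal_mul (by positivity),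
          ← ENNReal.ofReal_add (by positivity) (by positivity)]
        refine ENNReal.ofReal_le_ofReal ?_
        have : ε = η * (4 * C' + 4) := by rw [hη]; field_simp
        rw [this]
        nlinarith [mul_pos hη0 hl0, mul_pos (mul_pos hη0 hl0) hC']

/-- For every radius, almost every center makes the radius a Lebesgue point of the spherical
mean. -/
theorem ae_isLebesguePoint_sphMean {n k : ℕ} (hk : 1 ≤ k) (h : k < n) {t : ℝ} (ht : 0 < t)
    {f : E n → 𝕜} (hf : LocallyIntegrable f volume) :
    ∀ᵐ x, IsLebesguePoint (sphMean h f x) t := by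
  obtain ⟨m, rfl⟩ : ∃ m, n = m + 1 := ⟨n - 1, by omega⟩
  set f' := hf.aestronglyMeasurable.mk f with hf'
  have hff' : f =ᵐ[volume] f' := hf.aestronglyMeasurable.ae_eq_mk
  have hf'm : StronglyMeasurable f' := hf.aestronglyMeasurable.stronglyMeasurable_mk
  have hR : ∀ R : ℕ, ∀ᵐ x, IsLebesguePoint
      (sphMean h ((Metric.ball 0 (R : ℝ)).indicator f') x) t := by
    intro R
    refine ae_isLebesguePoint_of_integrable hk h ht (hf'm.indicator measurableSet_ball) ?_
    rw [integrable_indicator_iff measurableSet_ball]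
    refine IntegrableOn.congr_fun_ae ?_ (ae_restrict_of_ae hff')
    exact (hf.integrableOn_isCompact (isCompact_closedBall 0 (R : ℝ))).mono_set
      Metric.ball_subset_closedBall
  filter_upwards [ae_all_iff.mpr hR, ae_ae_sphere h hff' t] with x hx hxt
  -- All spheres about x of radius below 2t lie in this ball, so truncating f' does not affect the
  -- means near t.
  obtain ⟨R, hRx⟩ := exists_nat_gt (‖x‖ + 2 * t)
  have h1 : IsLebesguePoint (sphMean h f' x) t := by
    refine (hx R).congr_ae (S := Set.Ioo 0 (2 * t)) (Ioo_mem_nhds ht (by linarith))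
      ?_ ?_
    · filter_upwards [ae_restrict_mem measurableSet_Ioo] with s hs
      refine sphMean_congr (Eventually.of_forall fun γ => Set.indicator_of_mem ?_ _)
      rw [mem_ball_zero_iff]
      refine (norm_add_le _ _).trans_lt ?_
      rw [norm_spherePt, abs_of_pos hs.1]
      linarith [hs.2]
    · refine sphMean_congr (Eventually.of_forall fun γ => Set.indicator_of_mem ?_ _)
      rw [mem_ball_zero_iff]
      refine (norm_add_le _ _).trans_lt ?_
      rw [norm_spherePt, abs_of_pos ht]
      linarith
  refine h1.congr_ae (S := Set.Ioi 0) (Ioi_mem_nhds ht) ?_ ?_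
  · filter_upwards [ae_radius_ae_sphere hk h hff' x] with s hs
    exact sphMean_congr (hs.mono fun γ hγ => hγ.symm)
  · exact sphMean_congr (hxt.mono fun γ hγ => hγ.symm)


/-! ### Absolute convergence of the dual mean -/

theorem ae_sphMeanE_congr {n k : ℕ} (hk : 1 ≤ k) (h : k < n) {g g' : E n → ℝ≥0∞}
    (hg : g =ᵐ[volume] g') (x : E n) :
    ∀ᵐ s ∂(volume.restrict (Set.Ioi (0 : ℝ))), sphMeanE h g x s = sphMeanE h g' x s := by
  filter_upwards [ae_radius_ae_sphere hk h hg x] with s hs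
  exact lintegral_congr_ae hs

/-- Hölder's inequality: with q conjugate to p, the weight lies in L^q when rq > n, which is n(p -
1) < pr. For p = 1 the weight is merely bounded by 1. -/
theorem lintegral_bracket_mul_lt_top {n : ℕ} {p : ℝ} (hp : 1 ≤ p) {r : ℝ} (hr : 0 ≤ r)
    (hpr : n * (p - 1) < p * r) {f : E n → 𝕜} (hf : MemLp f (ENNReal.ofReal p) volume) (x : E n) :
    ∫⁻ y, ENNReal.ofReal ((1 + ‖y‖) ^ (-r)) * ‖f (x + y)‖ₑ < ∞ := by
  have hp0 : 0 < p := by linarith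
  have hfx : MemLp (fun y => f (x + y)) (ENNReal.ofReal p) volume :=
    hf.comp_measurePreserving (measurePreserving_add_left volume x)
  rcases hp.eq_or_lt with rfl | hp1
  · rw [ENNReal.ofReal_one] at hfx
    have h1 := hfx.2
    rw [eLpNorm_one_eq_lintegral_enorm] at h1
    refine lt_of_le_of_lt (lintegral_mono fun y => ?_) h1
    refine mul_le_of_le_one_left' ?_
    rw [← ENNReal.ofReal_one]
    refine ENNReal.ofReal_le_ofReal ?_
    exact Real.rpow_le_one_of_one_le_of_nonpos (by linarith [norm_nonneg y]) (neg_nonpos.mpr hr)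
  · have hpq := Real.HolderConjugate.conjExponent hp1
    set q := p.conjExponent with hq
    have hq0 : 0 < q := hpq.symm.pos
    have hqe : q * (p - 1) = p := by
      rw [hq, Real.conjExponent]; field_simp [(by linarith : p - 1 ≠ 0)]
    have h1 := ENNReal.lintegral_mul_le_Lp_mul_Lq volume hpq.symm
      (f := fun y : E n => ENNReal.ofReal ((1 + ‖y‖) ^ (-r))) (g := fun y => ‖f (x + y)‖ₑ)
      (by fun_prop) hfx.1.enorm
    refine lt_of_le_of_lt h1 (ENNReal.mul_lt_top ?_ ?_)
    · refine ENNReal.rpow_lt_top_of_nonneg (by positivity) (ne_of_lt ?_)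
      have hfin : (Module.finrank ℝ (E n) : ℝ) < r * q := by
        rw [finrank_euclideanSpace_fin]
        have : (n : ℝ) * (p - 1) < (r * q) * (p - 1) := by rw [mul_assoc, hqe]; linarith
        exact lt_of_mul_lt_mul_right this (by linarith)
      refine lt_of_le_of_lt (le_of_eq (lintegral_congr fun y => ?_))
        (finite_integral_one_add_norm (E := E n) (μ := volume) hfin)
      have : (0 : ℝ) < 1 + ‖y‖ := by positivity
      rw [ENNReal.ofReal_rpow_of_nonneg (by positivity) hq0.le, ← Real.rpow_mul this.le, neg_mul]
    · refine ENNReal.rpow_lt_top_of_nonneg (by positivity) (ne_of_lt ?_)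
      have := lintegral_rpow_enorm_lt_top_of_eLpNorm_lt_top (by simpa using hp0)
        ENNReal.ofReal_ne_top hfx.2
      rwa [ENNReal.toReal_ofReal hp0.le] at this

/-- On s > a the power s^(j-1) is bounded by a multiple of s^(n-1)(1 + s)^(-(n-j)), so polar
coordinates lead to `lintegral_bracket_mul_lt_top` with r = n - j. Its condition then reads pj < n.
-/
theorem lintegral_pow_sphMeanE_lt_top {n k : ℕ} (hk : 1 ≤ k) (h : k < n) {p : ℝ} (hp : 1 ≤ p)
    {j : ℕ} (hj : 1 ≤ j) (hpj : p * j < n) {f : E n → 𝕜}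
    (hf : MemLp f (ENNReal.ofReal p) volume) (x : E n) {a : ℝ} (ha : 0 < a) :
    ∫⁻ s in Set.Ioi a, ENNReal.ofReal (s ^ (j - 1)) * sphMeanE h (fun y => ‖f y‖ₑ) x s < ∞ := by
  have hjn : j < n := by
    have : (j : ℝ) ≤ p * j := le_mul_of_one_le_left (by positivity) hp
    exact_mod_cast this.trans_lt hpj
  set f' := hf.1.mk f with hf'
  have hff' : f =ᵐ[volume] f' := hf.1.ae_eq_mk
  have hf'm : StronglyMeasurable f' := hf.1.stronglyMeasurable_mk
  have hf'p : MemLp f' (ENNReal.ofReal p) volume := hf.ae_eq hff'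
  set r : ℝ := (n : ℝ) - j with hr
  have hr0 : 0 ≤ r := by
    have : (j : ℝ) ≤ n := by exact_mod_cast hjn.le
    linarith
  have hrn : r = ((n - j : ℕ) : ℝ) := by rw [Nat.cast_sub hjn.le]
  have hmain := lintegral_bracket_mul_lt_top hp hr0 (by rw [hr]; nlinarith) hf'p x
  have hgm : Measurable fun y : E n => ENNReal.ofReal ((1 + ‖y‖) ^ (-r)) * ‖f' (x + y)‖ₑ := by
    have := hf'm.measurable
    fun_prop
  rw [lintegral_eq_polar hk h _ hgm] at hmain
  have hmain' := (ENNReal.mul_lt_top_iff.mp hmain)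
  have hA : ENNReal.ofReal (sphereArea n) ≠ 0 := by
    simpa using sphereArea_pos (d := n) (by omega)
  have hfin : ∫⁻ s in Set.Ioi (0 : ℝ), ENNReal.ofReal (s ^ (n - 1)) *
      ∫⁻ γ, ENNReal.ofReal ((1 + ‖spherePt h (s, γ)‖) ^ (-r)) * ‖f' (x + spherePt h (s, γ))‖ₑ
        ∂(haarSO n) < ∞ := by
    rcases hmain' with h1 | h1 | h1
    · exact h1.2
    · exact absurd h1 hA
    · rw [h1]; exact ENNReal.zero_lt_top
  -- For s ≥ a one has (1 + a)s ≥ a(1 + s).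
  set c : ℝ := ((1 + a) / a) ^ (n - j) with hc
  have hcpos : 0 < c := by positivity
  calc ∫⁻ s in Set.Ioi a, ENNReal.ofReal (s ^ (j - 1)) * sphMeanE h (fun y => ‖f y‖ₑ) x s
      = ∫⁻ s in Set.Ioi a, ENNReal.ofReal (s ^ (j - 1)) * sphMeanE h (fun y => ‖f' y‖ₑ) x s := by
        refine lintegral_congr_ae ?_
        have := ae_sphMeanE_congr hk h (hff'.fun_comp (fun z : 𝕜 => ‖z‖ₑ)) x
        filter_upwards [ae_restrict_of_ae_restrict_of_subset
          (Set.Ioi_subset_Ioi ha.le) this] with s hs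
        exact congrArg _ hs
    _ ≤ ∫⁻ s in Set.Ioi a, ENNReal.ofReal c * (ENNReal.ofReal (s ^ (n - 1)) *
          ∫⁻ γ, ENNReal.ofReal ((1 + ‖spherePt h (s, γ)‖) ^ (-r)) *
            ‖f' (x + spherePt h (s, γ))‖ₑ ∂(haarSO n)) := by
        refine setLIntegral_mono' measurableSet_Ioi fun s hs => ?_
        have has : a < s := hs
        have hs0 : 0 < s := ha.trans has
        simp only [norm_spherePt, abs_of_pos hs0]
        rw [lintegral_const_mul' _ _ ENNReal.ofReal_ne_top, ← mul_assoc, ← mul_assoc,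
          ← ENNReal.ofReal_mul hcpos.le, ← ENNReal.ofReal_mul (by positivity)]
        refine mul_le_mul_left (ENNReal.ofReal_le_ofReal ?_) _
        have e1 : s ^ (n - 1) = s ^ (j - 1) * s ^ (n - j) := by
          rw [← pow_add]; congr 1; omega
        have e2 : (1 + s) ^ (-r) = ((1 + s) ^ (n - j))⁻¹ := by
          rw [hrn, Real.rpow_neg (by positivity), Real.rpow_natCast]
        have e3 : c * s ^ (n - 1) * (1 + s) ^ (-r) =
            s ^ (j - 1) * ((1 + a) / a * s / (1 + s)) ^ (n - j) := by
          rw [e1, e2, hc, div_pow, div_pow, mul_pow, div_pow]; field_simp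
        rw [e3]
        refine le_mul_of_one_le_right (by positivity) (one_le_pow₀ ?_)
        rw [le_div_iff₀ (by positivity), div_mul_eq_mul_div, le_div_iff₀ ha]
        nlinarith
    _ = ENNReal.ofReal c * ∫⁻ s in Set.Ioi a, (ENNReal.ofReal (s ^ (n - 1)) *
          ∫⁻ γ, ENNReal.ofReal ((1 + ‖spherePt h (s, γ)‖) ^ (-r)) *
            ‖f' (x + spherePt h (s, γ))‖ₑ ∂(haarSO n)) :=
        lintegral_const_mul' _ _ ENNReal.ofReal_ne_top
    _ < ∞ := ENNReal.mul_lt_top ENNReal.ofReal_lt_top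
        (lt_of_le_of_lt (lintegral_mono_set (Set.Ioi_subset_Ioi ha.le)) hfin)

theorem integrableOn_pow_smul_sphMean {n k : ℕ} (hk : 1 ≤ k) (h : k < n) {p : ℝ} (hp : 1 ≤ p)
    {j : ℕ} (hj : 1 ≤ j) (hpj : p * j < n) {f : E n → 𝕜}
    (hf : MemLp f (ENNReal.ofReal p) volume) (x : E n) {a : ℝ} (ha : 0 < a) :
    IntegrableOn (fun s => s ^ (j - 1) • sphMean h f x s) (Set.Ioi a) := by
  refine ⟨?_, ?_⟩
  · exact (continuous_pow _).aestronglyMeasurable.smul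
      ((aestronglyMeasurable_sphMean hk h hf.1 x).mono_measure
        (Measure.restrict_mono (Set.Ioi_subset_Ioi ha.le) le_rfl))
  · rw [hasFiniteIntegral_iff_enorm]
    refine lt_of_le_of_lt (setLIntegral_mono' measurableSet_Ioi fun s hs => ?_)
      (lintegral_pow_sphMeanE_lt_top hk h hp hj hpj hf x ha)
    have hs0 : 0 < s := ha.trans hs
    rw [enorm_smul, Real.enorm_of_nonneg (by positivity)]
    gcongr
    exact enorm_sphMean_le h f x s

/-- The weight of the polar form of the dual mean. -/
def radialWeight (k : ℕ) (t s : ℝ) : ℝ := (s ^ 2 - t ^ 2) ^ ((k : ℝ) / 2 - 1) * s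

theorem radialWeight_le_of_two_le {k : ℕ} (hk : 2 ≤ k) {t s : ℝ} (ht : 0 < t) (hs : t < s) :
    radialWeight k t s ≤ s ^ (k - 1) := by
  have hs0 : 0 < s := ht.trans hs
  have hk' : (2 : ℝ) ≤ k := by exact_mod_cast hk
  have h1 : (s ^ 2 - t ^ 2) ^ ((k : ℝ) / 2 - 1) ≤ (s ^ 2) ^ ((k : ℝ) / 2 - 1) :=
    Real.rpow_le_rpow (by nlinarith) (by nlinarith) (by linarith)
  have h2 : (s ^ 2) ^ ((k : ℝ) / 2 - 1) = s ^ (k - 2) := by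
    rw [← Real.rpow_natCast s 2, ← Real.rpow_mul hs0.le, ← Real.rpow_natCast s (k - 2),
      Nat.cast_sub hk]
    congr 1; push_cast; ring
  calc radialWeight k t s ≤ s ^ (k - 2) * s := by
        rw [radialWeight, ← h2]; gcongr
    _ = s ^ (k - 1) := by rw [← pow_succ]; congr 1; omega

/-- For k ≥ 2 the weight has no singularity at s = t, and convergence holds at every centre and
radius. -/
theorem lintegral_radialWeight_lt_top_of_two_le {n k : ℕ} (hk : 2 ≤ k) (h : k < n) {p : ℝ}
    (hp : 1 ≤ p) (hpk : p * k < n) {f : E n → 𝕜} (hf : MemLp f (ENNReal.ofReal p) volume)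
    (x : E n) {t : ℝ} (ht : 0 < t) :
    ∫⁻ s in Set.Ioi t, ENNReal.ofReal (radialWeight k t s) *
      sphMeanE h (fun y => ‖f y‖ₑ) x s < ∞ := by
  refine lt_of_le_of_lt (setLIntegral_mono' measurableSet_Ioi fun s hs => ?_)
    (lintegral_pow_sphMeanE_lt_top (by omega) h hp (by omega) hpk hf x ht)
  gcongr
  exact radialWeight_le_of_two_le hk ht hs

theorem lintegral_radialWeight_Ioc_lt_top {k : ℕ} (hk : 1 ≤ k) {t : ℝ} (ht : 0 < t) :
    ∫⁻ s in Set.Ioc t (2 * t), ENNReal.ofReal (radialWeight k t s) < ∞ := by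
  have h1 := lintegral_sqrt_change hk ht.le ((Set.Iic (2 * t)).indicator 1)
  have h2 : ∫⁻ s in Set.Ioc t (2 * t), ENNReal.ofReal (radialWeight k t s) =
      ∫⁻ s in Set.Ioi t, ENNReal.ofReal ((s ^ 2 - t ^ 2) ^ ((k : ℝ) / 2 - 1) * s) *
        (Set.Iic (2 * t)).indicator 1 s := by
    rw [← Set.Ioi_inter_Iic, Set.inter_comm, ← setLIntegral_indicator measurableSet_Iic]
    refine lintegral_congr fun s => ?_
    by_cases hs : s ∈ Set.Iic (2 * t)
    · simp only [Set.indicator_of_mem hs, radialWeight, Pi.one_apply, mul_one]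
    · simp only [Set.indicator_of_notMem hs, mul_zero]
  rw [h2, ← h1]
  calc ∫⁻ ρ in Set.Ioi (0 : ℝ), ENNReal.ofReal (ρ ^ (k - 1)) *
        (Set.Iic (2 * t)).indicator 1 √(t ^ 2 + ρ ^ 2)
      ≤ ∫⁻ ρ in Set.Ioi (0 : ℝ), (Set.Iic (2 * t)).indicator
          (fun _ => ENNReal.ofReal ((2 * t) ^ (k - 1))) ρ := by
        refine setLIntegral_mono' measurableSet_Ioi fun ρ hρ => ?_
        have hρ0 : 0 < ρ := hρ
        by_cases hm : √(t ^ 2 + ρ ^ 2) ∈ Set.Iic (2 * t)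
        · have hρt : ρ ≤ 2 * t := by
            refine le_trans ?_ (Set.mem_Iic.mp hm)
            exact Real.le_sqrt_of_sq_le (by nlinarith)
          rw [Set.indicator_of_mem hm, Set.indicator_of_mem (Set.mem_Iic.mpr hρt), Pi.one_apply,
            mul_one]
          gcongr
        · rw [Set.indicator_of_notMem hm, mul_zero]; exact zero_le
    _ = ENNReal.ofReal ((2 * t) ^ (k - 1)) * ENNReal.ofReal (2 * t) := by
        rw [setLIntegral_indicator measurableSet_Iic, setLIntegral_const, Set.inter_comm,
          Set.Ioi_inter_Iic, Real.volume_Ioc, sub_zero]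
    _ < ∞ := ENNReal.mul_lt_top ENNReal.ofReal_lt_top ENNReal.ofReal_lt_top

/-- After truncating f to a ball, integration over x replaces each spherical mean by the total
integral, and the weight is integrable near t. Hence the integral is finite for almost every x even
where the weight is singular. -/
theorem ae_lintegral_radialWeight_Ioc_lt_top {n k : ℕ} (hk : 1 ≤ k) (h : k < n) {f : E n → 𝕜}
    (hf : LocallyIntegrable f volume) {t : ℝ} (ht : 0 < t) :
    ∀ᵐ x, ∫⁻ s in Set.Ioc t (2 * t), ENNReal.ofReal (radialWeight k t s) *
      sphMeanE h (fun y => ‖f y‖ₑ) x s < ∞ := by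
  set f' := hf.aestronglyMeasurable.mk f with hf'
  have hff' : f =ᵐ[volume] f' := hf.aestronglyMeasurable.ae_eq_mk
  have hf'm : StronglyMeasurable f' := hf.aestronglyMeasurable.stronglyMeasurable_mk
  have hω : Measurable fun s => ENNReal.ofReal (radialWeight k t s) := by
    unfold radialWeight; fun_prop
  have hR : ∀ R : ℕ, ∀ᵐ x, ∫⁻ s in Set.Ioc t (2 * t), ENNReal.ofReal (radialWeight k t s) *
      sphMeanE h ((Metric.ball 0 (R : ℝ)).indicator fun y => ‖f' y‖ₑ) x s < ∞ := by
    intro R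
    set g := (Metric.ball (0 : E n) (R : ℝ)).indicator fun y => ‖f' y‖ₑ with hg
    have hgm : Measurable g := hf'm.measurable.enorm.indicator measurableSet_ball
    have hgi : ∫⁻ y, g y < ∞ := by
      rw [hg, lintegral_indicator measurableSet_ball]
      have : IntegrableOn f' (Metric.ball 0 (R : ℝ)) :=
        IntegrableOn.congr_fun_ae ((hf.integrableOn_isCompact
          (isCompact_closedBall 0 (R : ℝ))).mono_set Metric.ball_subset_closedBall)
          (ae_restrict_of_ae hff')
      exact hasFiniteIntegral_iff_enorm.mp this.2
    have hjm : Measurable fun z : E n × ℝ => sphMeanE h g z.1 z.2 := by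
      refine Measurable.lintegral_prod_right'
        (f := fun w : (E n × ℝ) × SO n => g (w.1.1 + spherePt h (w.1.2, w.2))) (hgm.comp ?_)
      exact (measurable_fst.comp measurable_fst).add
        ((continuous_spherePt h).measurable.comp (by fun_prop))
    have hFm : Measurable fun z : E n × ℝ =>
        ENNReal.ofReal (radialWeight k t z.2) * sphMeanE h g z.1 z.2 :=
      (hω.comp measurable_snd).mul hjm
    refine ae_lt_top (Measurable.lintegral_prod_right' hFm) (ne_of_lt ?_)
    rw [lintegral_lintegral_swap (f := fun x s =>
      ENNReal.ofReal (radialWeight k t s) * sphMeanE h g x s) hFm.aemeasurable]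
    have : ∀ s, ∫⁻ x, ENNReal.ofReal (radialWeight k t s) * sphMeanE h g x s =
        ENNReal.ofReal (radialWeight k t s) * ∫⁻ x, g x := fun s => by
      rw [lintegral_const_mul' _ _ ENNReal.ofReal_ne_top, lintegral_sphMeanE h hgm]
    simp only [this]
    rw [lintegral_mul_const' _ _ hgi.ne]
    exact ENNReal.mul_lt_top (lintegral_radialWeight_Ioc_lt_top hk ht) hgi
  filter_upwards [ae_all_iff.mpr hR] with x hx
  obtain ⟨R, hRx⟩ := exists_nat_gt (‖x‖ + 2 * t)
  refine lt_of_le_of_lt (le_of_eq ?_) (hx R)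
  refine lintegral_congr_ae ?_
  have h1 := ae_sphMeanE_congr hk h (hff'.fun_comp (fun z : 𝕜 => ‖z‖ₑ)) x
  have hsub : Set.Ioc t (2 * t) ⊆ Set.Ioi 0 := fun s hs => ht.trans hs.1
  filter_upwards [ae_restrict_of_ae_restrict_of_subset hsub h1,
    ae_restrict_mem measurableSet_Ioc] with s hs hst
  refine (congrArg _ hs).trans (congrArg _ (lintegral_congr fun γ => ?_))
  refine (Set.indicator_of_mem (s := Metric.ball (0 : E n) (R : ℝ))
    (f := fun y => ‖f' y‖ₑ) ?_).symm
  rw [mem_ball_zero_iff]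
  refine (norm_add_le _ _).trans_lt ?_
  rw [norm_spherePt, abs_of_pos (ht.trans hst.1)]
  linarith [hst.2]

theorem radialWeight_one_le {t s : ℝ} (ht : 0 < t) (hs : 2 * t < s) : radialWeight 1 t s ≤ 2 := by
  have hs0 : 0 < s := by linarith
  have h1 : (s / 2) ^ 2 ≤ s ^ 2 - t ^ 2 := by nlinarith
  have h2 : (s ^ 2 - t ^ 2) ^ (((1 : ℕ) : ℝ) / 2 - 1) ≤ ((s / 2) ^ 2) ^ (((1 : ℕ) : ℝ) / 2 - 1) :=
    Real.rpow_le_rpow_of_nonpos (by positivity) h1 (by norm_num)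
  have h3 : ((s / 2) ^ 2) ^ (((1 : ℕ) : ℝ) / 2 - 1) = (s / 2)⁻¹ := by
    rw [← Real.rpow_natCast (s / 2) 2, ← Real.rpow_mul (by positivity), ← Real.rpow_neg_one]
    norm_num
  calc radialWeight 1 t s ≤ (s / 2)⁻¹ * s := by rw [radialWeight, ← h3]; gcongr
    _ = 2 := by field_simp

theorem ae_lintegral_radialWeight_lt_top {n k : ℕ} (hk : 1 ≤ k) (h : k < n) {p : ℝ}
    (hp : 1 ≤ p) (hpk : p * k < n) {f : E n → 𝕜} (hf : MemLp f (ENNReal.ofReal p) volume)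
    {t : ℝ} (ht : 0 < t) :
    ∀ᵐ x, ∫⁻ s in Set.Ioi t, ENNReal.ofReal (radialWeight k t s) *
      sphMeanE h (fun y => ‖f y‖ₑ) x s < ∞ := by
  -- Only k = 1 has a singular weight. The integral is then split at 2t, beyond which the weight is
  -- at most 2.
  rcases hk.eq_or_lt with rfl | hk2
  · have hloc : LocallyIntegrable f volume :=
      hf.locallyIntegrable (by rw [← ENNReal.ofReal_one]; exact ENNReal.ofReal_le_ofReal hp)
    filter_upwards [ae_lintegral_radialWeight_Ioc_lt_top le_rfl h hloc ht] with x hx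
    rw [← Set.Ioc_union_Ioi_eq_Ioi (by linarith : t ≤ 2 * t)]
    refine lt_of_le_of_lt (lintegral_union_le _ _ _) (ENNReal.add_lt_top.mpr ⟨hx, ?_⟩)
    have h1 := lintegral_pow_sphMeanE_lt_top le_rfl h hp le_rfl hpk hf x
      (by linarith : 0 < 2 * t)
    simp only [le_refl, tsub_eq_zero_of_le, pow_zero, ENNReal.ofReal_one, one_mul] at h1
    refine lt_of_le_of_lt (setLIntegral_mono' measurableSet_Ioi fun s hs => ?_)
      (lt_of_eq_of_lt (lintegral_const_mul' (ENNReal.ofReal 2) _ ENNReal.ofReal_ne_top)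
        (ENNReal.mul_lt_top ENNReal.ofReal_lt_top h1))
    gcongr
    exact radialWeight_one_le ht hs
  · exact Eventually.of_forall fun x =>
      lintegral_radialWeight_lt_top_of_two_le hk2 h hp hpk hf x ht


/-! ### Convergence of spherical means in `L^p` -/

theorem eLpNorm_rpow_eq_lintegral {α : Type*} [MeasurableSpace α] {μ : Measure α} {p : ℝ}
    (hp : 0 < p) (f : α → 𝕜) :
    eLpNorm f (ENNReal.ofReal p) μ ^ p = ∫⁻ x, ‖f x‖ₑ ^ p ∂μ := by
  rw [eLpNorm_eq_lintegral_rpow_enorm_toReal (by simpa using hp) ENNReal.ofReal_ne_top,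
    ENNReal.toReal_ofReal hp.le, ← ENNReal.rpow_mul, one_div_mul_cancel hp.ne', ENNReal.rpow_one]

/-- Jensen's inequality, in the form of the monotonicity of L^p norms on a probability space. -/
theorem enorm_integral_rpow_le {α : Type*} [MeasurableSpace α] {μ : Measure α}
    [IsProbabilityMeasure μ] {p : ℝ} (hp : 1 ≤ p) {u : α → 𝕜} (hu : AEStronglyMeasurable u μ) :
    ‖∫ a, u a ∂μ‖ₑ ^ p ≤ ∫⁻ a, ‖u a‖ₑ ^ p ∂μ := by
  have hp0 : 0 < p := by linarith
  rw [← eLpNorm_rpow_eq_lintegral hp0]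
  gcongr
  refine (enorm_integral_le_lintegral_enorm _).trans ?_
  rw [← eLpNorm_one_eq_lintegral_enorm]
  refine eLpNorm_le_eLpNorm_of_exponent_le ?_ hu
  rw [← ENNReal.ofReal_one]
  exact ENNReal.ofReal_le_ofReal hp

/-- Translations act continuously on `L^p`. -/
theorem tendsto_eLpNorm_translate_sub {n : ℕ} {p : ℝ} (hp : 1 ≤ p) {f : E n → 𝕜}
    (hf : MemLp f (ENNReal.ofReal p) volume) :
    Tendsto (fun y : E n => eLpNorm (fun x => f (x + y) - f x) (ENNReal.ofReal p) volume)
      (𝓝 0) (𝓝 0) := by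
  have : Fact ((1 : ℝ≥0∞) ≤ ENNReal.ofReal p) :=
    ⟨by rw [← ENNReal.ofReal_one]; exact ENNReal.ofReal_le_ofReal hp⟩
  have : Fact (ENNReal.ofReal p ≠ ∞) := ⟨ENNReal.ofReal_ne_top⟩
  have hcont : Continuous fun y : E n => DomAddAct.mk y +ᵥ hf.toLp f :=
    (continuous_vadd (M := (E n)ᵈᵃᵃ) (X := Lp 𝕜 (ENNReal.ofReal p) (volume : Measure (E n)))).comp
      ((DomAddAct.continuous_mk).prodMk continuous_const)
  have h1 := (hcont.edist continuous_const : Continuous fun y : E n =>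
    edist (DomAddAct.mk y +ᵥ hf.toLp f) (hf.toLp f)).tendsto 0
  rw [DomAddAct.mk_zero, zero_vadd, edist_self] at h1
  refine h1.congr fun y => ?_
  rw [DomAddAct.mk_vadd_toLp, Lp.edist_toLp_toLp]
  refine congrArg (fun u => eLpNorm u _ _) (funext fun x => ?_)
  simp [add_comm]

theorem ae_eq_sphMean {n k : ℕ} (h : k < n) {f f' : E n → 𝕜} (hff' : f =ᵐ[volume] f') (t : ℝ) :
    (fun x => sphMean h f x t) =ᵐ[volume] fun x => sphMean h f' x t := by
  filter_upwards [ae_ae_sphere h hff' t] with x hx using sphMean_congr hx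

theorem measurable_add_spherePt {n k : ℕ} (h : k < n) (t : ℝ) :
    Measurable fun z : E n × SO n => z.1 + spherePt h (t, z.2) :=
  measurable_fst.add ((continuous_spherePt h).measurable.comp (by fun_prop))

theorem aestronglyMeasurable_sphMean_center {n k : ℕ} (h : k < n) {f : E n → 𝕜}
    (hf : AEStronglyMeasurable f volume) (t : ℝ) :
    AEStronglyMeasurable (fun x => sphMean h f x t) volume := by
  refine AEStronglyMeasurable.congr ?_ (ae_eq_sphMean h hf.ae_eq_mk t).symm
  exact (hf.stronglyMeasurable_mk.comp_measurable
    (measurable_add_spherePt h t)).aestronglyMeasurable.integral_prod_right'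

theorem eLpNorm_sphMean_sub_rpow_le {n k : ℕ} (h : k < n) {p : ℝ} (hp : 1 ≤ p) {f : E n → 𝕜}
    (hf : MemLp f (ENNReal.ofReal p) volume) (t : ℝ) :
    eLpNorm (fun x => sphMean h f x t - f x) (ENNReal.ofReal p) volume ^ p ≤
      ∫⁻ γ, eLpNorm (fun x => f (x + spherePt h (t, γ)) - f x) (ENNReal.ofReal p) volume ^ p
        ∂(haarSO n) := by
  have hp0 : 0 < p := by linarith
  set f' := hf.1.mk f
  have hff' : f =ᵐ[volume] f' := hf.1.ae_eq_mk
  have hf'm : StronglyMeasurable f' := hf.1.stronglyMeasurable_mk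
  have hf'p : MemLp f' (ENNReal.ofReal p) volume := hf.ae_eq hff'
  have hpow : Measurable fun y => ‖f' y‖ₑ ^ p := hf'm.measurable.enorm.pow_const p
  -- On almost every sphere of radius t the function is in L^p of a probability measure, hence
  -- integrable. This lets f' x be moved under the mean before Jensen is applied.
  have hslice : ∀ᵐ x, Integrable (fun γ => f' (x + spherePt h (t, γ))) (haarSO n) := by
    have hfin : ∫⁻ x, sphMeanE h (fun y => ‖f' y‖ₑ ^ p) x t ≠ ∞ := by
      rw [lintegral_sphMeanE h hpow, ← eLpNorm_rpow_eq_lintegral hp0]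
      exact ENNReal.rpow_ne_top_of_nonneg hp0.le hf'p.2.ne
    filter_upwards [ae_lt_top (measurable_sphMeanE h hpow t) hfin] with x hx
    have hm : AEStronglyMeasurable (fun γ => f' (x + spherePt h (t, γ))) (haarSO n) :=
      (hf'm.comp_measurable ((measurable_add_spherePt h t).comp
        measurable_prodMk_left)).aestronglyMeasurable
    have hLp : MemLp (fun γ => f' (x + spherePt h (t, γ))) (ENNReal.ofReal p) (haarSO n) := by
      refine ⟨hm, ?_⟩
      rw [← ENNReal.rpow_lt_top_iff_of_pos hp0, eLpNorm_rpow_eq_lintegral hp0]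
      exact hx
    exact hLp.integrable (by rw [← ENNReal.ofReal_one]; exact ENNReal.ofReal_le_ofReal hp)
  have hum : StronglyMeasurable fun z : E n × SO n => f' (z.1 + spherePt h (t, z.2)) - f' z.1 :=
    (hf'm.comp_measurable (measurable_add_spherePt h t)).sub (hf'm.comp_measurable measurable_fst)
  calc eLpNorm (fun x => sphMean h f x t - f x) (ENNReal.ofReal p) volume ^ p
      = ∫⁻ x, ‖sphMean h f' x t - f' x‖ₑ ^ p := by
        rw [eLpNorm_rpow_eq_lintegral hp0]
        refine lintegral_congr_ae ?_
        filter_upwards [ae_eq_sphMean h hff' t, hff'] with x h1 h2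
        rw [h2]; exact congrArg (fun z => ‖z - f' x‖ₑ ^ p) h1
    _ ≤ ∫⁻ x, ∫⁻ γ, ‖f' (x + spherePt h (t, γ)) - f' x‖ₑ ^ p ∂(haarSO n) := by
        refine lintegral_mono_ae ?_
        filter_upwards [hslice] with x hx
        have e : sphMean h f' x t - f' x =
            ∫ γ, (f' (x + spherePt h (t, γ)) - f' x) ∂(haarSO n) := by
          rw [integral_sub hx (integrable_const _)]; simp [sphMean]
        rw [e]
        exact enorm_integral_rpow_le hp
          (hum.comp_measurable measurable_prodMk_left).aestronglyMeasurable
    _ = ∫⁻ γ, (∫⁻ x, ‖f' (x + spherePt h (t, γ)) - f' x‖ₑ ^ p) ∂(haarSO n) :=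
        lintegral_lintegral_swap (f := fun x γ => ‖f' (x + spherePt h (t, γ)) - f' x‖ₑ ^ p)
          (hum.measurable.enorm.pow_const p).aemeasurable
    _ = _ := by
        refine lintegral_congr fun γ => ?_
        rw [eLpNorm_rpow_eq_lintegral hp0]
        refine lintegral_congr_ae ?_
        have h1 := (measurePreserving_add_right (volume : Measure (E n))
          (spherePt h (t, γ))).quasiMeasurePreserving.ae hff'
        filter_upwards [h1, hff'] with x h1 h2
        rw [h1, h2]

theorem memLp_sphMean {n k : ℕ} (h : k < n) {p : ℝ} (hp : 1 ≤ p) {f : E n → 𝕜}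
    (hf : MemLp f (ENNReal.ofReal p) volume) (t : ℝ) :
    MemLp (fun x => sphMean h f x t) (ENNReal.ofReal p) volume := by
  have hp0 : 0 < p := by linarith
  have hq : (1 : ℝ≥0∞) ≤ ENNReal.ofReal p := by
    rw [← ENNReal.ofReal_one]; exact ENNReal.ofReal_le_ofReal hp
  have hd : MemLp (fun x => sphMean h f x t - f x) (ENNReal.ofReal p) volume := by
    refine ⟨(aestronglyMeasurable_sphMean_center h hf.1 t).sub hf.1, ?_⟩
    rw [← ENNReal.rpow_lt_top_iff_of_pos hp0]
    refine (eLpNorm_sphMean_sub_rpow_le h hp hf t).trans_lt ?_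
    have hb : ∀ γ : SO n,
        eLpNorm (fun x => f (x + spherePt h (t, γ)) - f x) (ENNReal.ofReal p) volume ^ p ≤
          (eLpNorm f (ENNReal.ofReal p) volume + eLpNorm f (ENNReal.ofReal p) volume) ^ p := by
      intro γ
      have hmp := measurePreserving_add_right (volume : Measure (E n)) (spherePt h (t, γ))
      gcongr
      refine (eLpNorm_sub_le (hf.1.comp_measurePreserving hmp) hf.1 hq).trans ?_
      rw [eLpNorm_comp_measurePreserving hf.1 hmp]
    refine (lintegral_mono hb).trans_lt ?_
    rw [lintegral_const, measure_univ, mul_one]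
    exact ENNReal.rpow_lt_top_of_nonneg hp0.le (ENNReal.add_ne_top.mpr ⟨hf.2.ne, hf.2.ne⟩)
  convert! hd.add hf using 1
  funext x
  simp

theorem tendsto_eLpNorm_sphMean_sub {n k : ℕ} (h : k < n) {p : ℝ} (hp : 1 ≤ p) {f : E n → 𝕜}
    (hf : MemLp f (ENNReal.ofReal p) volume) :
    Tendsto (fun t => eLpNorm (fun x => sphMean h f x t - f x) (ENNReal.ofReal p) volume)
      (𝓝[>] 0) (𝓝 0) := by
  have hp0 : 0 < p := by linarith
  rw [ENNReal.tendsto_nhds_zero]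
  intro ε hε
  obtain ⟨δ, hδ, hd⟩ := Metric.eventually_nhds_iff.mp
    (ENNReal.tendsto_nhds_zero.mp (tendsto_eLpNorm_translate_sub hp hf) ε hε)
  filter_upwards [Ioo_mem_nhdsGT hδ] with t ht
  rw [← ENNReal.rpow_le_rpow_iff hp0]
  refine (eLpNorm_sphMean_sub_rpow_le h hp hf t).trans ?_
  calc ∫⁻ γ, eLpNorm (fun x => f (x + spherePt h (t, γ)) - f x) (ENNReal.ofReal p) volume ^ p
        ∂(haarSO n) ≤ ∫⁻ _γ, ε ^ p ∂(haarSO n) := by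
        refine lintegral_mono fun γ => ?_
        gcongr
        refine hd ?_
        rw [dist_zero_right, norm_spherePt, abs_of_pos ht.1]
        exact ht.2
    _ = ε ^ p := by simp

/-- Once a derivative is identified with the spherical mean at each radius for almost every centre,
all claims about L^p are those for spherical means, whatever the expression used. -/
theorem recoversInLp_of_eq_sphMean {n k : ℕ} (h : k < n) {p : ℝ} (hp : 1 ≤ p) {f : E n → 𝕜}
    (hf : MemLp f (ENNReal.ofReal p) volume) {φ : KPlane n k → 𝕜} {𝒟 : (ℝ → 𝕜) → ℝ → 𝕜}
    {dom : (ℝ → 𝕜) → ℝ → Prop}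
    (H : ∀ t : ℝ, 0 < t → ∀ᵐ x, dom (dualMean h φ x) t ∧
      𝒟 (dualMean h φ x) t = Real.pi ^ ((k : ℝ) / 2) • sphMean h f x t) :
    RecoversInLp h p φ f 𝒟 dom := by
  have hval : ∀ t : ℝ, 0 < t → (fun x => sphMean h f x t) =ᵐ[volume]
      fun x => Real.pi ^ (-(k : ℝ) / 2) • 𝒟 (dualMean h φ x) t := by
    intro t ht
    filter_upwards [H t ht] with x hx
    rw [hx.2, smul_smul, ← Real.rpow_add Real.pi_pos, neg_div, neg_add_cancel, Real.rpow_zero,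
      one_smul]
  refine ⟨fun t ht => (H t ht).mono fun x hx => hx.1,
    fun t ht => (memLp_sphMean h hp hf t).ae_eq (hval t ht), ?_⟩
  refine (tendsto_eLpNorm_sphMean_sub h hp hf).congr' ?_
  filter_upwards [self_mem_nhdsWithin] with t ht
  refine eLpNorm_congr_ae ?_
  filter_upwards [hval t ht] with x hx
  rw [hx]

end
end KPlaneTransform

/-! ### The inversion theorem -/

open KPlaneTransform in
theorem theorem3p5 {𝕜 : Type*} [RCLike 𝕜] {n k : ℕ} (hk : 1 ≤ k) (hkn : k < n)
    (p : ℝ) (hp : 1 ≤ p) (hpn : p < (n : ℝ) / k)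
    (f : E n → 𝕜) (hf : MemLp f (ENNReal.ofReal p) volume) :
    (∀ᵐ x : E n, ∀ᵐ t ∂(volume.restrict (Set.Ioi (0 : ℝ))), DualMeanConverges hkn f x t) ∧
    (∀ t : ℝ, 0 < t → ∀ᵐ x : E n, DualMeanConverges hkn f x t) ∧
    (Even k →
      (∀ᵐ x : E n, ∀ t : ℝ, 0 < t → DualMeanConverges hkn f x t) ∧
      RecoversInLp hkn p (kPlaneTransform k f) f (evenForm k) (EvenFormExists k)) ∧
    RecoversInLp hkn p (kPlaneTransform k f) f (weightedForm k) (WeightedFormExists k) ∧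
    RecoversInLp hkn p (kPlaneTransform k f) f (ordinaryForm k) (OrdinaryFormExists k) ∧
    (p < (n : ℝ) / (2 + 2 * (k / 2 : ℕ)) →
      RecoversInLp hkn p (kPlaneTransform k f) f (directForm k) (DirectFormExists k)) := by
  have hpk : p * k < n := (lt_div_iff₀ (by positivity)).mp hpn
  have hloc : LocallyIntegrable f volume :=
    hf.locallyIntegrable (by rw [← ENNReal.ofReal_one]; exact ENNReal.ofReal_le_ofReal hp)
  have hGm : ∀ x, AEStronglyMeasurable (sphMean hkn f x) (volume.restrict (Set.Ioi (0 : ℝ))) :=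
    aestronglyMeasurable_sphMean hk hkn hf.1
  have hG : ∀ x (a : ℝ), 0 < a →
      IntegrableOn (fun s => s ^ (k - 1) • sphMean hkn f x s) (Set.Ioi a) :=
    fun x a ha => integrableOn_pow_smul_sphMean hk hkn hp hk hpk hf x ha
  -- No centre is excluded here: only the radii are exceptional. The formula at almost every radius
  -- suffices for the three expressions that begin with an integral.
  have hae : ∀ x, ∀ᵐ t ∂(volume.restrict (Set.Ioi (0 : ℝ))), DualMeanConverges hkn f x t ∧
      dualMean hkn (kPlaneTransform k f) x t =
        ∫ s in Set.Ioi t, meanKernel k t s • sphMean hkn f x s := by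
    intro x
    filter_upwards [ae_lintegral_kernel_lt_top hk (aemeasurable_sphMeanE hk hkn hf.1.enorm x)
      fun a ha => lintegral_pow_sphMeanE_lt_top hk hkn hp hk hpk hf x ha,
      ae_restrict_mem measurableSet_Ioi] with t h1 ht
    exact dualMean_eq hk hkn hf.1 x ht h1
  have hLeb : ∀ t : ℝ, 0 < t → ∀ᵐ x, IsLebesguePoint (sphMean hkn f x) t :=
    fun t ht => ae_isLebesguePoint_sphMean hk hkn ht hloc
  refine ⟨Eventually.of_forall fun x => (hae x).mono fun t ht => ht.1, fun t ht => ?_,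
    fun hev => ?_, ?_, ?_, fun hp2 => ?_⟩
  · filter_upwards [ae_lintegral_radialWeight_lt_top hk hkn hp hpk hf ht] with x hx
    exact (dualMean_eq hk hkn hf.1 x ht hx).1
  · have hk2 : 2 ≤ k := by obtain ⟨l, hl⟩ := hev; omega
    have hall : ∀ x (t : ℝ), 0 < t → DualMeanConverges hkn f x t ∧
        dualMean hkn (kPlaneTransform k f) x t =
          ∫ s in Set.Ioi t, meanKernel k t s • sphMean hkn f x s := fun x t ht =>
      dualMean_eq hk hkn hf.1 x ht (lintegral_radialWeight_lt_top_of_two_le hk2 hkn hp hpk hf x ht)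
    refine ⟨Eventually.of_forall fun x t ht => (hall x t ht).1,
      recoversInLp_of_eq_sphMean hkn hp hf fun t ht => ?_⟩
    filter_upwards [hLeb t ht] with x hx
    exact evenForm_eq hk hev (hG x) (fun r hr => (hall x r hr).2) ht hx
  · refine recoversInLp_of_eq_sphMean hkn hp hf fun t ht => ?_
    filter_upwards [hLeb t ht] with x hx
    exact weightedForm_eq hk (hGm x) (hG x) ((hae x).mono fun t ht => ht.2) ht hx
  · refine recoversInLp_of_eq_sphMean hkn hp hf fun t ht => ?_
    filter_upwards [hLeb t ht] with x hx
    exact ordinaryForm_eq hk (hGm x) (hG x) ((hae x).mono fun t ht => ht.2) ht hx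
  · refine recoversInLp_of_eq_sphMean hkn hp hf fun t ht => ?_
    -- The growth s^(2m+1) required by `directForm_eq` is the case j = 2m + 2 of the integrability
    -- lemma.
    have hp3 : p * ((2 * (k / 2) + 2 : ℕ) : ℝ) < n := by
      have := (lt_div_iff₀ (by positivity)).mp hp2
      push_cast at this ⊢
      linarith
    filter_upwards [hLeb t ht] with x hx
    refine directForm_eq hk (hGm x) (fun a ha => ?_) ((hae x).mono fun t ht => ht.2) ht hx
    exact integrableOn_pow_smul_sphMean hk hkn hp (j := 2 * (k / 2) + 2) (by omega) hp3 hf x ha
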